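/- **Setting.** Let $\mathbb F$ be an arbitrary field (of any characteristic); all vector spaces are finite-dimensional over $\mathbb F$. Let $p,q\in\mathbb F[t]$ be monic of degree $2$, and put $\delta:=\operatorname{tr}p-\operatorname{tr}q$, where $\operatorname{tr}(t^2-\lambda t+\alpha)=\lambda$. A *$(p,q)$-difference* in an $\mathbb F$-algebra is an element $x_1-x_2$ with $p(x_1)=0=q(x_2)$. A *symplectic pair* $(b,u)$ is a symplectic (nondegenerate alternating) form $b$ on a space $V$ with an endomorphism $u$ of $V$ that is $b$-alternating, i.e. $b(x,u(x))=0$ for all $x\in V$. It is a *symplectic $(p,q)$-difference* if $u=u_1-u_2$ with $u_1,u_2$ $b$-alternating and $p(u_1)=0=q(u_2)$. An isometry $(b,u)\simeq(b',u')$ is a linear isomorphism that carries $b$ to $b'$ and $u$ to $u'$. A $(p,q)$-difference in $\operatorname{End}(V)$ is *indecomposable* if $V\neq 0$ and it is not similar to the direct sum of two $(p,q)$-differences on nonzero spaces; a symplectic $(p,q)$-difference is *indecomposable* if its space is nonzero and it is not isometric to the orthogonal direct sum of two symplectic $(p,q)$-differences on nonzero spaces. For $v\in\operatorname{End}(V)$,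 the pair $S(v)$ consists of the form $((x,\varphi),(y,\psi))\mapsto\varphi(y)-\psi(x)$ on $V\times V^\star$ and the endomorphism $h(v)=v\oplus v^t$. Let $F_{p,q}(t):=\operatorname{Res}_x(p(x),q(x-t))$; an endomorphism $u$ of $V$ is *$(p,q)$-exceptional* if $V=\bigcup_{n}\operatorname{Ker}F_{p,q}(u)^n$, and a pair $(b,u)$ is exceptional if $u$ is. $C(r)$ is the companion matrix of the monic polynomial $r$ ($C(1)$ is the $0\times0$ matrix), and $\oplus$ is the block-diagonal sum of matrices. **Theorem.** Assume that at least one of $p$ and $q$ has a root in $\mathbb F$. 1. Let $v$ be a $(p,q)$-exceptional endomorphism of a vector space $V$. Then $v$ is a $(p,q)$-difference in $\operatorname{End}(V)$ if and only if $S(v)$ is a symplectic $(p,q)$-difference. 2. Let $v$ be a $(p,q)$-exceptional endomorphism of a vector space $V$. Then $v$ is an indecomposable $(p,q)$-difference if and only if $S(v)$ is an indecomposable symplectic $(p,q)$-difference. 3. In each case below, each listed matrix represents an endomorphism $v$ such that $S(v)$ is an indecomposable exceptional symplectic $(p,q)$-difference, and every indecomposable exceptional symplectic $(p,q)$-difference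 is isometric to $S(v)$ for some $v$ represented by a listed matrix. In (a)–(c), $x$ ranges over $\{a-b : p(a)=0=q(b)\}\subseteq\mathbb F$; $n$ is a non-negative integer, subject to the restrictions indicated. - (a) $p$ and $q$ both split over $\mathbb F$ with a double root: $C((t-x)^n)$, $n\ge1$. - (b) $p$ and $q$ both split over $\mathbb F$ with simple roots: $C((t-x)^n)\oplus C((t-\delta+x)^n)$ with $n\ge2$ and $x\ne\delta-x$; $C((t-x)^{n+1})\oplus C((t-\delta+x)^n)$ with $n\ge0$ and $x\neq\delta-x$; $C((t-x)^n)$ with $n\ge1$ and $x=\delta-x$. - (c) One of $p,q$ splits over $\mathbb F$ with a double root and the other splits over $\mathbb F$ with simple roots: $C((t-x)^n)\oplus C((t-\delta+x)^n)$ with $n\ge3$; $C((t-x)^{n+1})\oplus C((t-\delta+x)^n)$ with $n\ge0$, $n\ne1$; $C((t-x)^{n+2})\oplus C((t-\delta+x)^n)$ with $n\ge0$. - (d) $p$ is irreducible and $q=(t-y_1)(t-y_2)$ with $y_1,y_2\in\mathbb F$; put $r_i:=p(t+y_i)$. If $r_1=r_2$: $C(r_1^n)$ with $n\ge1$. If $r_1\ne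 r_2$: $C(r_1^n)\oplus C(r_2^n)$ with $n\ge2$; $C(r_1^{n+1})\oplus C(r_2^n)$ and $C(r_2^{n+1})\oplus C(r_1^n)$ with $n\ge0$. - (e) $q$ is irreducible and $p=(t-x_1)(t-x_2)$ with $x_1,x_2\in\mathbb F$; put $r_i:=q(x_i-t)$. The matrices are the ones of (d) for these $r_1,r_2$. -/

import Mathlib

open Polynomial

universe u v w

noncomputable section

/-- The fundamental polynomial `Res_{F[t]}(p(x), q(x - t))`: here the outer variable `X` of
`F[t][X]` plays the role of `x`, and `C X` plays the role of `t`. -/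
def fundamentalPolynomial {F : Type u} [Field F] (p q : F[X]) : F[X] :=
  resultant (p.map (C : F →+* F[X])) ((q.map (C : F →+* F[X])).comp (X - C X))

/-- `v` is `(p,q)`-exceptional: `V` is the union of the kernels of the powers of `F_{p,q}(v)`. -/
def IsExceptional {F : Type u} [Field F] (p q : F[X])
    {V : Type v} [AddCommGroup V] [Module F V] (v : Module.End F V) : Prop :=
  (⋃ n : ℕ, (LinearMap.ker ((aeval v (fundamentalPolynomial p q)) ^ n) : Set V)) = Set.univ

/-- `(p,q)`-differences in an `F`-algebra. -/
def IsDifference {F : Type u} [Field F] (p q : F[X])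
    {A : Type v} [Ring A] [Algebra F A] (x : A) : Prop :=
  ∃ x₁ x₂ : A, aeval x₁ p = 0 ∧ aeval x₂ q = 0 ∧ x = x₁ - x₂

/-- Similarity of endomorphisms of possibly distinct vector spaces. -/
def IsSimilar {F : Type u} [Field F]
    {V : Type v} [AddCommGroup V] [Module F V] {W : Type w} [AddCommGroup W] [Module F W]
    (f : Module.End F V) (g : Module.End F W) : Prop :=
  ∃ φ : V ≃ₗ[F] W, ∀ x, g (φ x) = φ (f x)

/-- An indecomposable `(p,q)`-difference: a `(p,q)`-difference on a nonzero space that is not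
similar to the direct sum of two `(p,q)`-differences on nonzero spaces. -/
def IsIndecomposableDifference {F : Type u} [Field F] (p q : F[X])
    {V : Type v} [AddCommGroup V] [Module F V] (f : Module.End F V) : Prop :=
  IsDifference p q f ∧ Nontrivial V ∧
    ¬ ∃ (V₁ V₂ : Type v) (_ : AddCommGroup V₁) (_ : AddCommGroup V₂)
        (_ : Module F V₁) (_ : Module F V₂) (f₁ : Module.End F V₁) (f₂ : Module.End F V₂),
        Nontrivial V₁ ∧ Nontrivial V₂ ∧ IsDifference p q f₁ ∧ IsDifference p q f₂ ∧
        IsSimilar f (LinearMap.prodMap f₁ f₂)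

/-- A symplectic pair `(b, u)` on the space `V`. -/
structure SymplecticPair (F : Type u) [Field F] (V : Type v) [AddCommGroup V] [Module F V] where
  /-- the symplectic form `b` -/
  form : LinearMap.BilinForm F V
  /-- the endomorphism `u` -/
  endo : Module.End F V
  isAlt : form.IsAlt
  nondegenerate : form.Nondegenerate
  endo_alternating : ∀ x, form x (endo x) = 0

namespace SymplecticPair

variable {F : Type u} [Field F]
  {V : Type v} [AddCommGroup V] [Module F V] {W : Type w} [AddCommGroup W] [Module F W]

/-- Isometry of symplectic pairs. -/
def IsIsometric (P : SymplecticPair F V) (Q : SymplecticPair F W) : Prop :=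
  ∃ φ : V ≃ₗ[F] W,
    (∀ x y, Q.form (φ x) (φ y) = P.form x y) ∧ ∀ x, Q.endo (φ x) = φ (P.endo x)

/-- The orthogonal direct sum of two symplectic pairs. -/
def orthogonalSum (P : SymplecticPair F V) (Q : SymplecticPair F W) :
    SymplecticPair F (V × W) where
  form := LinearMap.mk₂ F (fun x y => P.form x.1 y.1 + Q.form x.2 y.2)
    (fun x x' y => by simp; abel) (fun c x y => by simp [mul_add])
    (fun x y y' => by simp; abel) (fun c x y => by simp [mul_add])
  endo := LinearMap.prodMap P.endo Q.endo
  isAlt := fun x => by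
    simp [P.isAlt.self_eq_zero, Q.isAlt.self_eq_zero]
  nondegenerate := by
    refine ⟨fun x hx => ?_, fun y hy => ?_⟩
    · refine Prod.ext ?_ ?_
      · exact P.nondegenerate.1 _ fun y => by simpa using hx (y, 0)
      · exact Q.nondegenerate.1 _ fun y => by simpa using hx (0, y)
    · refine Prod.ext ?_ ?_
      · exact P.nondegenerate.2 _ fun x => by simpa using hy (x, 0)
      · exact Q.nondegenerate.2 _ fun x => by simpa using hy (0, x)
  endo_alternating := fun x => by
    simp [P.endo_alternating, Q.endo_alternating]

/-- Symplectic `(p,q)`-differences. -/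
def IsDifference (p q : F[X]) (P : SymplecticPair F V) : Prop :=
  ∃ u₁ u₂ : Module.End F V,
    (∀ x, P.form x (u₁ x) = 0) ∧ (∀ x, P.form x (u₂ x) = 0) ∧
    aeval u₁ p = 0 ∧ aeval u₂ q = 0 ∧ P.endo = u₁ - u₂

/-- Indecomposable symplectic `(p,q)`-differences. -/
def IsIndecomposableDifference (p q : F[X]) (P : SymplecticPair F V) : Prop :=
  P.IsDifference p q ∧ Nontrivial V ∧
    ¬ ∃ (V₁ V₂ : Type v) (_ : AddCommGroup V₁) (_ : AddCommGroup V₂)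
        (_ : Module F V₁) (_ : Module F V₂) (P₁ : SymplecticPair F V₁) (P₂ : SymplecticPair F V₂),
        Nontrivial V₁ ∧ Nontrivial V₂ ∧ P₁.IsDifference p q ∧ P₂.IsDifference p q ∧
        P.IsIsometric (P₁.orthogonalSum P₂)

end SymplecticPair

/-- The symplectic extension `S(v)` of `v`: the form `((x,φ),(y,ψ)) ↦ φ y - ψ x` on
`V × V*`, with the endomorphism `v ⊕ vᵗ`. -/
def symplecticExtension {F : Type u} [Field F]
    {V : Type v} [AddCommGroup V] [Module F V] (f : Module.End F V) :
    SymplecticPair F (V × Module.Dual F V) where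
  form := LinearMap.mk₂ F (fun x y => x.2 y.1 - y.2 x.1)
    (fun x x' y => by simp; ring) (fun c x y => by simp; ring)
    (fun x y y' => by simp; ring) (fun c x y => by simp; ring)
  endo := LinearMap.prodMap f (Module.Dual.transpose f)
  isAlt := fun x => by simp
  nondegenerate := by
    refine ⟨fun x hx => ?_, fun y hy => ?_⟩
    · refine Prod.ext ?_ ?_
      · exact (Module.forall_dual_apply_eq_zero_iff F x.1).1 fun φ => by simpa using hx (0, φ)
      · exact LinearMap.ext fun z => by simpa using hx (z, 0)
    · refine Prod.ext ?_ ?_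
      · exact (Module.forall_dual_apply_eq_zero_iff F y.1).1 fun φ => by simpa using hy (0, φ)
      · exact LinearMap.ext fun z => by simpa using hy (z, 0)
  endo_alternating := fun x => by simp [Module.Dual.transpose_apply]

/-- Square matrices of arbitrary size (the size `0` is allowed). -/
abbrev SquareMatrix (F : Type u) : Type u := Σ n : ℕ, Matrix (Fin n) (Fin n) F

section Matrices

variable {F : Type u} [Field F]

/-- The companion matrix `C(r)` of the monic polynomial `r`: ones below the diagonal, and
the opposites of the coefficients of `r` in the last column. -/
def companion (r : F[X]) : SquareMatrix F :=
  ⟨r.natDegree, Matrix.of fun i j =>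
    if (j : ℕ) + 1 = r.natDegree then - r.coeff i
    else if (i : ℕ) = (j : ℕ) + 1 then 1 else 0⟩

/-- The block-diagonal sum of two square matrices. -/
def blockSum (M N : SquareMatrix F) : SquareMatrix F :=
  ⟨M.1 + N.1, Matrix.reindex finSumFinEquiv finSumFinEquiv (Matrix.fromBlocks M.2 0 0 N.2)⟩

/-- The endomorphism of `F ^ n` represented by a square matrix. -/
def SquareMatrix.toEnd (M : SquareMatrix F) : Module.End F (Fin M.1 → F) := Matrix.toLin' M.2

/-- The set `Root(p) - Root(q)`, for polynomials that split over `F`. -/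
def rootDifferences (p q : F[X]) : Set F := {x | ∃ a b, p.IsRoot a ∧ q.IsRoot b ∧ x = a - b}

/-- `p` and `q` both split with a double root. -/
def tableDoubleDouble (p q : F[X]) : Set (SquareMatrix F) :=
  {M | ∃ n : ℕ, ∃ x ∈ rootDifferences p q, 1 ≤ n ∧ M = companion ((X - C x) ^ n)}

/-- `p` and `q` both split with simple roots; `δ = tr p - tr q`. -/
def tableSimpleSimple (p q : F[X]) (δ : F) : Set (SquareMatrix F) :=
  {M | ∃ n : ℕ, ∃ x ∈ rootDifferences p q,
    (2 ≤ n ∧ x ≠ δ - x ∧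
      M = blockSum (companion ((X - C x) ^ n)) (companion ((X - C (δ - x)) ^ n))) ∨
    (x ≠ δ - x ∧
      M = blockSum (companion ((X - C x) ^ (n + 1))) (companion ((X - C (δ - x)) ^ n))) ∨
    (1 ≤ n ∧ x = δ - x ∧ M = companion ((X - C x) ^ n))}

/-- One of `p` and `q` splits with a double root, the other one with simple roots;
`δ = tr p - tr q`. -/
def tableSimpleDouble (p q : F[X]) (δ : F) : Set (SquareMatrix F) :=
  {M | ∃ n : ℕ, ∃ x ∈ rootDifferences p q,
    (3 ≤ n ∧
      M = blockSum (companion ((X - C x) ^ n)) (companion ((X - C (δ - x)) ^ n))) ∨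
    (n ≠ 1 ∧
      M = blockSum (companion ((X - C x) ^ (n + 1))) (companion ((X - C (δ - x)) ^ n))) ∨
    M = blockSum (companion ((X - C x) ^ (n + 2))) (companion ((X - C (δ - x)) ^ n))}

/-- `F_{p,q} = r ^ 2` with `r` irreducible of degree `2`. -/
def tableIrredSame (r : F[X]) : Set (SquareMatrix F) :=
  {M | ∃ n : ℕ, 1 ≤ n ∧ M = companion (r ^ n)}

/-- `F_{p,q} = r₁ r₂` with distinct monic irreducible `r₁` and `r₂` of degree `2`. -/
def tableIrredDistinct (r₁ r₂ : F[X]) : Set (SquareMatrix F) :=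
  {M | ∃ n : ℕ,
    (2 ≤ n ∧ M = blockSum (companion (r₁ ^ n)) (companion (r₂ ^ n))) ∨
    M = blockSum (companion (r₁ ^ (n + 1))) (companion (r₂ ^ n)) ∨
    M = blockSum (companion (r₂ ^ (n + 1))) (companion (r₁ ^ n))}

/-- The matrices in `T` classify the indecomposable exceptional symplectic `(p,q)`-differences:
each of them represents some `f` such that `S(f)` is one, and every one of them is isometric
to such an `S(f)`. -/
def ClassifiesExceptional (p q : F[X]) (T : Set (SquareMatrix F)) : Prop :=
  (∀ M ∈ T,
    (symplecticExtension (SquareMatrix.toEnd M)).IsIndecomposableDifference p q ∧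
    IsExceptional p q (symplecticExtension (SquareMatrix.toEnd M)).endo) ∧
  ∀ (W : Type w) [AddCommGroup W] [Module F W] [FiniteDimensional F W] (P : SymplecticPair F W),
    P.IsIndecomposableDifference p q → IsExceptional p q P.endo →
    ∃ M ∈ T, P.IsIsometric (symplecticExtension (SquareMatrix.toEnd M))

/-- The trace of a monic polynomial of positive degree. -/
def polyTrace (p : F[X]) : F := - p.coeff (p.natDegree - 1)

end Matrices

end

/-! ### Similarity, direct sums and transposes of endomorphisms. -/

section Similarity

variable {F : Type u} [Field F] {V W V' W' U : Type*}
  [AddCommGroup V] [Module F V] [AddCommGroup W] [Module F W]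
  [AddCommGroup V'] [Module F V'] [AddCommGroup W'] [Module F W'] [AddCommGroup U] [Module F U]

/-! Put δ = tr p - tr q. If u = u₁ - u₂ is a difference, the commutator T = u₁u₂ - u₂u₁ satisfies Tu
= (δ - u)T and T² = F_{p,q}(u) (`commutator_relations`). So T carries the primary part of u at an
irreducible r to the one at its reflection r' under t ↦ δ - t, and conversely, with a controlled
loss of rank. If r ≠ r' has multiplicity e in F_{p,q}, comparing ranks gives, for every k, at most
as many r-blocks of size > k + e as r'-blocks of size > k (`kerDim_interlacing`). For given p and q
one e serves all such r.

On the symplectic side, b(x, uⁿx) = 0 for all n, so cyclic subspaces are totally isotropic. Two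
vectors of maximal r-primary order that are dual to each other therefore span a copy of S(C(r^m)),
which splits off orthogonally (`SymplecticPair.exists_isIsometric_orthogonalSum_companion`).
Iterating, and pairing the largest r-block with the largest r'-block, turns an exceptional
symplectic difference into an orthogonal sum of pairs S(C(r^m) ⊕ C(r'^m')) whose sizes differ by at
most e, together with blocks S(C(r^m)) for r = r'. Interlacing survives the removal of each pair
(`SymplecticPair.exists_isIsometric_blockSumList`).

Conversely each of these blocks is a difference. For r ≠ r' the commutator relations dictate 2 × 2
operator matrices over F[t]/(r^m) × F[t]/(r^m') (`isDifference_blockSum`); for r = r' there are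
explicit constructions with shifts (`isDifference_companion`). Hence every exceptional symplectic
difference is S(M) for a difference M. As S(v) determines v up to similarity
(`isSimilar_of_isIsometric_symplecticExtension`), decompositions of S(v) and of v correspond, which
gives the first two assertions.

For the tables it remains to see which blocks are indecomposable. A pair with 1 ≤ m' ≤ m ≤ e splits,
because each companion block is then a difference by itself. In the other cases a splitting would
separate r from r' and contradict interlacing at k = 0 (`le_of_isSimilar_blockSum`). -/

theorem aeval_apply_of_intertwine {f : Module.End F V} {g : Module.End F W} (φ : V →ₗ[F] W)
    (h : ∀ x, g (φ x) = φ (f x)) (a : F[X]) (x : V) :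
    aeval g a (φ x) = φ (aeval f a x) := by
  induction a using Polynomial.induction_on' with
  | add a b ha hb => simp [ha, hb]
  | monomial n c =>
    have key : ∀ n : ℕ, ∀ x, (g ^ n) (φ x) = φ ((f ^ n) x) := by
      intro n
      induction n with
      | zero => intro x; simp
      | succ n ih => intro x; rw [pow_succ, pow_succ, Module.End.mul_apply, Module.End.mul_apply, h, ih]
    simp [aeval_monomial, key]

theorem IsSimilar.refl (f : Module.End F V) : IsSimilar f f := ⟨LinearEquiv.refl F V, fun _ => rfl⟩

theorem IsSimilar.symm {f : Module.End F V} {g : Module.End F W} (h : IsSimilar f g) :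
    IsSimilar g f := by
  obtain ⟨φ, h⟩ := h
  refine ⟨φ.symm, fun x => ?_⟩
  apply φ.injective
  rw [← h]; simp

theorem IsSimilar.trans {f : Module.End F V} {g : Module.End F W} {k : Module.End F U}
    (h : IsSimilar f g) (h' : IsSimilar g k) : IsSimilar f k := by
  obtain ⟨φ, h⟩ := h
  obtain ⟨ψ, h'⟩ := h'
  exact ⟨φ.trans ψ, fun x => by simp [h, h']⟩

theorem IsSimilar.prodMap {f : Module.End F V} {g : Module.End F W} {f' : Module.End F V'}
    {g' : Module.End F W'} (h : IsSimilar f f') (h' : IsSimilar g g') :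
    IsSimilar (LinearMap.prodMap f g) (LinearMap.prodMap f' g') := by
  obtain ⟨φ, h⟩ := h
  obtain ⟨ψ, h'⟩ := h'
  exact ⟨φ.prodCongr ψ, fun x => by simp [h, h']⟩

theorem isSimilar_prodMap_comm (f : Module.End F V) (g : Module.End F W) :
    IsSimilar (LinearMap.prodMap f g) (LinearMap.prodMap g f) :=
  ⟨LinearEquiv.prodComm F V W, fun x => by simp⟩

theorem isSimilar_prodMap_of_subsingleton [Subsingleton V] (f : Module.End F V)
    (g : Module.End F W) : IsSimilar g (LinearMap.prodMap f g) :=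
  ⟨{ toFun := fun x => (0, x), map_add' := by simp, map_smul' := by simp,
     invFun := fun x => x.2, left_inv := fun x => rfl,
     right_inv := fun x => Prod.ext (Subsingleton.elim _ _) rfl }, fun x => by simp⟩

theorem IsSimilar.aeval_eq_zero {f : Module.End F V} {g : Module.End F W} (h : IsSimilar f g)
    {a : F[X]} (ha : aeval f a = 0) : aeval g a = 0 := by
  obtain ⟨φ, h⟩ := h
  ext y
  obtain ⟨x, rfl⟩ := φ.surjective y
  have := aeval_apply_of_intertwine (φ : V →ₗ[F] W) h a x
  simp only [LinearEquiv.coe_coe] at this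
  rw [this, ha]; simp

theorem IsSimilar.conj (φ : V ≃ₗ[F] W) (f : Module.End F V) : IsSimilar f (φ.conj f) :=
  ⟨φ, fun x => by simp⟩

theorem IsSimilar.isDifference {p q : F[X]} {f : Module.End F V} {g : Module.End F W}
    (h : IsSimilar f g) (hf : IsDifference p q f) : IsDifference p q g := by
  obtain ⟨φ, h⟩ := h
  obtain ⟨u₁, u₂, h₁, h₂, rfl⟩ := hf
  refine ⟨φ.conj u₁, φ.conj u₂, (IsSimilar.conj φ u₁).aeval_eq_zero h₁,
    (IsSimilar.conj φ u₂).aeval_eq_zero h₂, ?_⟩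
  ext y
  obtain ⟨x, rfl⟩ := φ.surjective y
  simp [h]

theorem aeval_prodMap (f : Module.End F V) (g : Module.End F W) (a : F[X]) :
    aeval (LinearMap.prodMap f g : Module.End F (V × W)) a =
      LinearMap.prodMap (aeval f a) (aeval g a) := by
  ext x
  · have := aeval_apply_of_intertwine (f := f) (g := LinearMap.prodMap f g)
      (LinearMap.inl F V W) (by simp) a x
    simpa using congrArg Prod.fst this
  · have := aeval_apply_of_intertwine (f := f) (g := LinearMap.prodMap f g)
      (LinearMap.inl F V W) (by simp) a x
    simpa using congrArg Prod.snd this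
  · have := aeval_apply_of_intertwine (f := g) (g := LinearMap.prodMap f g)
      (LinearMap.inr F V W) (by simp) a x
    simpa using congrArg Prod.fst this
  · have := aeval_apply_of_intertwine (f := g) (g := LinearMap.prodMap f g)
      (LinearMap.inr F V W) (by simp) a x
    simpa using congrArg Prod.snd this

theorem IsDifference.prodMap {p q : F[X]} {f : Module.End F V} {g : Module.End F W}
    (hf : IsDifference p q f) (hg : IsDifference p q g) :
    IsDifference (A := Module.End F (V × W)) p q (LinearMap.prodMap f g) := by
  obtain ⟨u₁, u₂, h₁, h₂, rfl⟩ := hf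
  obtain ⟨w₁, w₂, k₁, k₂, rfl⟩ := hg
  refine ⟨LinearMap.prodMap u₁ w₁, LinearMap.prodMap u₂ w₂, ?_, ?_, ?_⟩
  · rw [aeval_prodMap, h₁, k₁, LinearMap.prodMap_zero]
  · rw [aeval_prodMap, h₂, k₂, LinearMap.prodMap_zero]
  · ext <;> simp

theorem IsDifference.neg {p q : F[X]} {f : Module.End F V} (hf : IsDifference p q f) :
    IsDifference q p (-f) := by
  obtain ⟨u₁, u₂, h₁, h₂, rfl⟩ := hf
  exact ⟨u₂, u₁, h₂, h₁, by simp⟩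

theorem aeval_transpose (f : Module.End F V) (a : F[X]) :
    aeval (Module.Dual.transpose f : Module.End F (Module.Dual F V)) a =
      Module.Dual.transpose (aeval f a) := by
  have key : ∀ n : ℕ, (Module.Dual.transpose f : Module.End F (Module.Dual F V)) ^ n =
      Module.Dual.transpose (f ^ n) := by
    intro n
    induction n with
    | zero => ext; simp [Module.Dual.transpose_apply]
    | succ n ih =>
      rw [pow_succ, ih, pow_succ']
      ext; simp [Module.Dual.transpose_apply]
  induction a using Polynomial.induction_on' with
  | add a b ha hb => simp [ha, hb]
  | monomial n c =>
    rw [aeval_monomial, aeval_monomial, key]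
    ext; simp [Module.Dual.transpose_apply, Module.algebraMap_end_apply]

end Similarity

/-! ### Kernel dimensions of polynomials in an endomorphism. -/

section Kernels

variable {F : Type u} [Field F] {V W : Type*}
  [AddCommGroup V] [Module F V] [AddCommGroup W] [Module F W]

/-- The dimension of the kernel of `a(f)`. -/
noncomputable def kerDim (f : Module.End F V) (a : F[X]) : ℕ :=
  Module.finrank F (LinearMap.ker (aeval f a))

theorem IsSimilar.kerDim_eq {f : Module.End F V} {g : Module.End F W} (h : IsSimilar f g)
    (a : F[X]) : kerDim f a = kerDim g a := by
  obtain ⟨φ, h⟩ := h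
  have key : ∀ x, aeval g a (φ x) = φ (aeval f a x) :=
    aeval_apply_of_intertwine (φ : V →ₗ[F] W) h a
  refine LinearEquiv.finrank_eq (φ.ofSubmodules _ _ ?_)
  ext y
  simp only [Submodule.mem_map, LinearMap.mem_ker]
  constructor
  · rintro ⟨x, hx, rfl⟩
    simp [key, hx]
  · intro hy
    refine ⟨φ.symm y, φ.injective ?_, by simp⟩
    rw [← key]; simpa using hy

theorem kerDim_prodMap [FiniteDimensional F V] [FiniteDimensional F W]
    (f : Module.End F V) (g : Module.End F W) (a : F[X]) :
    kerDim (LinearMap.prodMap f g : Module.End F (V × W)) a = kerDim f a + kerDim g a := by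
  unfold kerDim
  rw [aeval_prodMap, LinearMap.ker_prodMap, ← Module.finrank_prod]
  exact LinearEquiv.finrank_eq
    { toFun := fun x => (⟨x.1.1, x.2.1⟩, ⟨x.1.2, x.2.2⟩)
      map_add' := fun _ _ => rfl
      map_smul' := fun _ _ => rfl
      invFun := fun x => ⟨(x.1.1, x.2.1), x.1.2, x.2.2⟩
      left_inv := fun _ => rfl
      right_inv := fun _ => rfl }

theorem kerDim_transpose [FiniteDimensional F V] (f : Module.End F V) (a : F[X]) :
    kerDim (Module.Dual.transpose f : Module.End F (Module.Dual F V)) a = kerDim f a := by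
  have h1 := LinearMap.finrank_range_add_finrank_ker (aeval f a)
  have h2 := LinearMap.finrank_range_add_finrank_ker
    (aeval (Module.Dual.transpose f : Module.End F (Module.Dual F V)) a)
  have h3 : Module.finrank F (LinearMap.range
    (aeval (Module.Dual.transpose f : Module.End F (Module.Dual F V)) a)) =
     Module.finrank F (LinearMap.range (aeval f a)) := by
    rw [aeval_transpose]
    exact LinearMap.finrank_range_dualMap_eq_finrank_range (aeval f a)
  have h4 : Module.finrank F (Module.Dual F V) = Module.finrank F V := Subspace.dual_finrank_eq
  unfold kerDim
  omega

theorem kerDim_zero (f : Module.End F V) : kerDim f 0 = Module.finrank F V := by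
  rw [kerDim, map_zero, LinearMap.ker_zero, finrank_top]

theorem kerDim_le_of_dvd [FiniteDimensional F V] (f : Module.End F V) {a b : F[X]} (h : a ∣ b) :
    kerDim f a ≤ kerDim f b := by
  obtain ⟨c, rfl⟩ := h
  refine Submodule.finrank_mono fun x hx => ?_
  rw [LinearMap.mem_ker] at *
  rw [mul_comm, map_mul, Module.End.mul_apply, hx, map_zero]

theorem kerDim_eq_finrank_iff [FiniteDimensional F V] (f : Module.End F V) (a : F[X]) :
    kerDim f a = Module.finrank F V ↔ aeval f a = 0 := by
  rw [← LinearMap.ker_eq_top]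
  exact ⟨Submodule.eq_top_of_finrank_eq, fun h => by rw [kerDim, h, finrank_top]⟩

theorem kerDim_mul_of_isCoprime [FiniteDimensional F V] (f : Module.End F V) {a b : F[X]}
    (h : IsCoprime a b) : kerDim f (a * b) = kerDim f a + kerDim f b := by
  unfold kerDim
  rw [← sup_ker_aeval_eq_ker_aeval_mul_of_coprime f h, ← Submodule.finrank_sup_add_finrank_inf_eq,
    (disjoint_ker_aeval_of_isCoprime f h).eq_bot, finrank_bot, add_zero]

theorem kerDim_eq_zero_of_isCoprime (f : Module.End F V) {a b : F[X]} (h : IsCoprime a b)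
    (hb : aeval f b = 0) : kerDim f a = 0 := by
  have := (disjoint_ker_aeval_of_isCoprime f h).eq_bot
  rw [hb, LinearMap.ker_zero, inf_top_eq] at this
  rw [kerDim, this, finrank_bot]

theorem kerDim_add_finrank_range [FiniteDimensional F V] (f : Module.End F V) (a : F[X]) :
    kerDim f a + Module.finrank F (LinearMap.range (aeval f a)) = Module.finrank F V := by
  rw [add_comm]; exact LinearMap.finrank_range_add_finrank_ker _

end Kernels

/-! ### Isometries, orthogonal sums and symplectic extensions. -/

section Pairs

variable {F : Type u} [Field F] {V W V' W' U : Type*}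
  [AddCommGroup V] [Module F V] [AddCommGroup W] [Module F W]
  [AddCommGroup V'] [Module F V'] [AddCommGroup W'] [Module F W'] [AddCommGroup U] [Module F U]

namespace SymplecticPair

theorem IsIsometric.refl (P : SymplecticPair F V) : P.IsIsometric P :=
  ⟨LinearEquiv.refl F V, fun _ _ => rfl, fun _ => rfl⟩

theorem IsIsometric.symm {P : SymplecticPair F V} {Q : SymplecticPair F W}
    (h : P.IsIsometric Q) : Q.IsIsometric P := by
  obtain ⟨φ, h, h'⟩ := h
  refine ⟨φ.symm, fun x y => ?_, fun x => ?_⟩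
  · rw [← h]; simp
  · apply φ.injective
    rw [← h']; simp

theorem IsIsometric.trans {P : SymplecticPair F V} {Q : SymplecticPair F W}
    {R : SymplecticPair F U} (h : P.IsIsometric Q) (k : Q.IsIsometric R) : P.IsIsometric R := by
  obtain ⟨φ, h, h'⟩ := h
  obtain ⟨ψ, k, k'⟩ := k
  exact ⟨φ.trans ψ, fun x y => by simp [h, k], fun x => by simp [h', k']⟩

theorem IsIsometric.isSimilar {P : SymplecticPair F V} {Q : SymplecticPair F W}
    (h : P.IsIsometric Q) : IsSimilar P.endo Q.endo := by
  obtain ⟨φ, -, h'⟩ := h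
  exact ⟨φ, h'⟩

theorem IsIsometric.orthogonalSum {P : SymplecticPair F V} {Q : SymplecticPair F W}
    {P' : SymplecticPair F V'} {Q' : SymplecticPair F W'}
    (h : P.IsIsometric P') (k : Q.IsIsometric Q') :
    (P.orthogonalSum Q).IsIsometric (P'.orthogonalSum Q') := by
  obtain ⟨φ, h, h'⟩ := h
  obtain ⟨ψ, k, k'⟩ := k
  exact ⟨φ.prodCongr ψ, fun x y => by simp [SymplecticPair.orthogonalSum, h, k],
    fun x => by simp [SymplecticPair.orthogonalSum, h', k']⟩

theorem isIsometric_orthogonalSum_assoc (P : SymplecticPair F V) (Q : SymplecticPair F W)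
    (R : SymplecticPair F U) : ((P.orthogonalSum Q).orthogonalSum R).IsIsometric
      (P.orthogonalSum (Q.orthogonalSum R)) :=
  ⟨LinearEquiv.prodAssoc F V W U, fun x y => by simp [SymplecticPair.orthogonalSum, add_assoc],
    fun x => by simp [SymplecticPair.orthogonalSum]⟩

theorem isIsometric_orthogonalSum_comm (P : SymplecticPair F V) (Q : SymplecticPair F W) :
    (P.orthogonalSum Q).IsIsometric (Q.orthogonalSum P) :=
  ⟨LinearEquiv.prodComm F V W, fun x y => by simp [SymplecticPair.orthogonalSum, add_comm],
    fun x => by simp [SymplecticPair.orthogonalSum]⟩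

theorem isIsometric_orthogonalSum_of_subsingleton [Subsingleton V] (P : SymplecticPair F V)
    (Q : SymplecticPair F W) : Q.IsIsometric (P.orthogonalSum Q) :=
  ⟨{ toFun := fun x => (0, x), map_add' := by simp, map_smul' := by simp,
     invFun := fun x => x.2, left_inv := fun x => rfl,
     right_inv := fun x => Prod.ext (Subsingleton.elim _ _) rfl },
   fun x y => by simp [SymplecticPair.orthogonalSum],
   fun x => by simp [SymplecticPair.orthogonalSum]⟩

theorem IsIsometric.isDifference {p q : F[X]} {P : SymplecticPair F V} {Q : SymplecticPair F W}
    (h : P.IsIsometric Q) (hP : P.IsDifference p q) : Q.IsDifference p q := by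
  obtain ⟨φ, h, h'⟩ := h
  obtain ⟨u₁, u₂, h₁, h₂, h₃, h₄, h₅⟩ := hP
  refine ⟨φ.conj u₁, φ.conj u₂, fun y => ?_, fun y => ?_,
    (IsSimilar.conj φ u₁).aeval_eq_zero h₃, (IsSimilar.conj φ u₂).aeval_eq_zero h₄, ?_⟩
  · obtain ⟨x, rfl⟩ := φ.surjective y
    simp [h, h₁]
  · obtain ⟨x, rfl⟩ := φ.surjective y
    simp [h, h₂]
  · ext y
    obtain ⟨x, rfl⟩ := φ.surjective y
    simp [h', h₅]

theorem IsDifference.endo {p q : F[X]} {P : SymplecticPair F V} (h : P.IsDifference p q) :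
    _root_.IsDifference p q P.endo := by
  obtain ⟨u₁, u₂, -, -, h₃, h₄, h₅⟩ := h
  exact ⟨u₁, u₂, h₃, h₄, h₅⟩

/-- Transport of a symplectic pair along a linear isomorphism. -/
def transport (P : SymplecticPair F V) (e : W ≃ₗ[F] V) : SymplecticPair F W where
  form := P.form.compl₁₂ (e : W →ₗ[F] V) (e : W →ₗ[F] V)
  endo := e.symm.conj P.endo
  isAlt := fun x => by simp [P.isAlt.self_eq_zero]
  nondegenerate := by
    refine ⟨fun x hx => ?_, fun x hx => ?_⟩
    · refine e.map_eq_zero_iff.1 (P.nondegenerate.1 _ fun y => ?_)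
      simpa using hx (e.symm y)
    · refine e.map_eq_zero_iff.1 (P.nondegenerate.2 _ fun y => ?_)
      simpa using hx (e.symm y)
  endo_alternating := fun x => by simp [P.endo_alternating]

theorem isIsometric_transport (P : SymplecticPair F V) (e : W ≃ₗ[F] V) :
    P.IsIsometric (P.transport e) :=
  ⟨e.symm, fun x y => by simp [transport], fun x => by simp [transport]⟩

/-- The summands of an orthogonal decomposition may live in any universe. -/
theorem IsIndecomposableDifference.false_of_isIsometric {W : Type w} [AddCommGroup W] [Module F W]
    {p q : F[X]} {P : SymplecticPair F W}
    (h : P.IsIndecomposableDifference p q) {P₁ : SymplecticPair F V} {P₂ : SymplecticPair F V'}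
    [hV : Nontrivial V] [hV' : Nontrivial V'] (h₁ : P₁.IsDifference p q) (h₂ : P₂.IsDifference p q)
    (hP : P.IsIsometric (P₁.orthogonalSum P₂)) : False := by
  obtain ⟨φ, hφ⟩ := id hP
  -- Both summands are realised as subspaces of `W`, hence in the universe over which the definition
  -- of indecomposability quantifies.
  let i : V →ₗ[F] W := φ.symm.toLinearMap ∘ₗ LinearMap.inl F V V'
  let j : V' →ₗ[F] W := φ.symm.toLinearMap ∘ₗ LinearMap.inr F V V'
  have hi : Function.Injective i := φ.symm.injective.comp LinearMap.inl_injective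
  have hj : Function.Injective j := φ.symm.injective.comp LinearMap.inr_injective
  let e := (LinearEquiv.ofInjective i hi)
  let e' := (LinearEquiv.ofInjective j hj)
  exact h.2.2 ⟨LinearMap.range i, LinearMap.range j, inferInstance, inferInstance, inferInstance,
    inferInstance, P₁.transport e.symm, P₂.transport e'.symm, e.symm.toEquiv.nontrivial,
    e'.symm.toEquiv.nontrivial, (isIsometric_transport P₁ e.symm).isDifference h₁,
    (isIsometric_transport P₂ e'.symm).isDifference h₂,
    hP.trans ((isIsometric_transport P₁ e.symm).orthogonalSum (isIsometric_transport P₂ e'.symm))⟩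

end SymplecticPair

theorem IsIndecomposableDifference.false_of_isSimilar {W : Type w} [AddCommGroup W] [Module F W]
    {p q : F[X]} {f : Module.End F W}
    (h : IsIndecomposableDifference p q f) {f₁ : Module.End F V} {f₂ : Module.End F V'}
    [hV : Nontrivial V] [hV' : Nontrivial V'] (h₁ : IsDifference p q f₁) (h₂ : IsDifference p q f₂)
    (hP : IsSimilar f (LinearMap.prodMap f₁ f₂)) : False := by
  obtain ⟨φ, hφ⟩ := id hP
  let i : V →ₗ[F] W := φ.symm.toLinearMap ∘ₗ LinearMap.inl F V V'
  let j : V' →ₗ[F] W := φ.symm.toLinearMap ∘ₗ LinearMap.inr F V V'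
  have hi : Function.Injective i := φ.symm.injective.comp LinearMap.inl_injective
  have hj : Function.Injective j := φ.symm.injective.comp LinearMap.inr_injective
  let e := (LinearEquiv.ofInjective i hi)
  let e' := (LinearEquiv.ofInjective j hj)
  exact h.2.2 ⟨LinearMap.range i, LinearMap.range j, inferInstance, inferInstance, inferInstance,
    inferInstance, e.conj f₁, e'.conj f₂, e.symm.toEquiv.nontrivial,
    e'.symm.toEquiv.nontrivial, (IsSimilar.conj e f₁).isDifference h₁,
    (IsSimilar.conj e' f₂).isDifference h₂,
    hP.trans ((IsSimilar.conj e f₁).prodMap (IsSimilar.conj e' f₂))⟩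

theorem IsSimilar.symplecticExtension {f : Module.End F V} {g : Module.End F W}
    (h : IsSimilar f g) :
    (symplecticExtension f).IsIsometric (_root_.symplecticExtension g) := by
  obtain ⟨φ, h⟩ := h
  refine ⟨φ.prodCongr φ.symm.dualMap, fun x y => by simp [_root_.symplecticExtension], fun x => ?_⟩
  refine Prod.ext (by simp [_root_.symplecticExtension, h]) ?_
  ext y
  obtain ⟨y, rfl⟩ := φ.surjective y
  simp [_root_.symplecticExtension, h, Module.Dual.transpose_apply]

theorem symplecticExtension_prodMap (f : Module.End F V) (g : Module.End F W) :
    (symplecticExtension (LinearMap.prodMap f g : Module.End F (V × W))).IsIsometric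
      ((symplecticExtension f).orthogonalSum (symplecticExtension g)) := by
  refine ⟨((LinearEquiv.refl F (V × W)).prodCongr
      (Module.dualProdDualEquivDual F V W).symm).trans
      (LinearEquiv.prodProdProdComm F V W (Module.Dual F V) (Module.Dual F W)),
      fun x y => ?_, fun x => ?_⟩
  · obtain ⟨x, ξ⟩ := x
    obtain ⟨y, η⟩ := y
    obtain ⟨ξ, rfl⟩ := (Module.dualProdDualEquivDual F V W).surjective ξ
    obtain ⟨η, rfl⟩ := (Module.dualProdDualEquivDual F V W).surjective η
    simp [symplecticExtension, SymplecticPair.orthogonalSum]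
    ring
  · obtain ⟨x, ξ⟩ := x
    obtain ⟨ξ, rfl⟩ := (Module.dualProdDualEquivDual F V W).surjective ξ
    have : Module.Dual.transpose (LinearMap.prodMap f g : Module.End F (V × W))
        (Module.dualProdDualEquivDual F V W ξ) = Module.dualProdDualEquivDual F V W
        (Module.Dual.transpose f ξ.1, Module.Dual.transpose g ξ.2) := by
      ext <;> simp [Module.Dual.transpose_apply]
    simp [symplecticExtension, SymplecticPair.orthogonalSum, this]

/-- Any w ⊕ wᵗ is alternating for the form of S: its value on (x, φ) is φ(wx) - φ(wx). So both terms
of a difference extend. -/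
theorem IsDifference.symplecticExtension {p q : F[X]} {f : Module.End F V}
    (h : IsDifference p q f) : (symplecticExtension f).IsDifference p q := by
  obtain ⟨u₁, u₂, h₁, h₂, rfl⟩ := h
  refine ⟨LinearMap.prodMap u₁ (Module.Dual.transpose u₁),
    LinearMap.prodMap u₂ (Module.Dual.transpose u₂), fun x => ?_, fun x => ?_, ?_, ?_, ?_⟩
  · simp [_root_.symplecticExtension, Module.Dual.transpose_apply]
  · simp [_root_.symplecticExtension, Module.Dual.transpose_apply]
  · rw [aeval_prodMap, aeval_transpose, h₁, map_zero, LinearMap.prodMap_zero]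
  · rw [aeval_prodMap, aeval_transpose, h₂, map_zero, LinearMap.prodMap_zero]
  · ext <;> simp [_root_.symplecticExtension, Module.Dual.transpose_apply]

theorem kerDim_symplecticExtension [FiniteDimensional F V] (f : Module.End F V) (a : F[X]) :
    kerDim (symplecticExtension f).endo a = 2 * kerDim f a := by
  have : (symplecticExtension f).endo = LinearMap.prodMap f (Module.Dual.transpose f) := rfl
  rw [this, kerDim_prodMap, kerDim_transpose, two_mul]

theorem aeval_symplecticExtension_eq_zero {f : Module.End F V} {a : F[X]} (h : aeval f a = 0) :
    aeval (symplecticExtension f).endo a = 0 := by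
  have : (symplecticExtension f).endo = LinearMap.prodMap f (Module.Dual.transpose f) := rfl
  rw [this, aeval_prodMap, aeval_transpose, h, map_zero, LinearMap.prodMap_zero]

end Pairs

/-! ### Block-diagonal matrices as direct sums. -/

section Blocks

variable {F : Type u} [Field F]

theorem isSimilar_toEnd_blockSum (M N : SquareMatrix F) :
    IsSimilar (SquareMatrix.toEnd (blockSum M N))
      (LinearMap.prodMap (SquareMatrix.toEnd M) (SquareMatrix.toEnd N)) := by
  refine ⟨
    { toFun := fun x => (fun i => x (Fin.castAdd N.1 i), fun i => x (Fin.natAdd M.1 i))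
      map_add' := fun _ _ => rfl
      map_smul' := fun _ _ => rfl
      invFun := fun x => Fin.append x.1 x.2
      left_inv := fun x => Fin.append_castAdd_natAdd
      right_inv := fun x => by ext <;> simp }, fun x => ?_⟩
  change Fin (M.1 + N.1) → F at x
  have key : ∀ i, SquareMatrix.toEnd (blockSum M N) x i = ∑ j : Fin (M.1 + N.1),
      Matrix.fromBlocks M.2 0 0 N.2 (finSumFinEquiv.symm i) (finSumFinEquiv.symm j) * x j :=
    fun _ => rfl
  have hM : ∀ y i, SquareMatrix.toEnd M y i = ∑ j, M.2 i j * y j := fun _ _ => rfl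
  have hN : ∀ y i, SquareMatrix.toEnd N y i = ∑ j, N.2 i j * y j := fun _ _ => rfl
  refine Prod.ext (funext fun i => ?_) (funext fun i => ?_)
  · refine Eq.trans ?_ (key (Fin.castAdd N.1 i)).symm
    simp [Fin.sum_univ_add, hM]
    rfl
  · refine Eq.trans ?_ (key (Fin.natAdd M.1 i)).symm
    simp [Fin.sum_univ_add, hN]
    rfl

/-- The block-diagonal sum of a list of square matrices. -/
def blockSumList (L : List (SquareMatrix F)) : SquareMatrix F :=
  L.foldr blockSum ⟨0, 0⟩

end Blocks

/-! ### Cyclic endomorphisms and companion matrices. -/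

section Cyclic

variable {F : Type u} [Field F] {V W : Type*}
  [AddCommGroup V] [Module F V] [AddCommGroup W] [Module F W]

/-- The annihilator of `x` with respect to `f` is generated by `ρ`. -/
def HasOrder (f : Module.End F V) (x : V) (ρ : F[X]) : Prop :=
  ∀ g : F[X], aeval f g x = 0 ↔ ρ ∣ g

/-- By Bézout, gcd(r ^ m, g) kills `x` as soon as `g` does. This gcd is a power of r up to a unit,
and no exponent below m is possible. -/
theorem hasOrder_pow {f : Module.End F V} {x : V} {r : F[X]} (hr : Irreducible r) {m : ℕ}
    (h : aeval f (r ^ m) x = 0) (h' : ∀ k < m, aeval f (r ^ k) x ≠ 0) :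
    HasOrder f x (r ^ m) := by
  intro g
  constructor
  · intro hg
    classical
    have hd : aeval f (EuclideanDomain.gcd (r ^ m) g) x = 0 := by
      rw [EuclideanDomain.gcd_eq_gcd_ab, mul_comm, mul_comm g, map_add, map_mul, map_mul,
        LinearMap.add_apply, Module.End.mul_apply, Module.End.mul_apply, h, hg]
      simp
    obtain ⟨k, hk, hass⟩ := (dvd_prime_pow hr.prime m).1 (EuclideanDomain.gcd_dvd_left (r ^ m) g)
    rcases hk.lt_or_eq with hk | rfl
    · refine absurd ?_ (h' k hk)
      obtain ⟨c, hc⟩ := hass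
      rw [← hc, mul_comm, map_mul, Module.End.mul_apply, hd, map_zero]
    · exact hass.symm.dvd.trans (EuclideanDomain.gcd_dvd_right _ g)
  · rintro ⟨c, rfl⟩
    rw [mul_comm, map_mul, Module.End.mul_apply, h, map_zero]

theorem HasOrder.aeval_mul {f : Module.End F V} {x : V} {a b : F[X]} (h : HasOrder f x (a * b))
    (ha : a ≠ 0) : HasOrder f (aeval f a x) b := by
  intro g
  rw [← Module.End.mul_apply, ← map_mul, h, mul_comm g a, mul_dvd_mul_iff_left ha]

/-- The linear map from `F ^ d` to `V` that sends the standard basis to `x, f x, f² x, …`. -/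
def cyclicMap (f : Module.End F V) (x : V) (ρ : F[X]) : (Fin (companion ρ).1 → F) →ₗ[F] V :=
  Fintype.linearCombination F (fun i : Fin (companion ρ).1 => (f ^ (i : ℕ)) x)

theorem cyclicMap_single (f : Module.End F V) (x : V) (ρ : F[X]) (i : Fin (companion ρ).1) :
    cyclicMap f x ρ (Pi.single i 1) = (f ^ (i : ℕ)) x := by
  simp [cyclicMap, Fintype.linearCombination_apply_single]

theorem cyclicMap_companion {f : Module.End F V} {x : V} {ρ : F[X]} (hρ : ρ.Monic)
    (h : aeval f ρ x = 0) (c : Fin (companion ρ).1 → F) :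
    cyclicMap f x ρ (SquareMatrix.toEnd (companion ρ) c) = f (cyclicMap f x ρ c) := by
  suffices (cyclicMap f x ρ) ∘ₗ (SquareMatrix.toEnd (companion ρ)) = f ∘ₗ cyclicMap f x ρ from
    LinearMap.congr_fun this c
  refine LinearMap.pi_ext' fun j => LinearMap.ext_ring ?_
  simp only [LinearMap.comp_apply, LinearMap.single_apply, cyclicMap_single]
  rw [← Module.End.mul_apply, ← pow_succ']
  have hcol : SquareMatrix.toEnd (companion ρ) (Pi.single j 1) = fun i => (companion ρ).2 i j := by
    simp [SquareMatrix.toEnd, Matrix.col_def]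
    rfl
  rw [hcol, cyclicMap, Fintype.linearCombination_apply]
  change ∑ i : Fin ρ.natDegree, (if (j : ℕ) + 1 = ρ.natDegree then - ρ.coeff i
    else if (i : ℕ) = (j : ℕ) + 1 then 1 else 0) • (f ^ (i : ℕ)) x = _
  by_cases hj : (j : ℕ) + 1 = ρ.natDegree
  · rw [aeval_eq_sum_range, Finset.sum_range_succ, hρ.coeff_natDegree, one_smul,
      LinearMap.add_apply, LinearMap.sum_apply] at h
    simp only [hj, if_true, neg_smul, Finset.sum_neg_distrib]
    rw [neg_eq_iff_add_eq_zero, ← h]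
    congr 1
    exact Fin.sum_univ_eq_sum_range (fun i => ρ.coeff i • (f ^ i) x) ρ.natDegree
  · have hlt : (j : ℕ) + 1 < ρ.natDegree := lt_of_le_of_ne j.2 hj
    simp only [hj, if_false]
    rw [Finset.sum_eq_single (⟨(j : ℕ) + 1, hlt⟩ : Fin ρ.natDegree)]
    · simp
    · intro i _ hi
      have : (i : ℕ) ≠ (j : ℕ) + 1 := fun h => hi (Fin.ext h)
      simp [this]
    · simp

theorem cyclicMap_eq_aeval (f : Module.End F V) (x : V) (ρ : F[X]) (c : Fin (companion ρ).1 → F) :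
    cyclicMap f x ρ c = aeval f (∑ i, C (c i) * X ^ (i : ℕ)) x := by
  simp [cyclicMap, Fintype.linearCombination_apply, map_sum, Module.algebraMap_end_apply]

theorem cyclicMap_injective {f : Module.End F V} {x : V} {ρ : F[X]} (hρ : ρ.Monic)
    (h : HasOrder f x ρ) : Function.Injective (cyclicMap f x ρ) := by
  rw [injective_iff_map_eq_zero]
  intro c hc
  rw [cyclicMap_eq_aeval, h] at hc
  have hdeg : (∑ i : Fin ρ.natDegree, C (c i) * X ^ (i : ℕ)).degree < ρ.degree := by
    rw [degree_eq_natDegree hρ.ne_zero]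
    exact degree_sum_fin_lt c
  have h0 := eq_zero_of_dvd_of_degree_lt hc hdeg
  funext i
  have := congrArg (fun g => coeff g i) h0
  simpa [finsetSum_coeff, coeff_C_mul, coeff_X_pow, Fin.val_inj] using this

theorem aeval_mem_range_cyclicMap {f : Module.End F V} {x : V} {ρ : F[X]} (hρ : ρ.Monic)
    (h : aeval f ρ x = 0) (g : F[X]) : aeval f g x ∈ LinearMap.range (cyclicMap f x ρ) := by
  have hg : aeval f g x = aeval f (g %ₘ ρ) x := by
    conv_lhs => rw [← modByMonic_add_div g ρ]
    rw [map_add, mul_comm, map_mul, LinearMap.add_apply, Module.End.mul_apply, h]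
    simp
  -- The strict bound on the degree of the remainder fails for ρ = 1, where the remainder is zero.
  rcases eq_or_ne ρ 1 with rfl | h1
  · rw [hg]; simp
  refine ⟨fun i => (g %ₘ ρ).coeff i, ?_⟩
  rw [hg, cyclicMap_eq_aeval]
  congr 2
  have := (g %ₘ ρ).as_sum_range_C_mul_X_pow' (natDegree_modByMonic_lt g hρ h1)
  conv_rhs => rw [this]
  exact Fin.sum_univ_eq_sum_range (fun i => C ((g %ₘ ρ).coeff i) * X ^ i) ρ.natDegree

/-- `f` is a cyclic endomorphism with minimal polynomial `ρ`. -/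
def IsCyclicOf (f : Module.End F V) (ρ : F[X]) : Prop :=
  (∃ x, HasOrder f x ρ) ∧ Module.finrank F V = ρ.natDegree

theorem IsCyclicOf.isSimilar [FiniteDimensional F V] {f : Module.End F V} {ρ : F[X]} (hρ : ρ.Monic)
    (h : IsCyclicOf f ρ) : IsSimilar (SquareMatrix.toEnd (companion ρ)) f := by
  obtain ⟨⟨x, hx⟩, hd⟩ := h
  refine ⟨LinearEquiv.ofInjectiveOfFinrankEq _ (cyclicMap_injective hρ hx) ?_, fun c => ?_⟩
  · rw [hd, Module.finrank_fin_fun]; rfl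
  · exact (cyclicMap_companion hρ ((hx ρ).2 dvd_rfl) c).symm

/-- The class of 1 in F[X]/(ρ) is a cyclic vector. Companion matrices inherit their properties from
this model. -/
theorem isCyclicOf_adjoinRoot {ρ : F[X]} (hρ : ρ.Monic) :
    IsCyclicOf (LinearMap.mulLeft F (AdjoinRoot.root ρ)) ρ := by
  refine ⟨⟨1, fun g => ?_⟩, ?_⟩
  · have : aeval (LinearMap.mulLeft F (AdjoinRoot.root ρ)) g =
        LinearMap.mulLeft F (aeval (AdjoinRoot.root ρ) g) :=
      (aeval_algHom_apply (Algebra.lmul F (AdjoinRoot ρ)) (AdjoinRoot.root ρ) g)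
    rw [this, LinearMap.mulLeft_apply, mul_one, AdjoinRoot.aeval_eq, AdjoinRoot.mk_eq_zero]
  · exact (AdjoinRoot.powerBasis' hρ).finrank

theorem isCyclicOf_companion {ρ : F[X]} (hρ : ρ.Monic) :
    IsCyclicOf (SquareMatrix.toEnd (companion ρ)) ρ := by
  have h := isCyclicOf_adjoinRoot hρ
  have : Module.Finite F (AdjoinRoot ρ) := (AdjoinRoot.powerBasis' hρ).finite
  obtain ⟨φ, hφ⟩ := (h.isSimilar hρ).symm
  obtain ⟨⟨x, hx⟩, hd⟩ := h
  refine ⟨⟨φ x, fun g => ?_⟩, ?_⟩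
  · have := aeval_apply_of_intertwine φ.toLinearMap hφ g x
    simp only [LinearEquiv.coe_coe] at this
    rw [this, LinearEquiv.map_eq_zero_iff, hx]
  · rw [Module.finrank_fin_fun]; rfl

theorem IsCyclicOf.aeval_eq_zero [FiniteDimensional F V] {f : Module.End F V} {ρ : F[X]}
    (hρ : ρ.Monic) (h : IsCyclicOf f ρ) : aeval f ρ = 0 := by
  obtain ⟨⟨x, hx⟩, hd⟩ := h
  have h0 : aeval f ρ x = 0 := (hx ρ).2 dvd_rfl
  have hr : LinearMap.range (cyclicMap f x ρ) = ⊤ := by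
    rw [LinearMap.range_eq_top]
    refine (LinearMap.injective_iff_surjective_of_finrank_eq_finrank ?_).1
      (cyclicMap_injective hρ hx)
    rw [hd, Module.finrank_fin_fun]; rfl
  ext y
  obtain ⟨c, rfl⟩ := LinearMap.range_eq_top.1 hr y
  rw [cyclicMap_eq_aeval, ← Module.End.mul_apply, ← map_mul, mul_comm, map_mul,
    Module.End.mul_apply, h0]
  simp

/-- The range of a(f) is the cyclic space generated by a(f)x, a vector of order b; it has dimension
deg b, and rank-nullity gives the kernel. -/
theorem IsCyclicOf.kerDim_eq [FiniteDimensional F V] {f : Module.End F V} {a b : F[X]}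
    (ha : a.Monic) (hb : b.Monic) (h : IsCyclicOf f (a * b)) : kerDim f a = a.natDegree := by
  have hab : (a * b).Monic := ha.mul hb
  obtain ⟨⟨x, hx⟩, hd⟩ := h
  have hy := hx.aeval_mul ha.ne_zero
  have hr : LinearMap.range (aeval f a) = LinearMap.range (cyclicMap f (aeval f a x) b) := by
    apply le_antisymm
    · rintro _ ⟨z, rfl⟩
      have htop : LinearMap.range (cyclicMap f x (a * b)) = ⊤ := by
        rw [LinearMap.range_eq_top]
        refine (LinearMap.injective_iff_surjective_of_finrank_eq_finrank ?_).1
          (cyclicMap_injective hab hx)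
        rw [hd, Module.finrank_fin_fun]; rfl
      obtain ⟨c, rfl⟩ := LinearMap.range_eq_top.1 htop z
      rw [cyclicMap_eq_aeval, ← Module.End.mul_apply, ← map_mul, mul_comm, map_mul,
        Module.End.mul_apply]
      exact aeval_mem_range_cyclicMap hb ((hy b).2 dvd_rfl) _
    · rintro _ ⟨c, rfl⟩
      rw [cyclicMap_eq_aeval, ← Module.End.mul_apply, ← map_mul, mul_comm, map_mul,
        Module.End.mul_apply]
      exact LinearMap.mem_range_self _ _
  have h1 := kerDim_add_finrank_range f a
  rw [hr, LinearMap.finrank_range_of_inj (cyclicMap_injective hb hy), hd, Module.finrank_fin_fun,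
    ha.natDegree_mul hb] at h1
  have h2 : (companion b).1 = b.natDegree := rfl
  omega

/-- The increment from k to k + 1 is deg r for k < m and 0 afterwards. Increments of kernel
dimensions thus count blocks of size > k, which is how interlacing is to be read. -/
theorem IsCyclicOf.kerDim_pow [FiniteDimensional F V] {f : Module.End F V} {r : F[X]} {m : ℕ}
    (hr : r.Monic) (h : IsCyclicOf f (r ^ m)) (k : ℕ) :
    kerDim f (r ^ k) = r.natDegree * min k m := by
  rcases le_total k m with hk | hk
  · have : r ^ m = r ^ k * r ^ (m - k) := by rw [← pow_add]; congr 1; omega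
    rw [this] at h
    rw [h.kerDim_eq (hr.pow k) (hr.pow _), hr.natDegree_pow, min_eq_left hk, mul_comm]
  · have h0 := h.aeval_eq_zero (hr.pow m)
    have : aeval f (r ^ k) = 0 := by
      rw [← Nat.sub_add_cancel hk, pow_add, map_mul, h0, mul_zero]
    rw [(kerDim_eq_finrank_iff f _).2 this, h.2, hr.natDegree_pow, min_eq_right hk, mul_comm]

theorem aeval_companion {ρ : F[X]} (hρ : ρ.Monic) :
    aeval (SquareMatrix.toEnd (companion ρ)) ρ = 0 :=
  (isCyclicOf_companion hρ).aeval_eq_zero hρ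

theorem kerDim_companion_pow {r : F[X]} (hr : r.Monic) (m k : ℕ) :
    kerDim (SquareMatrix.toEnd (companion (r ^ m))) (r ^ k) = r.natDegree * min k m :=
  (isCyclicOf_companion (hr.pow m)).kerDim_pow hr k

theorem kerDim_companion_of_isCoprime {ρ a : F[X]} (hρ : ρ.Monic) (h : IsCoprime a ρ) :
    kerDim (SquareMatrix.toEnd (companion ρ)) a = 0 :=
  kerDim_eq_zero_of_isCoprime _ h (aeval_companion hρ)

end Cyclic

/-! ### Splitting off a cyclic block by duality. -/

section Splitting

variable {F : Type u} [Field F] {V W : Type*}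
  [AddCommGroup V] [Module F V] [AddCommGroup W] [Module F W]

theorem hasOrder_of_eq_pow {f : Module.End F V} {x : V} {r ρ : F[X]} (hr : Irreducible r) {m : ℕ}
    (hρ : ρ = r ^ m) (h : aeval f ρ x = 0) (h' : ∀ k < m, aeval f (r ^ k) x ≠ 0) :
    HasOrder f x ρ := by
  subst hρ
  exact hasOrder_pow hr h h'

/-- Adjointness says that B, seen as a map from W to the dual of V, intertwines `f'` with the
transpose of `f`. -/
theorem aeval_adjoint {B : W →ₗ[F] V →ₗ[F] F} {f : Module.End F V} {f' : Module.End F W}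
    (h : ∀ y x, B (f' y) x = B y (f x)) (g : F[X]) (y : W) (x : V) :
    B (aeval f' g y) x = B y (aeval f g x) := by
  have h1 := aeval_apply_of_intertwine (f := f') (g := Module.Dual.transpose f)
    (B : W →ₗ[F] Module.Dual F V) (fun y => LinearMap.ext fun x => by
      simp [Module.Dual.transpose_apply, h]) g y
  rw [aeval_transpose] at h1
  exact (LinearMap.congr_fun h1 x).symm

theorem cyclicMap_comp {f : Module.End F V} {g : Module.End F W} (D : V →ₗ[F] W)
    (h : ∀ x, g (D x) = D (f x)) (x : V) (ρ : F[X]) (c : Fin (companion ρ).1 → F) :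
    D (cyclicMap f x ρ c) = cyclicMap g (D x) ρ c := by
  rw [cyclicMap_eq_aeval, cyclicMap_eq_aeval, aeval_apply_of_intertwine D h]

/-- Two vectors of order `r ^ (n + 1)` that are dual to each other span a pair of cyclic
submodules in duality. -/
theorem exists_dual_cyclicMap {B : W →ₗ[F] V →ₗ[F] F} {f : Module.End F V} {f' : Module.End F W}
    (h : ∀ y x, B (f' y) x = B y (f x)) {r : F[X]} (hr : Irreducible r) (hm : r.Monic) {n : ℕ}
    {ρ : F[X]} (hρ : ρ = r ^ (n + 1))
    {x : V} {y : W} (hx : aeval f ρ x = 0) (hy : aeval f' ρ y = 0)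
    (hxy : B y (aeval f (r ^ n) x) ≠ 0) :
    ∃ ψ : Module.Dual F (Fin (companion ρ).1 → F) →ₗ[F] W,
      (∀ ξ c, B (ψ ξ) (cyclicMap f x ρ c) = ξ c) ∧
      (∀ ξ, ψ (Module.Dual.transpose (SquareMatrix.toEnd (companion ρ)) ξ) = f' (ψ ξ)) ∧
      ∀ ξ, ∃ g : F[X], ψ ξ = aeval f' g y := by
  have hρm : ρ.Monic := hρ ▸ hm.pow _
  let v := SquareMatrix.toEnd (companion ρ)
  -- `D z` is the functional that z induces, through B, on the coordinates of the cyclic space of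
  -- `x`.
  let D : W →ₗ[F] Module.Dual F (Fin (companion ρ).1 → F) :=
    (LinearMap.lcomp F F (cyclicMap f x ρ)) ∘ₗ B
  have hDa : ∀ z c, D z c = B z (cyclicMap f x ρ c) := fun z c => rfl
  have hD : ∀ z, Module.Dual.transpose v (D z) = D (f' z) := by
    intro z
    refine LinearMap.ext fun c => ?_
    rw [Module.Dual.transpose_apply, LinearMap.comp_apply, hDa, hDa, h,
      cyclicMap_companion hρm hx]
  have hcyc : ∀ c, D (cyclicMap f' y ρ c) = cyclicMap (Module.Dual.transpose v) (D y) ρ c :=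
    cyclicMap_comp D hD y ρ
  obtain ⟨e, he⟩ := aeval_mem_range_cyclicMap hρm hx 1
  -- Since B(y, rⁿx) ≠ 0, the power r ^ n does not kill `D y`, so its order is exactly r ^ (n + 1).
  -- By dimension `D y` then generates the whole dual space, and `Θ` below is an isomorphism through
  -- which functionals lift to the cyclic space of `y`.
  have hord : HasOrder (Module.Dual.transpose v) (D y) ρ := by
    have h0 : aeval (Module.Dual.transpose v) ρ (D y) = 0 := by
      rw [aeval_apply_of_intertwine D hD, hy, map_zero]
    refine hasOrder_of_eq_pow hr hρ h0 fun k hk h0 => hxy ?_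
    rw [aeval_apply_of_intertwine D hD] at h0
    have h1 : D (aeval f' (r ^ n) y) = 0 := by
      rw [← Nat.sub_add_cancel (Nat.lt_succ_iff.1 hk), pow_add, map_mul, Module.End.mul_apply,
        ← aeval_apply_of_intertwine D hD, h0, map_zero]
    have h2 := LinearMap.congr_fun h1 e
    rw [hDa, he, aeval_adjoint h] at h2
    simpa using h2
  let Θ := LinearEquiv.ofInjectiveOfFinrankEq _ (cyclicMap_injective hρm hord)
    (Subspace.dual_finrank_eq).symm
  have hΘ : ∀ c, Θ c = cyclicMap (Module.Dual.transpose v) (D y) ρ c := fun c => rfl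
  refine ⟨cyclicMap f' y ρ ∘ₗ Θ.symm.toLinearMap, fun ξ c => ?_, fun ξ => ?_, fun ξ => ?_⟩
  · rw [← hDa]
    refine LinearMap.congr_fun (?_ : D (cyclicMap f' y ρ (Θ.symm ξ)) = ξ) c
    rw [hcyc, ← hΘ, LinearEquiv.apply_symm_apply]
  · obtain ⟨c, rfl⟩ := Θ.surjective ξ
    have : Module.Dual.transpose v (Θ c) = Θ (v c) := by
      rw [hΘ, hΘ, cyclicMap_companion hρm ((hord ρ).2 dvd_rfl)]
    rw [this]
    simp only [LinearMap.comp_apply, LinearEquiv.coe_coe, LinearEquiv.symm_apply_apply]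
    exact cyclicMap_companion hρm hy c
  · exact ⟨_, cyclicMap_eq_aeval _ _ _ _⟩

/-- A pair of dual vectors of maximal order, with respect to the irreducible factor `r` of the
minimal polynomial. -/
theorem exists_dual_vectors {B : W →ₗ[F] V →ₗ[F] F} {f : Module.End F V}
    {f' : Module.End F W} (h : ∀ y x, B (f' y) x = B y (f x))
    (hB : ∀ x, (∀ y, B y x = 0) → x = 0) (hB' : ∀ y, (∀ x, B y x = 0) → y = 0)
    {r : F[X]} (hr : Irreducible r) {n : ℕ} {g : F[X]} (hmin : minpoly F f = r ^ (n + 1) * g)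
    (hg : ¬ r ∣ g) : ∃ x y, aeval f (r ^ (n + 1)) x = 0 ∧ aeval f' (r ^ (n + 1)) y = 0 ∧
      B y (aeval f (r ^ n) x) ≠ 0 := by
  have h0 : aeval f (r ^ (n + 1) * g) = 0 := by rw [← hmin, minpoly.aeval]
  have h0' : aeval f' (r ^ (n + 1) * g) = 0 := by
    ext y
    refine hB' _ fun x => ?_
    rw [aeval_adjoint h, h0]
    simp
  -- The factor g occurs twice because each of the two vectors needs one copy to be pushed into the
  -- r-primary part. The product is still not a multiple of the minimal polynomial, since r does not
  -- divide g.
  have h1 : aeval f (r ^ n * g * g) ≠ 0 := by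
    intro h1
    have h2 := minpoly.dvd F f h1
    rw [hmin, pow_succ, mul_assoc, mul_assoc, mul_dvd_mul_iff_left (pow_ne_zero _ hr.ne_zero)] at h2
    rcases hr.prime.dvd_or_dvd (dvd_of_mul_right_dvd h2) with h3 | h3 <;> exact hg h3
  obtain ⟨z, hz⟩ : ∃ z, aeval f (r ^ n * g * g) z ≠ 0 := by
    by_contra! hz
    exact h1 (LinearMap.ext hz)
  obtain ⟨w, hw⟩ : ∃ w, B w (aeval f (r ^ n * g * g) z) ≠ 0 := by
    by_contra! hw
    exact hz (hB _ hw)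
  refine ⟨aeval f g z, aeval f' g w, ?_, ?_, ?_⟩
  · rw [← Module.End.mul_apply, ← map_mul, h0]; simp
  · rw [← Module.End.mul_apply, ← map_mul, h0']; simp
  · rw [aeval_adjoint h, ← Module.End.mul_apply, ← map_mul, ← Module.End.mul_apply, ← map_mul]
    convert hw using 4
    ring

/-- An equivariant retraction splits the space. -/
noncomputable def splitEquiv (i : W →ₗ[F] V) (π : V →ₗ[F] W) (h : ∀ x, π (i x) = x) :
    (W × LinearMap.ker π) ≃ₗ[F] V where
  toFun z := i z.1 + z.2
  map_add' a b := by simp; abel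
  map_smul' a b := by simp
  invFun z := (π z, ⟨z - i (π z), by simp [h]⟩)
  left_inv z := by
    have : π z.2 = 0 := z.2.2
    ext <;> simp [h, this]
  right_inv z := by simp

/-- With the evaluation pairing between the dual of V and V, the dual cyclic family is an
equivariant retraction onto the cyclic space of `x`; its kernel is the complement. -/
theorem exists_isSimilar_prodMap_companion [FiniteDimensional F V] (f : Module.End F V)
    {r : F[X]} (hr : Irreducible r) (hm : r.Monic) {n : ℕ} {g : F[X]}
    (hmin : minpoly F f = r ^ (n + 1) * g) (hg : ¬ r ∣ g) :
    ∃ (V' : Submodule F V) (f' : Module.End F V'),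
      IsSimilar (LinearMap.prodMap (SquareMatrix.toEnd (companion (r ^ (n + 1)))) f') f := by
  obtain ⟨ρ, hρn⟩ : ∃ ρ, ρ = r ^ (n + 1) := ⟨_, rfl⟩
  rw [← hρn]
  obtain ⟨x, y, hx, hy, hxy⟩ := exists_dual_vectors
    (B := (LinearMap.id : Module.Dual F V →ₗ[F] Module.Dual F V)) (f := f)
    (f' := Module.Dual.transpose f)
    (fun y x => by simp [Module.Dual.transpose_apply])
    (fun x => (Module.forall_dual_apply_eq_zero_iff F x).1) (fun y h => LinearMap.ext h) hr hmin hg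
  rw [← hρn] at hx hy
  obtain ⟨ψ, h1, h2, -⟩ := exists_dual_cyclicMap
    (B := (LinearMap.id : Module.Dual F V →ₗ[F] Module.Dual F V)) (f := f)
    (f' := Module.Dual.transpose f)
    (fun y x => by simp [Module.Dual.transpose_apply]) hr hm hρn hx hy hxy
  have hρ : ρ.Monic := hρn ▸ hm.pow _
  -- The retraction is the transpose of `ψ`, after identifying F ^ d with its bidual.
  let π : V →ₗ[F] (Fin (companion ρ).1 → F) :=
    (Module.evalEquiv F (Fin (companion ρ).1 → F)).symm.toLinearMap ∘ₗ ψ.flip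
  have hπ : ∀ ξ z, ξ (π z) = ψ ξ z := by
    intro ξ z
    simp [π]
  have hext : ∀ c c' : Fin (companion ρ).1 → F,
      (∀ ξ : Module.Dual F (Fin (companion ρ).1 → F), ξ c = ξ c') → c = c' :=
    fun c c' h => sub_eq_zero.1 <| (Module.forall_dual_apply_eq_zero_iff F _).1 fun ξ => by
      rw [map_sub, h, sub_self]
  have hr' : ∀ c, π (cyclicMap f x ρ c) = c := fun c => hext _ _ fun ξ => by
    rw [hπ]; exact h1 ξ c
  have hπf : ∀ z, π (f z) = SquareMatrix.toEnd (companion ρ) (π z) := fun z =>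
    hext _ _ fun ξ => by
      rw [hπ]
      have := hπ (Module.Dual.transpose (SquareMatrix.toEnd (companion ρ)) ξ) z
      rw [h2] at this
      exact this.symm
  refine ⟨LinearMap.ker π, f.restrict (fun z hz => ?_), splitEquiv (cyclicMap f x ρ) π hr',
    fun z => ?_⟩
  · rw [LinearMap.mem_ker] at *
    rw [hπf, hz, map_zero]
  · simp [splitEquiv, cyclicMap_companion hρ hx]

namespace SymplecticPair

theorem form_neg (P : SymplecticPair F V) (x y : V) : P.form x y = - P.form y x :=
  (LinearMap.IsAlt.neg P.isAlt y x).symm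

theorem form_endo (P : SymplecticPair F V) (x y : V) : P.form (P.endo x) y = P.form x (P.endo y) := by
  have h := P.endo_alternating (x + y)
  simp only [map_add, LinearMap.add_apply, P.endo_alternating, zero_add, add_zero] at h
  rw [P.form_neg (P.endo x) y]
  linear_combination -h

/-- Half of the powers move to the left argument: an even n leaves b(z, z), an odd n leaves b(z,
uz), and both vanish. No division by 2 is involved, so characteristic 2 is covered. -/
theorem form_pow_self (P : SymplecticPair F V) (x : V) (n : ℕ) : P.form x ((P.endo ^ n) x) = 0 := by
  have hadj : ∀ (n : ℕ) x y, P.form ((P.endo ^ n) x) y = P.form x ((P.endo ^ n) y) := by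
    intro n
    induction n with
    | zero => simp
    | succ n ih =>
      intro x y
      rw [pow_succ, Module.End.mul_apply, ih, form_endo, ← Module.End.mul_apply, ← pow_succ',
        ← pow_succ]
  rcases Nat.even_or_odd' n with ⟨k, rfl | rfl⟩
  · rw [two_mul, pow_add, Module.End.mul_apply, ← hadj]
    exact P.isAlt _
  · rw [two_mul, add_assoc, pow_add, Module.End.mul_apply, ← hadj, pow_succ', Module.End.mul_apply]
    exact P.endo_alternating _

/-- This is the total isotropy of cyclic subspaces, obtained by moving g(u) across and expanding in
powers of u. -/
theorem form_aeval_aeval (P : SymplecticPair F V) (x : V) (g k : F[X]) :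
    P.form (aeval P.endo g x) (aeval P.endo k x) = 0 := by
  rw [aeval_adjoint P.form_endo, ← Module.End.mul_apply, ← map_mul, aeval_eq_sum_range]
  simp [form_pow_self]

/-- The cyclic spaces of two dual vectors are isotropic and in duality, so together they carry the
form and the endomorphism of S(C(ρ)). This subspace is nondegenerate, hence its orthogonal is a
stable complement. -/
theorem exists_isIsometric_orthogonalSum_companion [FiniteDimensional F V] (P : SymplecticPair F V)
    {r : F[X]} (hr : Irreducible r) (hm : r.Monic) {n : ℕ} {g : F[X]}
    (hmin : minpoly F P.endo = r ^ (n + 1) * g) (hg : ¬ r ∣ g) :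
    ∃ (V' : Submodule F V) (P' : SymplecticPair F V'),
      P.IsIsometric ((symplecticExtension
        (SquareMatrix.toEnd (companion (r ^ (n + 1))))).orthogonalSum P') := by
  obtain ⟨ρ, hρn⟩ : ∃ ρ, ρ = r ^ (n + 1) := ⟨_, rfl⟩
  rw [← hρn]
  obtain ⟨x, y, hx, hy, hxy⟩ := exists_dual_vectors P.form_endo P.nondegenerate.2 P.nondegenerate.1
    hr hmin hg
  rw [← hρn] at hx hy
  obtain ⟨ψ, h1, h2, h3⟩ := exists_dual_cyclicMap P.form_endo hr hm hρn hx hy hxy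
  have hρ : ρ.Monic := hρn ▸ hm.pow _
  let v := SquareMatrix.toEnd (companion ρ)
  obtain ⟨φ, hφ⟩ : ∃ φ, φ = cyclicMap P.endo x ρ := ⟨_, rfl⟩
  rw [← hφ] at h1
  have h1' : ∀ ξ c, P.form (φ c) (ψ ξ) = - ξ c := fun ξ c => by rw [form_neg, h1]
  have hφφ : ∀ c c', P.form (φ c) (φ c') = 0 := fun c c' => by
    rw [hφ, cyclicMap_eq_aeval, cyclicMap_eq_aeval, form_aeval_aeval]
  have hψψ : ∀ ξ ξ', P.form (ψ ξ) (ψ ξ') = 0 := fun ξ ξ' => by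
    obtain ⟨g, hg⟩ := h3 ξ
    obtain ⟨k, hk⟩ := h3 ξ'
    rw [hg, hk, form_aeval_aeval]
  have hφv : ∀ c, φ (v c) = P.endo (φ c) := fun c => by
    rw [hφ]; exact cyclicMap_companion hρ hx c
  let i : ((Fin (companion ρ).1 → F) × Module.Dual F (Fin (companion ρ).1 → F)) →ₗ[F] V :=
    φ.coprod ψ
  -- Coordinates of the orthogonal projection onto the range of `i`: pairing with `ψ` reads the
  -- vector part and pairing with `φ` the dual part. The kernel is the orthogonal of that range, by
  -- `hker`.
  let π : V →ₗ[F] ((Fin (companion ρ).1 → F) × Module.Dual F (Fin (companion ρ).1 → F)) :=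
    ((Module.evalEquiv F (Fin (companion ρ).1 → F)).symm.toLinearMap ∘ₗ
      (P.form ∘ₗ ψ).flip).prod (P.form.compl₂ φ)
  have hπ1 : ∀ ξ z, ξ (π z).1 = P.form (ψ ξ) z := by
    intro ξ z
    simp [π]
  have hπ2 : ∀ z c, (π z).2 c = P.form z (φ c) := fun _ _ => rfl
  have hext : ∀ c c' : Fin (companion ρ).1 → F,
      (∀ ξ : Module.Dual F (Fin (companion ρ).1 → F), ξ c = ξ c') → c = c' :=
    fun c c' h => sub_eq_zero.1 <| (Module.forall_dual_apply_eq_zero_iff F _).1 fun ξ => by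
      rw [map_sub, h, sub_self]
  have hr' : ∀ c, π (i c) = c := fun c => Prod.ext (hext _ _ fun ξ => by
    rw [hπ1]; simp [i, h1, hψψ]) (LinearMap.ext fun c' => by rw [hπ2]; simp [i, hφφ, h1])
  have hker : ∀ z, π z = 0 ↔ (∀ c, P.form (i c) z = 0) := by
    intro z
    constructor
    · intro hz c
      have e1 := hπ1 c.2 z
      have e2 := hπ2 z c.1
      rw [hz] at e1 e2
      simp only [i, LinearMap.coprod_apply, map_add, LinearMap.add_apply]
      rw [← e1, form_neg, ← e2]
      simp
    · intro hz
      refine Prod.ext (hext _ _ fun ξ => ?_) (LinearMap.ext fun c => ?_)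
      · have := hz (0, ξ)
        rw [hπ1]
        simpa [i] using this
      · have := hz (c, 0)
        rw [hπ2, form_neg]
        simpa [i] using this
  have hi : ∀ c, P.endo (i c) = i ((symplecticExtension v).endo c) := by
    intro c
    have := h2 c.2
    simp [i, symplecticExtension, hφv, this, v]
  have hstab : ∀ z ∈ LinearMap.ker π, P.endo z ∈ LinearMap.ker π := by
    intro z hz
    rw [LinearMap.mem_ker, hker] at *
    intro c
    rw [← form_endo, hi, hz]
  let e := splitEquiv i π hr'
  have he : ∀ z, e z = i z.1 + z.2 := fun z => rfl
  have horth : ∀ c (z : LinearMap.ker π), P.form (i c) z = 0 := fun c z => (hker z).1 z.2 c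
  have horth' : ∀ c (z : LinearMap.ker π), P.form z (i c) = 0 := fun c z => by
    rw [form_neg, horth, neg_zero]
  have hform : ∀ c c', P.form (i c) (i c') = (symplecticExtension v).form c c' := by
    intro c c'
    simp [i, symplecticExtension, hφφ, hψψ, h1, h1']
    try ring
  let P' : SymplecticPair F (LinearMap.ker π) :=
    { form := P.form.restrict (LinearMap.ker π)
      endo := P.endo.restrict hstab
      isAlt := fun z => P.isAlt _
      nondegenerate := by
        -- A vector of the complement is already orthogonal to the range of `i`, so orthogonality to
        -- the complement puts it in the radical of the whole form.
        have key : ∀ z : LinearMap.ker π, (∀ w : LinearMap.ker π, P.form z w = 0) → z = 0 := by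
          intro z hz
          refine Subtype.ext (P.nondegenerate.1 _ fun w => ?_)
          obtain ⟨w, rfl⟩ := e.surjective w
          rw [he, map_add, horth', hz, add_zero]
        refine ⟨key, fun z hz => key z fun w => ?_⟩
        rw [form_neg]
        exact neg_eq_zero.2 (hz w)
      endo_alternating := fun z => P.endo_alternating _ }
  refine ⟨LinearMap.ker π, P', IsIsometric.symm ⟨e, fun z w => ?_, fun z => ?_⟩⟩
  · rw [he, he]
    simp only [map_add, LinearMap.add_apply, horth, horth', hform, add_zero, zero_add]
    rfl
  · rw [he, he, map_add, hi]
    rfl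

end SymplecticPair

end Splitting

/-! ### Kernel dimensions determine the similarity class. -/

section SimilarityInvariants

variable {F : Type u} [Field F]

theorem exists_eq_pow_succ_mul {r a : F[X]} (hr : Irreducible r) (ha : a ≠ 0) (h : r ∣ a) :
    ∃ n g, a = r ^ (n + 1) * g ∧ ¬ r ∣ g := by
  obtain ⟨g, hg, hg'⟩ :=
    (FiniteMultiplicity.of_not_isUnit hr.not_isUnit ha).exists_eq_pow_mul_and_not_dvd
  have hpos : multiplicity r a ≠ 0 := by
    intro h0
    rw [h0, pow_zero, one_mul] at hg
    exact hg' (hg ▸ h)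
  obtain ⟨n, hn⟩ := Nat.exists_eq_succ_of_ne_zero hpos
  exact ⟨n, g, by rw [← Nat.succ_eq_add_one, ← hn]; exact hg, hg'⟩

theorem exists_irreducible_dvd_minpoly {V : Type*} [AddCommGroup V] [Module F V]
    [FiniteDimensional F V] [Nontrivial V] (f : Module.End F V) :
    ∃ r : F[X], r.Monic ∧ Irreducible r ∧ r ∣ minpoly F f := by
  obtain ⟨r, hm, hr, hd⟩ := exists_monic_irreducible_factor (minpoly F f) (minpoly.not_isUnit F f)
  exact ⟨r, hm, hr, hd⟩

theorem kerDim_companion_zero (ρ : F[X]) :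
    kerDim (SquareMatrix.toEnd (companion ρ)) 0 = ρ.natDegree := by
  rw [kerDim_zero, Module.finrank_fin_fun]; rfl

/-- The data determine which polynomials kill f, hence the minimal polynomial; the zero polynomial
records the dimension. The same largest block at a common irreducible factor splits off from both
sides, and the kernel dimensions of the remainders agree by subtraction. -/
theorem isSimilar_of_kerDim_eq {V : Type v} [AddCommGroup V] [Module F V]
    [FiniteDimensional F V] {W : Type w} [AddCommGroup W] [Module F W] [FiniteDimensional F W]
    (f : Module.End F V) (g : Module.End F W) (h : ∀ a, kerDim f a = kerDim g a) :
    IsSimilar f g := by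
  obtain ⟨N, hN⟩ : ∃ N, Module.finrank F V ≤ N := ⟨_, le_rfl⟩
  induction N generalizing V W with
  | zero =>
    have hV : Module.finrank F V = 0 := by omega
    have hW : Module.finrank F W = 0 := by rw [← kerDim_zero g, ← h 0, kerDim_zero, hV]
    have := Module.finrank_zero_iff.1 hV
    have := Module.finrank_zero_iff.1 hW
    exact ⟨LinearEquiv.ofFinrankEq V W (by rw [hV, hW]), fun x => Subsingleton.elim _ _⟩
  | succ N ih =>
    have hVW : Module.finrank F V = Module.finrank F W := by
      rw [← kerDim_zero f, ← kerDim_zero g, h]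
    rcases Nat.eq_zero_or_pos (Module.finrank F V) with h0 | hpos
    · exact ih f g h (by omega)
    have := Module.finrank_pos_iff.1 hpos
    obtain ⟨r, hm, hr, hd⟩ := exists_irreducible_dvd_minpoly f
    obtain ⟨n, c, hc, hc'⟩ := exists_eq_pow_succ_mul hr
      (minpoly.ne_zero (Algebra.IsIntegral.isIntegral f)) hd
    have hiff : ∀ a, aeval f a = 0 ↔ aeval g a = 0 := fun a => by
      rw [← kerDim_eq_finrank_iff, ← kerDim_eq_finrank_iff, h, hVW]
    have hmin : minpoly F f = minpoly F g :=
      eq_of_monic_of_associated (minpoly.monic (Algebra.IsIntegral.isIntegral f))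
        (minpoly.monic (Algebra.IsIntegral.isIntegral g))
        (associated_of_dvd_dvd (minpoly.dvd F f ((hiff _).2 (minpoly.aeval F g)))
          (minpoly.dvd F g ((hiff _).1 (minpoly.aeval F f))))
    obtain ⟨V', f', hf'⟩ := exists_isSimilar_prodMap_companion f hr hm hc hc'
    obtain ⟨W', g', hg'⟩ := exists_isSimilar_prodMap_companion g hr hm (hmin ▸ hc) hc'
    refine (hf'.symm.trans ((IsSimilar.refl _).prodMap (ih f' g' (fun a => ?_) ?_))).trans hg'
    · have h1 := hf'.kerDim_eq a
      have h2 := hg'.kerDim_eq a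
      rw [kerDim_prodMap] at h1 h2
      have := h a
      omega
    · have h1 := hf'.kerDim_eq 0
      rw [kerDim_prodMap, kerDim_companion_zero, kerDim_zero, kerDim_zero] at h1
      have := hr.natDegree_pos
      rw [hm.natDegree_pow] at h1
      have : 0 < (n + 1) * r.natDegree := by positivity
      omega

/-- Kernel dimensions of S(f) are twice those of f, because an endomorphism and its transpose have
the same ones. -/
theorem isSimilar_of_isIsometric_symplecticExtension {V W : Type*} [AddCommGroup V] [Module F V]
    [FiniteDimensional F V] [AddCommGroup W] [Module F W] [FiniteDimensional F W]
    {f : Module.End F V} {g : Module.End F W}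
    (h : (symplecticExtension f).IsIsometric (symplecticExtension g)) : IsSimilar f g := by
  refine isSimilar_of_kerDim_eq f g fun a => ?_
  have := h.isSimilar.kerDim_eq a
  rw [kerDim_symplecticExtension, kerDim_symplecticExtension] at this
  omega

end SimilarityInvariants

/-! ### The commutator of the two terms of a difference. -/

section Commutator

variable {F : Type u} [Field F]

/-- The reflection `t ↦ tr p - tr q - t`, for monic quadratic polynomials `p`, `q`. -/
noncomputable def conjPoly (p q : F[X]) : F[X] := C (q.coeff 1 - p.coeff 1) - X

/-- `[u₁, u₂] = halfPoly(u) u₁ - shiftPoly(u)` if `u = u₁ - u₂` is a difference. -/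
noncomputable def halfPoly (p q : F[X]) : F[X] := 2 * X - C (q.coeff 1 - p.coeff 1)

/-- See `halfPoly`. -/
noncomputable def shiftPoly (p q : F[X]) : F[X] := X ^ 2 - C (q.coeff 1) * X + C (q.coeff 0 - p.coeff 0)

/-- An explicit formula for the fundamental polynomial. -/
noncomputable def fundPoly (p q : F[X]) : F[X] :=
  shiftPoly p q ^ 2 + C (p.coeff 1) * shiftPoly p q * halfPoly p q + C (p.coeff 0) * halfPoly p q ^ 2

/-- This symmetry makes the set of irreducible factors of F_{p,q} stable under reflection. -/
theorem fundPoly_comp_conjPoly (p q : F[X]) :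
    (fundPoly p q).comp (conjPoly p q) = fundPoly p q := by
  simp [fundPoly, conjPoly, halfPoly, shiftPoly]
  ring

theorem monic_quadratic_eq {p : F[X]} (hp : p.Monic) (hp2 : p.natDegree = 2) :
    p = X ^ 2 + C (p.coeff 1) * X + C (p.coeff 0) := by
  conv_lhs => rw [hp.as_sum, hp2]
  simp [Finset.sum_range_succ]
  ring

/-- The quadratic relations give T = h u₁ - s with h = 2u - δ and s a quadratic polynomial in u. The
first relation makes T anticommute with h and controls how it passes s, and this determines T². -/
theorem commutator_relations {A : Type*} [Ring A] [Algebra F A] {p q : F[X]} (hp : p.Monic)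
    (hp2 : p.natDegree = 2) (hq : q.Monic) (hq2 : q.natDegree = 2) {u₁ u₂ : A}
    (h₁ : aeval u₁ p = 0) (h₂ : aeval u₂ q = 0) :
    aeval (u₁ - u₂) (conjPoly p q) * (u₁ * u₂ - u₂ * u₁) =
      (u₁ * u₂ - u₂ * u₁) * (u₁ - u₂) ∧
    (u₁ * u₂ - u₂ * u₁) ^ 2 = aeval (u₁ - u₂) (fundPoly p q) := by
  obtain ⟨a, ha⟩ : ∃ a, a = p.coeff 1 := ⟨_, rfl⟩
  obtain ⟨b, hb⟩ : ∃ b, b = p.coeff 0 := ⟨_, rfl⟩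
  obtain ⟨c, hc⟩ : ∃ c, c = q.coeff 1 := ⟨_, rfl⟩
  obtain ⟨d, hd⟩ : ∃ d, d = q.coeff 0 := ⟨_, rfl⟩
  rw [monic_quadratic_eq hp hp2, ← ha, ← hb] at h₁
  rw [monic_quadratic_eq hq hq2, ← hc, ← hd] at h₂
  simp only [map_add, map_mul, map_pow, aeval_X, aeval_C] at h₁ h₂
  have e₁ : u₁ * u₁ = -(a • u₁) - b • 1 := by
    rw [Algebra.smul_def, Algebra.smul_def, mul_one]
    linear_combination (norm := noncomm_ring) h₁
  have e₂ : u₂ * u₂ = -(c • u₂) - d • 1 := by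
    rw [Algebra.smul_def, Algebra.smul_def, mul_one]
    linear_combination (norm := noncomm_ring) h₂
  have e₁' : ∀ x, u₁ * (u₁ * x) = -(a • (u₁ * x)) - b • x := fun x => by
    rw [← mul_assoc, e₁]; simp [sub_mul]
  have e₂' : ∀ x, u₂ * (u₂ * x) = -(c • (u₂ * x)) - d • x := fun x => by
    rw [← mul_assoc, e₂]; simp [sub_mul]
  obtain ⟨u, hu⟩ : ∃ u, u = u₁ - u₂ := ⟨_, rfl⟩
  obtain ⟨T, hT⟩ : ∃ T, T = u₁ * u₂ - u₂ * u₁ := ⟨_, rfl⟩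
  obtain ⟨h, hh⟩ : ∃ h, h = (2 : F) • u - (c - a) • 1 := ⟨_, rfl⟩
  obtain ⟨s, hs⟩ : ∃ s, s = u * u - c • u + (d - b) • 1 := ⟨_, rfl⟩
  have t1 : T = h * u₁ - s := by
    subst hh hs hT hu
    simp only [mul_sub, sub_mul, add_mul, mul_add, smul_mul_assoc, one_mul, e₁, e₂]
    module
  have t2 : T * u = (c - a) • T - u * T := by
    subst hT hu
    simp only [mul_sub, sub_mul, add_mul, mul_add, smul_mul_assoc, mul_assoc, e₁, e₂, e₁', e₂',
      mul_smul_comm, mul_neg, mul_one]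
    module
  have t3 : T * h = -(h * T) := by
    rw [hh]
    simp only [mul_sub, sub_mul, smul_mul_assoc, mul_smul_comm, mul_one, one_mul, t2]
    module
  have t4 : T * s = s * T + a • (h * T) := by
    rw [hs, hh]
    simp only [mul_sub, mul_add, add_mul, sub_mul, smul_mul_assoc, mul_smul_comm, mul_one, one_mul,
      ← mul_assoc, t2]
    simp only [mul_assoc, t2, mul_sub, mul_smul_comm]
    module
  have t5 : s * h = h * s := by
    rw [hs, hh]
    simp only [mul_sub, mul_add, add_mul, sub_mul, smul_mul_assoc, mul_smul_comm, mul_one, one_mul,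
      mul_assoc]
    module
  have t6 : T * u₁ = -(a • T) - a • s - b • h - s * u₁ := by
    rw [t1, sub_mul, mul_assoc, e₁]
    simp only [mul_sub, mul_neg, mul_smul_comm, mul_one]
    module
  -- Only one factor is replaced by h u₁ - s. After moving T to the right, the remaining occurrence
  -- of h u₁ is traded back for T + s, and all terms in T cancel.
  have t7 : T * T = s * s + a • (s * h) + b • (h * h) := by
    have : T * T = T * (h * u₁ - s) := by rw [← t1]
    have t8 : s * (h * u₁) = s * T + s * s := by
      rw [t1, mul_sub]; abel
    rw [this, mul_sub, ← mul_assoc, t3, neg_mul, mul_assoc, t6, t4]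
    simp only [mul_sub, mul_neg, mul_smul_comm, ← mul_assoc]
    rw [← t5, mul_assoc s h u₁, t8]
    module
  have hcb : aeval u (halfPoly p q) = h := by
    simp [halfPoly, hh, ← ha, ← hc, Algebra.smul_def]
    rw [map_ofNat (aeval u) 2, map_ofNat (algebraMap F A) 2]
  have hsb : aeval u (shiftPoly p q) = s := by
    simp [shiftPoly, hs, ← hb, ← hc, ← hd, Algebra.smul_def, pow_two]
  rw [← hu, ← hT]
  constructor
  · rw [t2, conjPoly, ← ha, ← hc]
    simp [sub_mul, Algebra.smul_def]
  · rw [pow_two, t7, fundPoly, ← ha, ← hb]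
    simp only [map_add, map_mul, map_pow, aeval_C, hcb, hsb, Algebra.smul_def, pow_two, mul_assoc]

end Commutator

/-! ### The fundamental polynomial in explicit form. -/

section Fundamental

variable {F : Type u} [Field F]

theorem exists_eq_mul_of_isRoot {p : F[X]} (hp : p.Monic) (hp2 : p.natDegree = 2) {a : F}
    (ha : p.IsRoot a) : ∃ a', p = (X - C a) * (X - C a') := by
  obtain ⟨r, hr⟩ := dvd_iff_isRoot.2 ha
  have hrm : r.Monic := (monic_X_sub_C a).of_mul_monic_left (hr ▸ hp)
  have hdeg : r.natDegree = 1 := by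
    have := congrArg natDegree hr
    rw [(monic_X_sub_C a).natDegree_mul hrm, natDegree_X_sub_C, hp2] at this
    omega
  refine ⟨-r.coeff 0, ?_⟩
  rw [hr, hrm.eq_X_add_C hdeg]
  simp

theorem coeff_one_mul_X_sub_C (a b : F) : ((X - C a) * (X - C b)).coeff 1 = -(a + b) := by
  have : (X - C a) * (X - C b) = X ^ 2 + C (-(a + b)) * X + C (a * b) := by simp; ring
  rw [this]
  simp

theorem coeff_zero_mul_X_sub_C (a b : F) : ((X - C a) * (X - C b)).coeff 0 = a * b := by
  simp [mul_coeff_zero]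

theorem monic_mul_X_sub_C (a b : F) : ((X - C a) * (X - C b)).Monic :=
  (monic_X_sub_C a).mul (monic_X_sub_C b)

theorem natDegree_mul_X_sub_C (a b : F) : ((X - C a) * (X - C b)).natDegree = 2 := by
  rw [(monic_X_sub_C a).natDegree_mul (monic_X_sub_C b)]; simp

theorem fundPoly_of_left (a b : F) {q : F[X]} (hq : q.Monic) (hq2 : q.natDegree = 2) :
    fundPoly ((X - C a) * (X - C b)) q = q.comp (C a - X) * q.comp (C b - X) := by
  rw [fundPoly, shiftPoly, halfPoly, coeff_one_mul_X_sub_C, coeff_zero_mul_X_sub_C]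
  conv_rhs => rw [monic_quadratic_eq hq hq2]
  simp
  ring

theorem fundPoly_of_right {p : F[X]} (hp : p.Monic) (hp2 : p.natDegree = 2) (a b : F) :
    fundPoly p ((X - C a) * (X - C b)) = p.comp (X + C a) * p.comp (X + C b) := by
  rw [fundPoly, shiftPoly, halfPoly, coeff_one_mul_X_sub_C, coeff_zero_mul_X_sub_C]
  conv_rhs => rw [monic_quadratic_eq hp hp2]
  simp
  ring

/-- A monic quadratic with a root is a product of two linear factors, so the resultant is a product
of two evaluations of the other polynomial. -/
theorem fundamentalPolynomial_eq {p q : F[X]}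
    (hp : p.Monic) (hp2 : p.natDegree = 2) (hq : q.Monic) (hq2 : q.natDegree = 2)
    (hroot : (∃ a : F, p.IsRoot a) ∨ (∃ b : F, q.IsRoot b)) :
    fundamentalPolynomial p q = fundPoly p q := by
  rcases hroot with ⟨a, ha⟩ | ⟨a, ha⟩
  · obtain ⟨b, rfl⟩ := exists_eq_mul_of_isRoot hp hp2 ha
    rw [fundPoly_of_left a b hq hq2, fundamentalPolynomial]
    have h1 : (map (C : F →+* F[X]) ((X - C a) * (X - C b))) =
      (X - C (C a)) * (X - C (C b)) := by simp
    have h2 : ∀ r : F[X], (X - C r : F[X][X]).natDegree = 1 := natDegree_X_sub_C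
    have h3 : ((X - C (C a)) * (X - C (C b)) : F[X][X]).natDegree =
        (X - C (C a) : F[X][X]).natDegree + (X - C (C b) : F[X][X]).natDegree :=
      (monic_X_sub_C _).natDegree_mul (monic_X_sub_C _)
    have h4 : ∀ x : F, eval (C x) ((q.map (C : F →+* F[X])).comp (X - C X)) = q.comp (C x - X) := by
      intro x
      rw [eval_comp, eval_sub, eval_X, eval_C, eval_map]
      rfl
    rw [h1, h3, resultant_mul_left _ _ _ _ le_rfl, h2, h2, resultant_X_sub_C_left _ _ _ le_rfl,
      resultant_X_sub_C_left _ _ _ le_rfl, h4, h4]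
  · obtain ⟨b, rfl⟩ := exists_eq_mul_of_isRoot hq hq2 ha
    rw [fundPoly_of_right hp hp2, fundamentalPolynomial]
    have h1 : (map (C : F →+* F[X]) ((X - C a) * (X - C b))).comp (X - C X) =
      (X - C (X + C a)) * (X - C (X + C b)) := by
      simp
      ring
    have h2 : ∀ r : F[X], (X - C r : F[X][X]).natDegree = 1 := natDegree_X_sub_C
    have h3 : ((X - C (X + C a)) * (X - C (X + C b)) : F[X][X]).natDegree =
        (X - C (X + C a) : F[X][X]).natDegree + (X - C (X + C b) : F[X][X]).natDegree :=
      (monic_X_sub_C _).natDegree_mul (monic_X_sub_C _)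
    have h4 : ∀ x : F[X], eval x (p.map (C : F →+* F[X])) = p.comp x := by
      intro x
      rw [eval_map]
      rfl
    have h5 : (p.map (C : F →+* F[X])).natDegree = 2 := by rw [natDegree_map_eq_of_injective C_injective, hp2]
    rw [h1, h3, resultant_mul_right _ _ _ _ le_rfl, h2, h2, resultant_X_sub_C_right _ _ _ le_rfl,
      resultant_X_sub_C_right _ _ _ le_rfl, h4, h4, h5]
    simp

end Fundamental

/-! ### Reflecting polynomials under t ↦ d - t. -/

section Reflection

variable {F : Type u} [Field F]

/-- The monic polynomial with the roots of `r`, reflected by `t ↦ d - t`. -/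
noncomputable def reflection (d : F) (r : F[X]) : F[X] := C ((-1) ^ r.natDegree) * r.comp (C d - X)

theorem comp_reflect_reflect (d : F) (r : F[X]) : (r.comp (C d - X)).comp (C d - X) = r := by
  simp [comp_assoc]

theorem natDegree_C_sub_X (d : F) : (C d - X : F[X]).natDegree = 1 := by
  rw [← neg_sub, natDegree_neg, natDegree_X_sub_C]

theorem natDegree_comp_reflect (d : F) (r : F[X]) : (r.comp (C d - X)).natDegree = r.natDegree := by
  rw [natDegree_comp, natDegree_C_sub_X, mul_one]

theorem reflection_monic (d : F) {r : F[X]} (hr : r.Monic) : (reflection d r).Monic := by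
  have h1 : (C d - X : F[X]).leadingCoeff = -1 := by
    rw [← neg_sub, leadingCoeff_neg, leadingCoeff_X_sub_C]
  rw [Monic, reflection, leadingCoeff_mul, leadingCoeff_C, leadingCoeff_comp
    (by rw [natDegree_C_sub_X]; exact one_ne_zero), h1, hr.leadingCoeff, one_mul, ← mul_pow]
  simp

theorem isUnit_C_neg_one_pow (n : ℕ) : IsUnit (C ((-1 : F) ^ n)) :=
  isUnit_C.2 ((isUnit_one.neg).pow n)

theorem associated_reflection (d : F) (r : F[X]) : Associated (r.comp (C d - X)) (reflection d r) := by
  rw [reflection, mul_comm]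
  exact (associated_mul_unit_right _ _ (isUnit_C_neg_one_pow _))

theorem natDegree_reflection (d : F) (r : F[X]) : (reflection d r).natDegree = r.natDegree := by
  rw [reflection, natDegree_C_mul (pow_ne_zero _ (by simp)), natDegree_comp_reflect]

theorem reflection_reflection (d : F) (r : F[X]) : reflection d (reflection d r) = r := by
  rw [reflection, natDegree_reflection, reflection, mul_comp, C_comp, comp_reflect_reflect,
    ← mul_assoc, ← C_mul, ← mul_pow]
  simp

theorem dvd_comp_reflect {d : F} {a b : F[X]} (h : a ∣ b) :
    a.comp (C d - X) ∣ b.comp (C d - X) := by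
  obtain ⟨c, rfl⟩ := h
  exact ⟨c.comp (C d - X), by rw [mul_comp]⟩

/-- Substituting d - X is an involution that respects products, so factorisations and units transfer
in both directions. -/
theorem reflection_irreducible (d : F) {r : F[X]} (hr : Irreducible r) :
    Irreducible (reflection d r) := by
  refine (associated_reflection d r).irreducible ?_
  refine ⟨fun h => hr.not_isUnit ?_, fun {a b} h => ?_⟩
  · rw [Polynomial.isUnit_iff_degree_eq_zero] at *
    have h0 : r.comp (C d - X) ≠ 0 := by
      intro h0
      simp [h0] at h
    rw [degree_eq_natDegree h0, natDegree_comp_reflect] at h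
    rw [degree_eq_natDegree hr.ne_zero]
    exact h
  · have h1 : r = a.comp (C d - X) * b.comp (C d - X) := by
      rw [← mul_comp, ← h, comp_reflect_reflect]
    have key : ∀ s : F[X], IsUnit (s.comp (C d - X)) → IsUnit s := by
      intro s hs
      obtain ⟨c, hc, hc'⟩ := Polynomial.isUnit_iff.1 hs
      have := congrArg (fun r => r.comp (C d - X)) hc'
      simp only [C_comp, comp_reflect_reflect] at this
      rw [← this]
      exact isUnit_C.2 hc
    exact (hr.isUnit_or_isUnit h1).imp (key a) (key b)

theorem reflection_pow (d : F) (r : F[X]) (k : ℕ) :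
    reflection d r ^ k = C ((-1) ^ (r.natDegree * k)) * (r ^ k).comp (C d - X) := by
  rw [reflection, mul_pow, ← C_pow, ← pow_mul, pow_comp]

theorem kerDim_congr_associated {V : Type*} [AddCommGroup V] [Module F V] [FiniteDimensional F V]
    (f : Module.End F V) {a b : F[X]} (h : Associated a b) : kerDim f a = kerDim f b :=
  le_antisymm (kerDim_le_of_dvd f h.dvd) (kerDim_le_of_dvd f h.symm.dvd)

/-- Distinct monic irreducible polynomials are coprime. -/
theorem isCoprime_of_irreducible {r s : F[X]} (hr : Irreducible r) (hs : Irreducible s)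
    (hrm : r.Monic) (hsm : s.Monic) (h : r ≠ s) : IsCoprime r s := by
  refine (hr.coprime_iff_not_dvd).2 fun hd => h ?_
  exact eq_of_monic_of_associated hrm hsm ((hr.dvd_irreducible_iff_associated hs).1 hd)

end Reflection

/-! ### Interlacing of the primary parts at r and at its reflection. -/

section Interlacing

variable {F : Type u} [Field F] {V : Type*} [AddCommGroup V] [Module F V] [FiniteDimensional F V]

/-- T induces a surjection from X/Y onto T(X)/T(Y). -/
theorem finrank_map_add_le (T : V →ₗ[F] V) {X Y : Submodule F V} (h : Y ≤ X) :
    Module.finrank F (X.map T) + Module.finrank F Y ≤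
      Module.finrank F (Y.map T) + Module.finrank F X := by
  have key : ∀ Z : Submodule F V, Module.finrank F (Z.map T) +
      Module.finrank F (LinearMap.ker T ⊓ Z : Submodule F V) = Module.finrank F Z := by
    intro Z
    have := LinearMap.finrank_range_add_finrank_ker (T.domRestrict Z)
    rw [LinearMap.range_domRestrict] at this
    rw [← this]
    congr 1
    rw [inf_comm, ← Submodule.map_comap_subtype, Submodule.finrank_map_subtype_eq]
    rfl
  have hX := key X
  have hY := key Y
  have : Module.finrank F (LinearMap.ker T ⊓ Y : Submodule F V) ≤
    Module.finrank F (LinearMap.ker T ⊓ X : Submodule F V) :=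
      Submodule.finrank_mono (inf_le_inf_left _ h)
  omega

/-- With g = d - f, T intertwines f and g in both directions, so T r(g)^j T = r(f)^j Φ(f). The drop
in rank from r^(k+e)c to r^(k+1+e)c at f is therefore a drop between images under T of subspaces of
the range of r(g)^k, hence at most the drop in rank from r(g)^k to r(g)^(k+1). Drops in rank are
increments of kernel dimensions, and the coprime factor c contributes equally to both terms. -/
theorem kerDim_interlacing {f T : Module.End F V} {d : F} {Φ r c : F[X]} {e : ℕ}
    (h : aeval f (C d - X) * T = T * f) (hT : T ^ 2 = aeval f Φ) (hΦ : Φ = r ^ e * c)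
    (hrc : IsCoprime r c) (k : ℕ) :
    kerDim f (r ^ (k + 1 + e)) + kerDim f (reflection d r ^ k) ≤
      kerDim f (r ^ (k + e)) + kerDim f (reflection d r ^ (k + 1)) := by
  obtain ⟨g, hg⟩ : ∃ g, g = aeval f (C d - X) := ⟨_, rfl⟩
  have hgf : ∀ s : F[X], aeval f (s.comp (C d - X)) = aeval g s := fun s => by
    rw [aeval_comp, hg]
  have h2 : T * g = f * T := by
    have hg' : g = algebraMap F _ d - f := by rw [hg]; simp
    rw [← hg, hg', sub_mul, Algebra.commutes] at h
    rw [hg', mul_sub, ← h]; abel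
  have hTf : ∀ (s : F[X]) x, T (aeval f s x) = aeval g s (T x) := fun s x =>
    (aeval_apply_of_intertwine (f := f) (g := g) T
      (fun x => LinearMap.congr_fun (hg ▸ h) x) s x).symm
  have hTg : ∀ (s : F[X]) x, T (aeval g s x) = aeval f s (T x) := fun s x =>
    (aeval_apply_of_intertwine (f := g) (g := f) T
      (fun x => (LinearMap.congr_fun h2 x).symm) s x).symm
  have hK : ∀ j, kerDim f (reflection d r ^ j) = kerDim g (r ^ j) := by
    intro j
    rw [reflection_pow, kerDim_congr_associated f (a := _ * _) (b := (r ^ j).comp (C d - X)),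
      kerDim, hgf, kerDim]
    exact associated_unit_mul_left _ _ (isUnit_C_neg_one_pow _)
  -- This subspace links the two sides: T sends it onto the range of r^(k+e)c at f, and it lies
  -- inside the range of r(g)^k. The quotient estimate is applied once for each fact.
  obtain ⟨X, hX⟩ : ∃ X, X = (LinearMap.range T).map (aeval g (r ^ k)) := ⟨_, rfl⟩
  have hY : X.map (aeval g r) = (LinearMap.range T).map (aeval g (r ^ (k + 1))) := by
    rw [hX, ← Submodule.map_comp, pow_succ', map_mul]; rfl
  have hmap : ∀ j, ((LinearMap.range T).map (aeval g (r ^ j))).map T =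
      LinearMap.range (aeval f (r ^ (j + e) * c)) := by
    intro j
    have : r ^ (j + e) * c = r ^ j * Φ := by rw [hΦ]; ring
    rw [this, map_mul, ← hT]
    ext y
    simp only [Submodule.mem_map, LinearMap.mem_range, exists_exists_eq_and]
    refine exists_congr fun x => ?_
    rw [hTg, Module.End.mul_apply, pow_two, Module.End.mul_apply]
  have hYX : X.map (aeval g r) ≤ X := by
    rw [hX]
    rintro _ ⟨_, ⟨_, ⟨x, rfl⟩, rfl⟩, rfl⟩
    refine ⟨T (aeval f r x), ⟨_, rfl⟩, ?_⟩
    have h3 := congrArg (aeval g) (mul_comm (r ^ k) r)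
    rw [map_mul, map_mul] at h3
    rw [hTf]
    exact LinearMap.congr_fun h3 (T x)
  have hXB : X ≤ LinearMap.range (aeval g (r ^ k)) := by
    rw [hX]
    exact LinearMap.map_le_range
  have e1 := finrank_map_add_le T hYX
  have e2 := finrank_map_add_le (aeval g r) hXB
  rw [hY, hmap, hX, hmap] at e1
  have hB : (LinearMap.range (aeval g (r ^ k))).map (aeval g r) =
      LinearMap.range (aeval g (r ^ (k + 1))) := by
    rw [pow_succ', map_mul, Module.End.mul_eq_comp, LinearMap.range_comp]
  rw [hY, hB, hX] at e2
  have c1 := kerDim_mul_of_isCoprime f (hrc.pow_left (m := k + e))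
  have c2 := kerDim_mul_of_isCoprime f (hrc.pow_left (m := k + 1 + e))
  have d1 := kerDim_add_finrank_range f (r ^ (k + e) * c)
  have d2 := kerDim_add_finrank_range f (r ^ (k + 1 + e) * c)
  have d3 := kerDim_add_finrank_range g (r ^ k)
  have d4 := kerDim_add_finrank_range g (r ^ (k + 1))
  rw [hK, hK]
  omega

end Interlacing

/-! ### Decomposition of a symplectic pair into paired blocks. -/

section Decomposition

variable {F : Type u} [Field F]

/-- By Bézout, r ^ m is a combination of r ^ k and the annihilating polynomial r ^ m * g. -/
theorem kerDim_pow_eq_of_le {V : Type*} [AddCommGroup V] [Module F V] {f : Module.End F V}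
    {r g : F[X]} {m k : ℕ} (h : aeval f (r ^ m * g) = 0) (hrg : IsCoprime r g) (hk : m ≤ k) :
    kerDim f (r ^ k) = kerDim f (r ^ m) := by
  unfold kerDim
  suffices LinearMap.ker (aeval f (r ^ k)) = LinearMap.ker (aeval f (r ^ m)) by rw [this]
  apply le_antisymm
  · intro x hx
    rw [LinearMap.mem_ker] at *
    obtain ⟨s, t, hst⟩ := hrg.pow_left (m := k - m)
    have h1 : r ^ m = s * r ^ k + t * (r ^ m * g) := by
      calc r ^ m = r ^ m * (s * r ^ (k - m) + t * g) := by rw [hst, mul_one]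
        _ = s * (r ^ (k - m) * r ^ m) + t * (r ^ m * g) := by ring
        _ = _ := by rw [← pow_add, Nat.sub_add_cancel hk]
    rw [h1, map_add, map_mul, map_mul, LinearMap.add_apply, Module.End.mul_apply, hx, h]
    simp
  · intro x hx
    rw [LinearMap.mem_ker] at *
    rw [← Nat.sub_add_cancel hk, pow_add, map_mul, Module.End.mul_apply, hx, map_zero]

theorem subsingleton_companion_one : Subsingleton (Fin (companion (1 : F[X])).1 → F) := by
  have : (companion (1 : F[X])).1 = 0 := natDegree_one
  rw [this]
  infer_instance

theorem symplecticExtension_blockSum (M N : SquareMatrix F) :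
    (symplecticExtension (SquareMatrix.toEnd (blockSum M N))).IsIsometric
      ((symplecticExtension (SquareMatrix.toEnd M)).orthogonalSum
        (symplecticExtension (SquareMatrix.toEnd N))) :=
  (isSimilar_toEnd_blockSum M N).symplecticExtension.trans (symplecticExtension_prodMap _ _)

namespace SymplecticPair

variable {V W U : Type*} [AddCommGroup V] [Module F V] [AddCommGroup W] [Module F W]
  [AddCommGroup U] [Module F U]

theorem IsIsometric.kerDim_eq_add [FiniteDimensional F W] [FiniteDimensional F U]
    {P : SymplecticPair F V} {Q : SymplecticPair F W}
    {R : SymplecticPair F U} (h : P.IsIsometric (Q.orthogonalSum R)) (a : F[X]) :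
    kerDim P.endo a = kerDim Q.endo a + kerDim R.endo a := by
  rw [h.isSimilar.kerDim_eq a]
  exact kerDim_prodMap Q.endo R.endo a

theorem IsIsometric.aeval_right_eq_zero {P : SymplecticPair F V} {Q : SymplecticPair F W}
    {R : SymplecticPair F U} (h : P.IsIsometric (Q.orthogonalSum R)) {a : F[X]}
    (ha : aeval P.endo a = 0) : aeval R.endo a = 0 := by
  have h1 : aeval (LinearMap.prodMap Q.endo R.endo : Module.End F (W × U)) a = 0 :=
    h.isSimilar.aeval_eq_zero ha
  rw [aeval_prodMap] at h1
  ext x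
  simpa using congrArg Prod.snd (LinearMap.congr_fun h1 ((0 : W), x))

/-- Splitting off a block of maximal size attached to an irreducible polynomial. -/
theorem exists_split {V : Type w} [AddCommGroup V] [Module F V] [FiniteDimensional F V]
    (P : SymplecticPair F V) {r : F[X]} (hr : Irreducible r) (hm : r.Monic) :
    ∃ (m : ℕ) (V' : Type w) (_ : AddCommGroup V') (_ : Module F V') (_ : FiniteDimensional F V')
      (P' : SymplecticPair F V'),
      P.IsIsometric ((symplecticExtension
        (SquareMatrix.toEnd (companion (r ^ m)))).orthogonalSum P') ∧
      (∀ k, m ≤ k → kerDim P.endo (r ^ k) = kerDim P.endo (r ^ m)) ∧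
      (r ∣ minpoly F P.endo → 1 ≤ m) := by
  by_cases hd : r ∣ minpoly F P.endo
  · obtain ⟨n, g, hg, hg'⟩ := exists_eq_pow_succ_mul hr
      (minpoly.ne_zero (Algebra.IsIntegral.isIntegral P.endo)) hd
    obtain ⟨V', P', h⟩ := P.exists_isIsometric_orthogonalSum_companion hr hm hg hg'
    refine ⟨n + 1, V', inferInstance, inferInstance, inferInstance, P', h, fun k hk => ?_,
      fun _ => by omega⟩
    exact kerDim_pow_eq_of_le (by rw [← hg, minpoly.aeval]) (hr.coprime_iff_not_dvd.2 hg') hk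
  · have := subsingleton_companion_one (F := F)
    -- When r is absent the block has size 0: C(1) is the empty matrix and nothing is split off.
    refine ⟨0, V, inferInstance, inferInstance, inferInstance, P, ?_, fun k hk => ?_,
      fun h => absurd h hd⟩
    · rw [pow_zero]
      exact isIsometric_orthogonalSum_of_subsingleton _ _
    · exact kerDim_pow_eq_of_le (g := minpoly F P.endo) (by rw [pow_zero, one_mul, minpoly.aeval])
        (hr.coprime_iff_not_dvd.2 hd) hk

end SymplecticPair

/-- The sizes of the primary blocks of `f` attached to `r` and to its reflection differ by at
most `e`. -/
def Interlaced {V : Type*} [AddCommGroup V] [Module F V] (d : F) (Φ : F[X]) (e : ℕ)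
    (f : Module.End F V) : Prop :=
  ∀ r : F[X], r.Monic → Irreducible r → r ∣ Φ → reflection d r ≠ r → ∀ k,
    kerDim f (r ^ (k + 1 + e)) + kerDim f (reflection d r ^ k) ≤
      kerDim f (r ^ (k + e)) + kerDim f (reflection d r ^ (k + 1))

/-- The elementary blocks. -/
def IsBlock (d : F) (Φ : F[X]) (e : ℕ) (M : SquareMatrix F) : Prop :=
  ∃ r : F[X], r.Monic ∧ Irreducible r ∧ r ∣ Φ ∧
    ((reflection d r = r ∧ ∃ m, 1 ≤ m ∧ M = companion (r ^ m)) ∨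
     (reflection d r ≠ r ∧ ∃ m m', 1 ≤ m ∧ m' ≤ m ∧ m ≤ m' + e ∧
        M = blockSum (companion (r ^ m)) (companion (reflection d r ^ m'))))

theorem mul_min_succ (D k m : ℕ) :
    D * min (k + 1) m = D * min k m + if k < m then D else 0 := by
  split_ifs with h
  · rw [min_eq_left h, min_eq_left h.le, mul_add, mul_one]
  · rw [min_eq_right (by omega), min_eq_right (by omega), add_zero]

theorem reflection_dvd {d : F} {Φ r : F[X]} (hΦ : Φ.comp (C d - X) = Φ) (h : r ∣ Φ) :
    reflection d r ∣ Φ :=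
  (associated_reflection d r).symm.dvd.trans (hΦ ▸ dvd_comp_reflect h)

theorem kerDim_blocks_of_ne {r s : F[X]} (hr : Irreducible r) (hs : Irreducible s)
    (hrm : r.Monic) (hsm : s.Monic) (h : s ≠ r) (m k : ℕ) :
    kerDim (SquareMatrix.toEnd (companion (r ^ m))) (s ^ k) = 0 :=
  kerDim_companion_of_isCoprime (hrm.pow m) ((isCoprime_of_irreducible hs hr hsm hrm h).pow)

/-- Greedy pairing: the largest block at r is removed together with the largest block at its
reflection. Interlacing bounds the difference of the two sizes and persists on the remainder, so
induction on the dimension applies. -/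
theorem SymplecticPair.exists_isIsometric_blockSumList {d : F} {Φ : F[X]} {e N : ℕ}
    (hΦ : Φ.comp (C d - X) = Φ) {V : Type w} [AddCommGroup V] [Module F V] [FiniteDimensional F V]
    (P : SymplecticPair F V) (hN : aeval P.endo (Φ ^ N) = 0) (hP : Interlaced d Φ e P.endo) :
    ∃ L : List (SquareMatrix F), (∀ M ∈ L, IsBlock d Φ e M) ∧
      P.IsIsometric (symplecticExtension (SquareMatrix.toEnd (blockSumList L))) := by
  obtain ⟨n, hn⟩ : ∃ n, Module.finrank F V ≤ n := ⟨_, le_rfl⟩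
  induction n generalizing V with
  | zero =>
    have := Module.finrank_zero_iff.1 (Nat.le_zero.1 hn)
    refine ⟨[], by simp, ?_⟩
    have : Subsingleton (Fin (blockSumList ([] : List (SquareMatrix F))).1 → F) :=
      inferInstanceAs (Subsingleton (Fin 0 → F))
    refine ⟨LinearEquiv.ofFinrankEq _ _ ?_, fun x y => ?_, fun x => Subsingleton.elim _ _⟩
    · rw [Module.finrank_zero_of_subsingleton, Module.finrank_zero_of_subsingleton]
    · rw [Subsingleton.elim x 0]; simp
  | succ n ih =>
    rcases subsingleton_or_nontrivial V with hV | hV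
    · exact ih P hN hP (by rw [Module.finrank_zero_of_subsingleton]; omega)
    obtain ⟨r, hrm, hr, hd⟩ := exists_irreducible_dvd_minpoly P.endo
    have hrΦ : r ∣ Φ := hr.prime.dvd_of_dvd_pow (hd.trans (minpoly.dvd F _ hN))
    obtain ⟨m, V₁, _, _, _, P₁, h₁, hst, hm⟩ := P.exists_split hr hrm
    have hm := hm hd
    have hK₁ : ∀ a, kerDim P.endo a =
        2 * kerDim (SquareMatrix.toEnd (companion (r ^ m))) a + kerDim P₁.endo a := fun a => by
      rw [h₁.kerDim_eq_add a, kerDim_symplecticExtension]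
    have hdim : Module.finrank F V₁ ≤ n := by
      have := hK₁ 0
      rw [kerDim_companion_zero, kerDim_zero, kerDim_zero, hrm.natDegree_pow] at this
      have h0 := hr.natDegree_pos
      have : 0 < m * r.natDegree := by positivity
      omega
    by_cases hself : reflection d r = r
    · have hI : Interlaced d Φ e P₁.endo := by
        intro s hsm hs hsΦ hsr k
        have h := hP s hsm hs hsΦ hsr k
        have hs' := reflection_irreducible d hs
        have hsm' := reflection_monic d hsm
        have h1 : s ≠ r := fun h => hsr (h ▸ hself)
        have h2 : reflection d s ≠ r := fun h => h1 (by
          rw [← reflection_reflection d s, h, hself])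
        simp only [hK₁, kerDim_blocks_of_ne hr hs hrm hsm h1,
          kerDim_blocks_of_ne hr hs' hrm hsm' h2] at h
        omega
      obtain ⟨L, hL, hL'⟩ := ih P₁ (h₁.aeval_right_eq_zero hN) hI hdim
      refine ⟨companion (r ^ m) :: L, ?_, ?_⟩
      · simp only [List.mem_cons, forall_eq_or_imp]
        exact ⟨⟨r, hrm, hr, hrΦ, Or.inl ⟨hself, m, hm, rfl⟩⟩, hL⟩
      · exact (h₁.trans ((IsIsometric.refl _).orthogonalSum hL')).trans
          (symplecticExtension_blockSum _ _).symm
    · obtain ⟨r', hr'⟩ : ∃ r', r' = reflection d r := ⟨_, rfl⟩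
      rw [← hr'] at hself
      have hrr' : reflection d r' = r := by rw [hr', reflection_reflection]
      have hri' : Irreducible r' := hr' ▸ reflection_irreducible d hr
      have hrm' : r'.Monic := hr' ▸ reflection_monic d hrm
      have hdeg : r'.natDegree = r.natDegree := by rw [hr', natDegree_reflection]
      -- The reflected factor need not divide the minimal polynomial, so m' = 0 is allowed here.
      obtain ⟨m', V₂, _, _, _, P₂, h₂, hst', -⟩ := P₁.exists_split hri' hrm'
      have hK₂ : ∀ a, kerDim P.endo a =
          2 * kerDim (SquareMatrix.toEnd (companion (r ^ m))) a +
          2 * kerDim (SquareMatrix.toEnd (companion (r' ^ m'))) a + kerDim P₂.endo a := fun a => by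
        rw [hK₁, h₂.kerDim_eq_add a, kerDim_symplecticExtension, add_assoc]
      have hdim₂ : Module.finrank F V₂ ≤ n := by
        have := h₂.kerDim_eq_add 0
        rw [kerDim_zero, kerDim_zero, kerDim_zero] at this
        omega
      obtain ⟨D, hD⟩ : ∃ D, D = r.natDegree := ⟨_, rfl⟩
      have hDpos : 0 < D := hD ▸ hr.natDegree_pos
      have hKr : ∀ k, kerDim P.endo (r ^ k) = 2 * (D * min k m) + kerDim P₂.endo (r ^ k) := by
        intro k
        rw [hK₂, kerDim_companion_pow hrm, kerDim_blocks_of_ne hri' hr hrm' hrm (Ne.symm hself),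
          hD]
        omega
      have hKr' : ∀ k, kerDim P.endo (r' ^ k) =
          2 * (D * min k m') + kerDim P₂.endo (r' ^ k) := by
        intro k
        rw [hK₂, kerDim_companion_pow hrm', kerDim_blocks_of_ne hr hri' hrm hrm' hself,
          hdeg, hD]
        omega
      have hst'' : ∀ k, m' ≤ k → kerDim P.endo (r' ^ k) = kerDim P.endo (r' ^ m') := by
        intro k hk
        have h := hst' k hk
        rw [hK₁, hK₁, h, kerDim_blocks_of_ne hr hri' hrm hrm' hself,
          kerDim_blocks_of_ne hr hri' hrm hrm' hself]
      have hmono : ∀ s : F[X], ∀ k, kerDim P₂.endo (s ^ k) ≤ kerDim P₂.endo (s ^ (k + 1)) :=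
        fun s k => kerDim_le_of_dvd _ (pow_dvd_pow s (Nat.le_succ k))
      -- the estimates are symmetric in `(r, m)` and `(r', m')`
      have key : ∀ {a a' : F[X]} {i i' : ℕ},
          (∀ k, kerDim P.endo (a ^ k) = 2 * (D * min k i) + kerDim P₂.endo (a ^ k)) →
          (∀ k, kerDim P.endo (a' ^ k) = 2 * (D * min k i') + kerDim P₂.endo (a' ^ k)) →
          (∀ k, i ≤ k → kerDim P.endo (a ^ k) = kerDim P.endo (a ^ i)) →
          (∀ k, i' ≤ k → kerDim P.endo (a' ^ k) = kerDim P.endo (a' ^ i')) →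
          (∀ k, kerDim P.endo (a ^ (k + 1 + e)) + kerDim P.endo (a' ^ k) ≤
            kerDim P.endo (a ^ (k + e)) + kerDim P.endo (a' ^ (k + 1))) →
          i ≤ i' + e ∧ ∀ k, kerDim P₂.endo (a ^ (k + 1 + e)) + kerDim P₂.endo (a' ^ k) ≤
            kerDim P₂.endo (a ^ (k + e)) + kerDim P₂.endo (a' ^ (k + 1)) := by
        intro a a' i i' hi hi' hs hs' hint
        have hle : i ≤ i' + e := by
          by_contra! hlt
          -- At this k the kernels at a' have stabilised, so interlacing forbids growth at a from k
          -- + e = i - 1 to i; but the block of size i does grow there.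
          obtain ⟨k, rfl⟩ : ∃ k, i = k + 1 + e := ⟨i - 1 - e, by omega⟩
          have e1 := hint k
          have e2 := hs' k (by omega)
          have e3 := hs' (k + 1) (by omega)
          have e4 := hi (k + 1 + e)
          have e5 := hi (k + e)
          have e6 := mul_min_succ D (k + e) (k + 1 + e)
          rw [if_pos (by omega)] at e6
          have e7 : k + e + 1 = k + 1 + e := by omega
          have e8 := hmono a (k + e)
          rw [e7] at e6 e8
          omega
        refine ⟨hle, fun k => ?_⟩
        have e1 := hint k
        have e2 := hi (k + 1 + e)
        have e3 := hi (k + e)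
        have e4 := hi' k
        have e5 := hi' (k + 1)
        have e6 := mul_min_succ D (k + e) i
        have e7 := mul_min_succ D k i'
        have e8 : k + e + 1 = k + 1 + e := by omega
        rw [e8] at e6
        have e9 := hmono a' k
        -- If k + e < i then k < i', so the removed blocks contribute the same increment 2D on both
        -- sides. Otherwise the kernels at a have stabilised and the increment of the remainder at a
        -- is zero.
        by_cases hk : k + e < i
        · rw [if_pos hk] at e6
          rw [if_pos (by omega)] at e7
          omega
        · rw [if_neg hk] at e6
          have f1 := hs (k + e) (by omega)
          have f2 := hs (k + 1 + e) (by omega)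
          omega
      have hrΦ' : r' ∣ Φ := hr' ▸ reflection_dvd hΦ hrΦ
      have k₁ := key hKr hKr' hst hst'' (fun k => by
        have := hP r hrm hr hrΦ (hr' ▸ hself) k
        rwa [← hr'] at this)
      have k₂ := key hKr' hKr hst'' hst (fun k => by
        have := hP r' hrm' hri' hrΦ' (hrr'.symm ▸ Ne.symm hself) k
        rwa [hrr'] at this)
      have hI : Interlaced d Φ e P₂.endo := by
        intro s hsm hs hsΦ hsr k
        by_cases h1 : s = r
        · subst h1
          rw [← hr']
          exact k₁.2 k
        by_cases h2 : s = r'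
        · subst h2
          rw [hrr']
          exact k₂.2 k
        have h := hP s hsm hs hsΦ hsr k
        have hs' := reflection_irreducible d hs
        have hsm' := reflection_monic d hsm
        have h3 : reflection d s ≠ r := fun h => h2 (by
          rw [← reflection_reflection d s, h, hr'])
        have h4 : reflection d s ≠ r' := fun h => h1 (by
          rw [← reflection_reflection d s, h, hrr'])
        simp only [hK₂, kerDim_blocks_of_ne hr hs hrm hsm h1,
          kerDim_blocks_of_ne hr hs' hrm hsm' h3,
          kerDim_blocks_of_ne hri' hs hrm' hsm h2,
          kerDim_blocks_of_ne hri' hs' hrm' hsm' h4] at h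
        omega
      obtain ⟨L, hL, hL'⟩ := ih P₂ (h₂.aeval_right_eq_zero (h₁.aeval_right_eq_zero hN)) hI hdim₂
      have hiso := h₁.trans ((IsIsometric.refl _).orthogonalSum
        (h₂.trans ((IsIsometric.refl _).orthogonalSum hL')))
      -- The irreducible polynomial with the larger exponent is listed first.
      rcases le_total m' m with hle | hle
      · refine ⟨blockSum (companion (r ^ m)) (companion (r' ^ m')) :: L, ?_, ?_⟩
        · simp only [List.mem_cons, forall_eq_or_imp]
          exact ⟨⟨r, hrm, hr, hrΦ, Or.inr ⟨hr' ▸ hself, m, m', hm, hle, k₁.1, by rw [hr']⟩⟩, hL⟩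
        · refine IsIsometric.trans ?_ (symplecticExtension_blockSum _ _).symm
          refine IsIsometric.trans ?_
            ((symplecticExtension_blockSum _ _).symm.orthogonalSum (IsIsometric.refl _))
          exact hiso.trans (isIsometric_orthogonalSum_assoc _ _ _).symm
      · refine ⟨blockSum (companion (r' ^ m')) (companion (r ^ m)) :: L, ?_, ?_⟩
        · simp only [List.mem_cons, forall_eq_or_imp]
          refine ⟨⟨r', hrm', hri', hrΦ', Or.inr ⟨hrr'.symm ▸ Ne.symm hself, m', m, by omega, hle,
            k₂.1, by rw [hrr']⟩⟩, hL⟩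
        · refine IsIsometric.trans ?_ (symplecticExtension_blockSum _ _).symm
          refine IsIsometric.trans ?_
            ((symplecticExtension_blockSum _ _).symm.orthogonalSum (IsIsometric.refl _))
          refine IsIsometric.trans ?_
            ((isIsometric_orthogonalSum_comm _ _).orthogonalSum (IsIsometric.refl _))
          exact hiso.trans (isIsometric_orthogonalSum_assoc _ _ _).symm

end Decomposition

/-! ### Differences attached to r and a distinct reflection. -/

section ExistenceDistinct

variable {F : Type u} [Field F]

theorem isCyclicOf_quotient {ρ : F[X]} (hρ : ρ.Monic) :
    IsCyclicOf (LinearMap.mulLeft F (Ideal.Quotient.mk (Ideal.span {ρ}) X)) ρ :=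
  isCyclicOf_adjoinRoot hρ

theorem dvd_comp_reflect_iff (d : F) (a b : F[X]) :
    a ∣ b.comp (C d - X) ↔ a.comp (C d - X) ∣ b := by
  constructor
  · intro h
    have := dvd_comp_reflect (d := d) h
    rwa [comp_reflect_reflect] at this
  · intro h
    have := dvd_comp_reflect (d := d) h
    rwa [comp_reflect_reflect] at this

/-- A polynomial g in multiplication by d - X kills the class of 1 exactly when r ^ m divides g(d -
X). This realises the reflected block on a quotient by a power of r itself. -/
theorem isCyclicOf_quotient_reflect (d : F) {r : F[X]} (hr : r.Monic) (m : ℕ) :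
    IsCyclicOf (LinearMap.mulLeft F (Ideal.Quotient.mk (Ideal.span {r ^ m}) (C d - X)))
      (reflection d r ^ m) := by
  refine ⟨⟨1, fun g => ?_⟩, ?_⟩
  · have h1 : aeval (LinearMap.mulLeft F (Ideal.Quotient.mk (Ideal.span {r ^ m}) (C d - X))) g =
        LinearMap.mulLeft F (aeval (Ideal.Quotient.mk (Ideal.span {r ^ m}) (C d - X)) g) :=
      (aeval_algHom_apply (Algebra.lmul F (F[X] ⧸ Ideal.span {r ^ m})) _ g)
    have h2 : aeval (Ideal.Quotient.mk (Ideal.span {r ^ m}) (C d - X)) g =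
        Ideal.Quotient.mk (Ideal.span {r ^ m}) (g.comp (C d - X)) := by
      have := aeval_algHom_apply (Ideal.Quotient.mkₐ F (Ideal.span {r ^ m})) (C d - X) g
      rw [Ideal.Quotient.mkₐ_eq_mk] at this
      exact this
    rw [h1, h2, LinearMap.mulLeft_apply, mul_one, Ideal.Quotient.eq_zero_iff_mem,
      Ideal.mem_span_singleton, dvd_comp_reflect_iff, reflection_pow]
    exact (associated_unit_mul_left _ _ (isUnit_C_neg_one_pow _)).symm.dvd_iff_dvd_left
  · rw [(isCyclicOf_quotient (hr.pow m)).2, (reflection_monic d hr).natDegree_pow,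
      natDegree_reflection, hr.natDegree_pow]

/-- The polynomial 2X - d = X - (d - X) divides r(X) - r(d - X). If r divided it, then r would
divide its own reflection. -/
theorem isCoprime_halfPoly {p q r : F[X]} (hr : Irreducible r) (hrm : r.Monic)
    (h : reflection (q.coeff 1 - p.coeff 1) r ≠ r) : IsCoprime r (halfPoly p q) := by
  obtain ⟨d, hd⟩ : ∃ d, d = q.coeff 1 - p.coeff 1 := ⟨_, rfl⟩
  rw [← hd] at h
  refine hr.coprime_iff_not_dvd.2 fun hdvd => h ?_
  have h1 : X - (C d - X) ∣ r.comp X - r.comp (C d - X) := by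
    have := sub_dvd_eval_sub X (C d - X) (r.map (C : F →+* F[X]))
    rw [eval_map, eval_map] at this
    exact this
  rw [comp_X] at h1
  have h2 : r ∣ r.comp (C d - X) := by
    have h3 : r ∣ r - r.comp (C d - X) := by
      refine dvd_trans ?_ h1
      have : X - (C d - X) = halfPoly p q := by rw [halfPoly, hd]; ring
      rwa [this]
    have := dvd_sub dvd_rfl h3
    rwa [sub_sub_cancel] at this
  have h4 := h2.trans (associated_reflection d r).dvd
  exact (eq_of_monic_of_associated hrm (reflection_monic d hrm)
    ((hr.dvd_irreducible_iff_associated (reflection_irreducible d hr)).1 h4)).symm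

/-- The endomorphism `(x, y) ↦ (A x + ι y, π x + (-a - A) y)`. -/
noncomputable def crossMap {M N : Type*} [AddCommGroup M] [Module F[X] M] [AddCommGroup N]
    [Module F[X] N] (π : M →ₗ[F[X]] N) (ι : N →ₗ[F[X]] M) (A : F[X]) (a : F) :
    Module.End F[X] (M × N) :=
  ((A • LinearMap.id).coprod ι).prod (π.coprod ((-C a - A) • LinearMap.id))

/-- Cayley–Hamilton for a 2 × 2 matrix of maps: the diagonal entries add up to -a, the off-diagonal
ones compose to κ, and the hypotheses say that A(-a - A) - κ acts as b. -/
theorem crossMap_quadratic {M N : Type*} [AddCommGroup M] [Module F[X] M] [AddCommGroup N]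
    [Module F[X] N] {π : M →ₗ[F[X]] N} {ι : N →ₗ[F[X]] M} {A κ : F[X]} {a b : F}
    (h₁ : ∀ x, ι (π x) = κ • x) (h₂ : ∀ y, π (ι y) = κ • y)
    (hM : ∀ x : M, (A ^ 2 + C a * A + C b + κ) • x = 0)
    (hN : ∀ y : N, (A ^ 2 + C a * A + C b + κ) • y = 0) (z : M × N) :
    crossMap π ι A a (crossMap π ι A a z) + C a • crossMap π ι A a z + C b • z = 0 := by
  obtain ⟨x, y⟩ := z
  have key : ∀ x y, crossMap π ι A a (x, y) = (A • x + ι y, π x + (-C a - A) • y) :=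
    fun _ _ => rfl
  rw [key, key]
  simp only [map_add, map_smul, h₁, h₂]
  refine Prod.ext ?_ ?_
  · change A • (A • x + ι y) + (κ • x + (-C a - A) • ι y) + C a • (A • x + ι y) + C b • x = 0
    rw [← hM x]
    module
  · change A • π x + κ • y + (-C a - A) • (π x + (-C a - A) • y) +
      C a • (π x + (-C a - A) • y) + C b • y = 0
    rw [← hN y]
    module

/-- Since T = h u₁ - s must exchange the two summands while h is invertible modulo r ^ m, the
diagonal of u₁ has to start with s/h, and its off-diagonal entries must compose to -F_{p,q}/h². Both
u₁ and u₂ = u₁ - u are built from this prescription. The bound m ≤ m' + e is what makes the second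
off-diagonal map well defined. -/
theorem isDifference_blockSum {p q : F[X]} (hp : p.Monic) (hp2 : p.natDegree = 2)
    (hq : q.Monic) (hq2 : q.natDegree = 2) {r c : F[X]} {e m m' : ℕ} (hr : Irreducible r)
    (hrm : r.Monic) (h : reflection (q.coeff 1 - p.coeff 1) r ≠ r) (hΦ : fundPoly p q = r ^ e * c)
    (hm : m' ≤ m) (hm' : m ≤ m' + e) :
    IsDifference p q (SquareMatrix.toEnd (blockSum (companion (r ^ m))
      (companion (reflection (q.coeff 1 - p.coeff 1) r ^ m')))) := by
  obtain ⟨d, hd⟩ : ∃ d, d = q.coeff 1 - p.coeff 1 := ⟨_, rfl⟩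
  -- `h'` is an inverse of `halfPoly p q` modulo r ^ m.
  obtain ⟨w, h', hw⟩ := (isCoprime_halfPoly hr hrm h).pow_left (m := m)
  rw [← hd] at h ⊢
  let I := Ideal.span {r ^ m}
  let J := Ideal.span {r ^ m'}
  have hfin : ∀ k, Module.Finite F (F[X] ⧸ Ideal.span {r ^ k}) := fun k =>
    (AdjoinRoot.powerBasis' (hrm.pow k)).finite
  have hI := hfin m
  have hJ := hfin m'
  obtain ⟨κ, hκ⟩ : ∃ κ, κ = -(fundPoly p q * h' ^ 2) := ⟨_, rfl⟩
  let π : (F[X] ⧸ I) →ₗ[F[X]] (F[X] ⧸ J) := Submodule.mapQ I J LinearMap.id (by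
    rw [Submodule.comap_id, Ideal.span_singleton_le_span_singleton]
    exact pow_dvd_pow r hm)
  -- Multiplication by κ descends because r ^ e divides κ, so that κ is a multiple of r ^ e and r ^
  -- m' κ is a multiple of r ^ m.
  let ι : (F[X] ⧸ J) →ₗ[F[X]] (F[X] ⧸ I) := Submodule.mapQ J I (κ • LinearMap.id) (by
    refine (Ideal.span_singleton_le_iff_mem _).2 ?_
    rw [Submodule.mem_comap, LinearMap.smul_apply, LinearMap.id_apply]
    refine Ideal.mem_span_singleton.2 ?_
    have h1 : r ^ m ∣ r ^ (m' + e) := pow_dvd_pow r hm'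
    rw [hκ, hΦ, smul_eq_mul]
    exact h1.trans ⟨-(c * h' ^ 2), by ring⟩)
  have hιπ : ∀ x, ι (π x) = κ • x := by
    intro x
    obtain ⟨x, rfl⟩ := Submodule.Quotient.mk_surjective _ x
    rfl
  have hπι : ∀ x, π (ι x) = κ • x := by
    intro x
    obtain ⟨x, rfl⟩ := Submodule.Quotient.mk_surjective _ x
    rfl
  have hzI : ∀ (s : F[X]), r ^ m ∣ s → ∀ x : F[X] ⧸ I, s • x = 0 := by
    intro s hs x
    obtain ⟨x, rfl⟩ := Submodule.Quotient.mk_surjective _ x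
    rw [← Submodule.Quotient.mk_smul, Submodule.Quotient.mk_eq_zero]
    exact Ideal.mem_span_singleton.2 (hs.mul_right x)
  have hzJ : ∀ (s : F[X]), r ^ m ∣ s → ∀ x : F[X] ⧸ J, s • x = 0 := by
    intro s hs x
    obtain ⟨x, rfl⟩ := Submodule.Quotient.mk_surjective _ x
    rw [← Submodule.Quotient.mk_smul, Submodule.Quotient.mk_eq_zero]
    exact Ideal.mem_span_singleton.2 (((pow_dvd_pow r hm).trans hs).mul_right x)
  obtain ⟨A, hA⟩ : ∃ A, A = shiftPoly p q * h' := ⟨_, rfl⟩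
  have d₁ : r ^ m ∣ A ^ 2 + C (p.coeff 1) * A + C (p.coeff 0) + κ := by
    refine ⟨w * (C (p.coeff 1) * A + C (p.coeff 0) * (1 + h' * halfPoly p q)), ?_⟩
    rw [hA, hκ, fundPoly]
    linear_combination (-(C (p.coeff 1) * (shiftPoly p q * h') +
      C (p.coeff 0) * (1 + h' * halfPoly p q))) * hw
  have d₂ : r ^ m ∣ (A - X) ^ 2 + C (q.coeff 1) * (A - X) + C (q.coeff 0) + κ := by
    -- The formula for T² written with u₂ instead of u₁: substituting u₁ = u₂ + u turns s into s -
    -- uh.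
    have hid : fundPoly p q = (shiftPoly p q - X * halfPoly p q) ^ 2 +
        C (q.coeff 1) * (shiftPoly p q - X * halfPoly p q) * halfPoly p q +
        C (q.coeff 0) * halfPoly p q ^ 2 := by
      simp only [fundPoly, shiftPoly, halfPoly, C_sub]
      ring
    obtain ⟨W, hW⟩ : ∃ W, W = w * r ^ m := ⟨_, rfl⟩
    have hH : h' * halfPoly p q = 1 - W := by rw [hW]; linear_combination hw
    have hE : (shiftPoly p q - X * halfPoly p q) * h' = (A - X) + X * W := by
      rw [hA]; linear_combination (-X) * hH
    have hκ' : κ = -((A - X + X * W) ^ 2 + C (q.coeff 1) * (A - X + X * W) * (1 - W) +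
        C (q.coeff 0) * (1 - W) ^ 2) := by
      rw [← hE, ← hH, hκ, hid]; ring
    have hdvd : r ^ m ∣ W := ⟨w, by rw [hW, mul_comm]⟩
    refine hdvd.trans ⟨-2 * (A - X) * X - X ^ 2 * W - C (q.coeff 1) * X +
      C (q.coeff 1) * (A - X) + C (q.coeff 1) * X * W + 2 * C (q.coeff 0) - C (q.coeff 0) * W, ?_⟩
    rw [hκ']
    ring
  let U₁ := crossMap π ι A (p.coeff 1)
  let U₂ := crossMap π ι (A - X) (q.coeff 1)
  have hsmul : ∀ (a : F) (z : (F[X] ⧸ I) × (F[X] ⧸ J)), C a • z = a • z := by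
    intro a z
    rw [← algebraMap_smul F[X] a z]; rfl
  refine IsSimilar.isDifference (f := (U₁.restrictScalars F - U₂.restrictScalars F)) ?_ ?_
  · refine IsSimilar.trans ?_ (isSimilar_toEnd_blockSum _ _).symm
    refine IsSimilar.trans ?_ (((isCyclicOf_quotient (hrm.pow m)).isSimilar
      (hrm.pow m)).symm.prodMap ((isCyclicOf_quotient_reflect d hrm m').isSimilar
      ((reflection_monic d hrm).pow m')).symm)
    -- The off-diagonal entries cancel, and the diagonal becomes multiplication by X and by d - X.
    have : (U₁.restrictScalars F - U₂.restrictScalars F) = LinearMap.prodMap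
        (LinearMap.mulLeft F (Ideal.Quotient.mk (Ideal.span {r ^ m}) X))
        (LinearMap.mulLeft F (Ideal.Quotient.mk (Ideal.span {r ^ m'}) (C d - X))) := by
      refine LinearMap.ext fun z => ?_
      obtain ⟨x, y⟩ := z
      refine Prod.ext ?_ ?_
      · have h1 : (A • x + ι y) - ((A - X) • x + ι y) = (X : F[X]) • x := by module
        exact h1
      · have h1 : (π x + (-C (p.coeff 1) - A) • y) - (π x + (-C (q.coeff 1) - (A - X)) • y) =
          (C d - X) • y := by
          rw [hd, C_sub]; module
        exact h1
    rw [this]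
    exact IsSimilar.refl _
  · refine ⟨U₁.restrictScalars F, U₂.restrictScalars F, ?_, ?_, rfl⟩
    · refine LinearMap.ext fun z => ?_
      have := crossMap_quadratic hιπ hπι (hzI _ d₁) (hzJ _ d₁) z
      rw [hsmul, hsmul] at this
      rw [monic_quadratic_eq hp hp2]
      simpa [pow_two, Module.algebraMap_end_apply, U₁] using this
    · refine LinearMap.ext fun z => ?_
      have := crossMap_quadratic hιπ hπι (hzI _ d₂) (hzJ _ d₂) z
      rw [hsmul, hsmul] at this
      rw [monic_quadratic_eq hq hq2]
      simpa [pow_two, Module.algebraMap_end_apply, U₂] using this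

end ExistenceDistinct

/-! ### Differences attached to a factor equal to its reflection. -/

section ExistenceSelf

variable {F : Type u} [Field F] {M : Type*} [AddCommGroup M] [Module F M] {n : ℕ}

/-- The value at index `i - 1`, or zero if `i = 0`. -/
def prev (x : Fin n → M) (i : Fin n) : M :=
  if (i : ℕ) = 0 then 0 else x ⟨(i : ℕ) - 1, by omega⟩

theorem prev_succ (x : Fin n → M) (i : ℕ) (hi : i + 1 < n) : prev x ⟨i + 1, hi⟩ = x ⟨i, by omega⟩ := by
  simp [prev]

theorem prev_zero (x : Fin n → M) (hi : 0 < n) : prev x ⟨0, hi⟩ = 0 := by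
  simp [prev]

theorem prev_add (x y : Fin n → M) (i : Fin n) : prev (x + y) i = prev x i + prev y i := by
  unfold prev; split_ifs <;> simp

theorem prev_smul (c : F) (x : Fin n → M) (i : Fin n) : prev (c • x) i = c • prev x i := by
  unfold prev; split_ifs <;> simp

/-- The shift `(x₀, x₁, …) ↦ (0, x₀, x₁, …)`. -/
def shiftEnd (F : Type u) [Field F] (M : Type*) [AddCommGroup M] [Module F M] (n : ℕ) :
    Module.End F (Fin n → M) where
  toFun x := prev x
  map_add' x y := funext fun i => prev_add x y i
  map_smul' c x := funext fun i => prev_smul c x i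

theorem shiftEnd_pow_apply (x : Fin n → M) (k i : ℕ) (hi : i < n) :
    (shiftEnd F M n ^ k) x ⟨i, hi⟩ = if h : k ≤ i then x ⟨i - k, by omega⟩ else 0 := by
  induction k generalizing i with
  | zero => simp
  | succ k ih =>
    rw [pow_succ', Module.End.mul_apply]
    change prev ((shiftEnd F M n ^ k) x) ⟨i, hi⟩ = _
    rcases i with _ | i
    · simp [prev_zero]
    · rw [prev_succ, ih]
      simp

theorem shiftEnd_pow_eq_zero : shiftEnd F M n ^ n = 0 := by
  refine LinearMap.ext fun x => funext fun i => ?_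
  have := shiftEnd_pow_apply (F := F) x n i i.2
  rw [dif_neg (by omega)] at this
  exact this

/-- Powers of r(f) are powers of the shift up to a unit, so a nonzero vector placed at index 0
survives r(f)^k for every k < n and dies at k = n. -/
theorem isCyclicOf_of_aeval_eq_shiftEnd_mul [Nontrivial M]
    {f W : Module.End F (Fin n → M)} {r : F[X]} (hr : Irreducible r)
    (hrm : r.Monic) (hf : aeval f r = shiftEnd F M n * W) (hc : Commute (shiftEnd F M n) W)
    (hW : IsUnit W) (hM : Module.finrank F M = r.natDegree) :
    IsCyclicOf f (r ^ n) := by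
  have hfin : Module.Finite F M :=
    Module.finite_of_finrank_pos (by rw [hM]; exact hr.natDegree_pos)
  obtain ⟨v, hv⟩ := exists_ne (0 : M)
  have hpow : ∀ k, aeval f (r ^ k) = W ^ k * shiftEnd F M n ^ k := fun k => by
    rw [map_pow, hf, hc.mul_pow, (hc.pow_pow k k).eq]
  refine ⟨⟨fun i => if (i : ℕ) = 0 then v else 0, hasOrder_pow hr ?_ fun k hk h0 => hv ?_⟩, ?_⟩
  · rw [hpow, shiftEnd_pow_eq_zero, mul_zero]; rfl
  · rw [hpow, Module.End.mul_apply] at h0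
    have h1 := ((Module.End.isUnit_iff _).1 (hW.pow k)).injective (h0.trans (map_zero _).symm)
    have h2 := congrFun h1 ⟨k, hk⟩
    rw [shiftEnd_pow_apply, dif_pos le_rfl] at h2
    simpa using h2
  · rw [Module.finrank_pi_fintype, hrm.natDegree_pow]
    simp [hM]

/-- Coordinatewise action. -/
def coordEnd (n : ℕ) (θ : Module.End F M) : Module.End F (Fin n → M) :=
  LinearMap.pi fun i => θ ∘ₗ LinearMap.proj i

theorem coordEnd_comm (θ : Module.End F M) :
    coordEnd n θ * shiftEnd F M n = shiftEnd F M n * coordEnd n θ := by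
  refine LinearMap.ext fun x => funext fun i => ?_
  change θ (prev x i) = prev (coordEnd n θ x) i
  unfold prev
  split_ifs
  · simp
  · rfl

/-- The shift is divided between the two terms by parity: u₁ contains its odd rows and u₂ the
negative of its even rows. On even indices the scalar α is added to both terms; it cancels in the
difference. The hypotheses make θ and θ + α conjugate roots of p, and y and y + α the two roots of
q, so the triangular terms disappear from p(u₁) and q(u₂). -/
theorem isDifference_coordEnd_add_shiftEnd {p q : F[X]} (hp : p.Monic) (hp2 : p.natDegree = 2)
    (hq : q.Monic) (hq2 : q.natDegree = 2) {θ : Module.End F M} {α y : F}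
    (h₁ : ∀ x, θ (θ x) + p.coeff 1 • θ x + p.coeff 0 • x = 0)
    (h₂ : ∀ x, (2 : F) • θ x + (α + p.coeff 1) • x = 0) (h₃ : y ^ 2 + q.coeff 1 * y + q.coeff 0 = 0)
    (h₄ : 2 * y + (α + q.coeff 1) = 0) :
    IsDifference p q (coordEnd n θ - algebraMap F _ y + shiftEnd F M n) := by
  let U₁ : Module.End F (Fin n → M) :=
    { toFun := fun x i => θ (x i) + if Even (i : ℕ) then α • x i else prev x i
      map_add' := fun x z => funext fun i => by
        simp only [Pi.add_apply, map_add, prev_add]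
        split_ifs <;> module
      map_smul' := fun c x => funext fun i => by
        simp only [Pi.smul_apply, map_smul, prev_smul, RingHom.id_apply]
        split_ifs <;> module }
  let U₂ : Module.End F (Fin n → M) :=
    { toFun := fun x i => y • x i + if Even (i : ℕ) then α • x i - prev x i else 0
      map_add' := fun x z => funext fun i => by
        simp only [Pi.add_apply, prev_add]
        split_ifs <;> module
      map_smul' := fun c x => funext fun i => by
        simp only [Pi.smul_apply, prev_smul, RingHom.id_apply]
        split_ifs <;> module }
  have hU₁ : ∀ x i, U₁ x i = θ (x i) + if Even (i : ℕ) then α • x i else prev x i :=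
    fun _ _ => rfl
  have hU₂ : ∀ x i, U₂ x i = y • x i + if Even (i : ℕ) then α • x i - prev x i else 0 :=
    fun _ _ => rfl
  refine ⟨U₁, U₂, LinearMap.ext fun x => funext fun ⟨i, hi⟩ => ?_,
    LinearMap.ext fun x => funext fun ⟨i, hi⟩ => ?_,
    LinearMap.ext fun x => funext fun ⟨i, hi⟩ => ?_⟩
  · have key : U₁ (U₁ x) ⟨i, hi⟩ + p.coeff 1 • U₁ x ⟨i, hi⟩ + p.coeff 0 • x ⟨i, hi⟩ = 0 := by
      by_cases hev : Even i
      · have e1 : ∀ x, U₁ x ⟨i, hi⟩ = θ (x ⟨i, hi⟩) + α • x ⟨i, hi⟩ := fun x => by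
          rw [hU₁, if_pos hev]
        have f1 := h₁ (x ⟨i, hi⟩)
        have f2 := h₂ (x ⟨i, hi⟩)
        rw [e1, e1, map_add, map_smul]
        linear_combination (norm := module) f1 + α • f2
      · obtain ⟨j, rfl⟩ : ∃ j, i = j + 1 := Nat.exists_eq_succ_of_ne_zero (by rintro rfl; simp at hev)
        have hj : Even j := by
          by_contra h
          exact hev (Nat.even_add_one.2 h)
        have e1 : ∀ x, U₁ x ⟨j, by omega⟩ = θ (x ⟨j, by omega⟩) + α • x ⟨j, by omega⟩ := fun x => by
          rw [hU₁, if_pos hj]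
        have e2 : ∀ x, U₁ x ⟨j + 1, hi⟩ = θ (x ⟨j + 1, hi⟩) + x ⟨j, by omega⟩ := fun x => by
          rw [hU₁, if_neg hev, prev_succ]
        have f1 := h₁ (x ⟨j + 1, hi⟩)
        have f2 := h₂ (x ⟨j, by omega⟩)
        rw [e2, e1, e2, map_add]
        linear_combination (norm := module) f1 + f2
    rw [monic_quadratic_eq hp hp2]
    simpa [pow_two, Module.algebraMap_end_apply] using key
  · have key : U₂ (U₂ x) ⟨i, hi⟩ + q.coeff 1 • U₂ x ⟨i, hi⟩ + q.coeff 0 • x ⟨i, hi⟩ = 0 := by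
      have g1 : ∀ z : M, (y ^ 2 + q.coeff 1 * y + q.coeff 0) • z = 0 := fun z => by
        rw [h₃, zero_smul]
      have g2 : ∀ z : M, (2 * y + (α + q.coeff 1)) • z = 0 := fun z => by
        rw [h₄, zero_smul]
      by_cases hev : Even i
      · rcases i with _ | j
        · have e1 : ∀ x, U₂ x ⟨0, hi⟩ = y • x ⟨0, hi⟩ + α • x ⟨0, hi⟩ := fun x => by
            rw [hU₂, if_pos hev, prev_zero, sub_zero]
          rw [e1, e1]
          linear_combination (norm := module) g1 (x ⟨0, hi⟩) + α • g2 (x ⟨0, hi⟩)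
        · have hj : ¬ Even j := Nat.even_add_one.1 hev
          have e1 : ∀ x, U₂ x ⟨j, by omega⟩ = y • x ⟨j, by omega⟩ := fun x => by
            rw [hU₂, if_neg hj, add_zero]
          have e2 : ∀ x, U₂ x ⟨j + 1, hi⟩ = y • x ⟨j + 1, hi⟩ +
              (α • x ⟨j + 1, hi⟩ - x ⟨j, by omega⟩) := fun x => by
            rw [hU₂, if_pos hev, prev_succ]
          rw [e2, e1, e2]
          linear_combination (norm := module) g1 (x ⟨j + 1, hi⟩) + α • g2 (x ⟨j + 1, hi⟩) -
            g2 (x ⟨j, by omega⟩)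
      · have e1 : ∀ x, U₂ x ⟨i, hi⟩ = y • x ⟨i, hi⟩ := fun x => by
          rw [hU₂, if_neg hev, add_zero]
        rw [e1, e1]
        linear_combination (norm := module) g1 (x ⟨i, hi⟩)
    rw [monic_quadratic_eq hq hq2]
    simpa [pow_two, Module.algebraMap_end_apply] using key
  · have e1 : (coordEnd n θ - algebraMap F _ y + shiftEnd F M n) x ⟨i, hi⟩ =
      θ (x ⟨i, hi⟩) - y • x ⟨i, hi⟩ + prev x ⟨i, hi⟩ := rfl
    rw [e1, LinearMap.sub_apply, Pi.sub_apply, hU₁, hU₂]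
    split_ifs <;> module

/-- The companion endomorphism of a quadratic polynomial `t² + a t + b`. -/
def quadEnd (a b : F) : Module.End F (F × F) where
  toFun x := (-b * x.2, x.1 - a * x.2)
  map_add' x y := by ext <;> simp <;> ring
  map_smul' c x := by ext <;> simp <;> ring

/-- A square-zero endomorphism. -/
def nilEnd (F : Type u) [Field F] : Module.End F (F × F) where
  toFun x := (x.2, 0)
  map_add' x y := by ext <;> simp
  map_smul' c x := by ext <;> simp

theorem quadEnd_sq (a b : F) (x : F × F) :
    quadEnd a b (quadEnd a b x) + a • quadEnd a b x + b • x = 0 := by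
  ext <;> simp [quadEnd] <;> ring

theorem quadratic_sub_eq {A : Type*} [Ring A] {θ s a b t : A} (h : θ * θ + a * θ + b = 0)
    (hs : s * s = 0) (ht : θ * s + s * θ + a * s = t) :
    (θ - s) * (θ - s) + a * (θ - s) + b = t * -1 := by
  subst ht
  linear_combination (norm := noncomm_ring) h + hs

theorem irreducible_comp_X_add_C {p : F[X]} (h : Irreducible p) (y : F) :
    Irreducible (p.comp (X + C y)) := by
  have := (MulEquiv.irreducible_iff (Polynomial.algEquivAevalXAddC y)).2 h
  simpa [comp, aeval_def] using this

/-- Two translates of p by y₁ and y₂ coincide only if y₁ = y₂, or if the characteristic is 2 and y₂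
= -y₁ - a. The two cases need different constructions. -/
theorem exists_isDifference_isCyclicOf_of_irreducible {p : F[X]} (hp : p.Monic)
    (hp2 : p.natDegree = 2) (hirr : Irreducible p) {y₁ y₂ : F}
    (h : p.comp (X + C y₁) = p.comp (X + C y₂)) (n : ℕ) :
    ∃ f : Module.End F (Fin n → F × F), IsDifference p ((X - C y₁) * (X - C y₂)) f ∧
      IsCyclicOf f (p.comp (X + C y₁) ^ n) := by
  obtain ⟨a, ha⟩ : ∃ a, a = p.coeff 1 := ⟨_, rfl⟩
  obtain ⟨b, hb⟩ : ∃ b, b = p.coeff 0 := ⟨_, rfl⟩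
  have hp' := monic_quadratic_eq hp hp2
  rw [← ha, ← hb] at hp'
  have hr : Irreducible (p.comp (X + C y₁)) := irreducible_comp_X_add_C hirr y₁
  have hrm : (p.comp (X + C y₁)).Monic := hp.comp_X_add_C y₁
  have hrd : Module.finrank F (F × F) = (p.comp (X + C y₁)).natDegree := by
    rw [natDegree_comp, natDegree_X_add_C, hp2]; simp
  rw [hp'] at h
  have hc1 := congrArg (fun r => coeff r 1) h
  have hc0 := congrArg (fun r => coeff r 0) h
  have hexp : ∀ y : F, (X ^ 2 + C a * X + C b).comp (X + C y) =
      X ^ 2 + C (2 * y + a) * X + C (y ^ 2 + a * y + b) := by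
    intro y
    have h2 : (C (2 : F) : F[X]) = 2 := rfl
    simp [h2]
    ring
  have hco1 : ∀ c d : F, (X ^ 2 + C c * X + C d).coeff 1 = c := by
    intro c d; simp [coeff_C]
  have hco0 : ∀ c d : F, (X ^ 2 + C c * X + C d).coeff 0 = d := by
    intro c d; simp
  simp only [hexp, hco1, hco0] at hc1 hc0
  have haev : ∀ f : Module.End F (Fin n → F × F), aeval f (p.comp (X + C y₁)) =
      (f + algebraMap F _ y₁) * (f + algebraMap F _ y₁) + algebraMap F _ a *
        (f + algebraMap F _ y₁) + algebraMap F _ b := by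
    intro f
    rw [aeval_comp, hp']
    simp [pow_two]
  by_cases h12 : y₁ = y₂
  · subst h12
    -- As q has the double root y₁, u₂ = y₁ + S with S² = 0 is admissible, and u₁ can stay diagonal.
    let S : Module.End F (Fin n → F × F) := coordEnd n (nilEnd F) * shiftEnd F (F × F) n
    have hS : S * S = 0 := by
      have h0 : coordEnd n (nilEnd F) * coordEnd n (nilEnd F) = 0 := rfl
      calc S * S = coordEnd n (nilEnd F) * (shiftEnd F (F × F) n * coordEnd n (nilEnd F)) *
            shiftEnd F (F × F) n := by simp only [S, mul_assoc]
        _ = coordEnd n (nilEnd F) * coordEnd n (nilEnd F) *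
            (shiftEnd F (F × F) n * shiftEnd F (F × F) n) := by
          rw [← coordEnd_comm]; simp only [mul_assoc]
        _ = 0 := by rw [h0, zero_mul]
    refine ⟨coordEnd n (quadEnd a b) - (algebraMap F _ y₁ + S),
      ⟨coordEnd n (quadEnd a b), algebraMap F _ y₁ + S, ?_, ?_, rfl⟩, ?_⟩
    · refine LinearMap.ext fun x => funext fun i => ?_
      rw [hp']
      simp only [map_add, map_mul, aeval_X, aeval_C, pow_two]
      exact quadEnd_sq a b (x i)
    · simp [hS]
    · refine isCyclicOf_of_aeval_eq_shiftEnd_mul (W := -1) hr hrm ?_ (Commute.neg_one_right _)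
        isUnit_one.neg hrd
      rw [haev]
      -- The nilpotent N = `nilEnd F` satisfies θN + Nθ + aN = 1 for θ = `quadEnd a b`, so only the
      -- shift remains. Consequently r(f) is minus the shift.
      have hΘS : coordEnd n (quadEnd a b) * S + S * coordEnd n (quadEnd a b) +
          algebraMap F _ a * S = shiftEnd F (F × F) n := by
        refine LinearMap.ext fun x => funext fun i => ?_
        have h1 : (S * coordEnd n (quadEnd a b)) x i =
            nilEnd F (quadEnd a b (shiftEnd F (F × F) n x i)) := by
          simp only [S, mul_assoc]
          rw [← coordEnd_comm]
          rfl
        have h2 : (coordEnd n (quadEnd a b) * S + S * coordEnd n (quadEnd a b) +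
          algebraMap F _ a * S) x i = quadEnd a b (nilEnd F (shiftEnd F (F × F) n x i)) +
            nilEnd F (quadEnd a b (shiftEnd F (F × F) n x i)) +
            a • nilEnd F (shiftEnd F (F × F) n x i) := by
          rw [← h1]; rfl
        rw [h2]
        ext <;> simp [quadEnd, nilEnd]
      have hΘ : coordEnd n (quadEnd a b) * coordEnd n (quadEnd a b) + algebraMap F _ a *
          coordEnd n (quadEnd a b) + algebraMap F _ b = 0 :=
        LinearMap.ext fun x => funext fun i => quadEnd_sq a b (x i)
      have e1 : coordEnd n (quadEnd a b) - (algebraMap F _ y₁ + S) + algebraMap F _ y₁ =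
        coordEnd n (quadEnd a b) - S := by abel
      rw [e1]
      exact quadratic_sub_eq hΘ hS hΘS
  -- Comparing the coefficients of t in the two translates gives 2(y₁ - y₂) = 0.
  · have h20 : (2 : F) = 0 := by
      have : (2 : F) * (y₁ - y₂) = 0 := by linear_combination hc1
      exact (mul_eq_zero.1 this).resolve_right (sub_ne_zero.2 h12)
    have hy : y₂ = -y₁ - a := by
      have : (y₁ - y₂) * (y₁ + y₂ + a) = 0 := by linear_combination hc0
      linear_combination (mul_eq_zero.1 this).resolve_left (sub_ne_zero.2 h12)
    have ha0 : a ≠ 0 := by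
      rintro rfl
      exact h12 (by linear_combination -hy + y₁ * h20)
    have h2M : ∀ x : F × F, (2 : F) • x = 0 := fun x => by rw [h20, zero_smul]
    let Θ := coordEnd n (quadEnd a b)
    refine ⟨Θ - algebraMap F _ y₁ + shiftEnd F (F × F) n,
      isDifference_coordEnd_add_shiftEnd (α := -a) hp hp2 (monic_mul_X_sub_C _ _)
        (natDegree_mul_X_sub_C _ _) ?_ ?_ ?_ ?_, ?_⟩
    · rw [← ha, ← hb]
      exact quadEnd_sq a b
    · intro x
      rw [← ha, h2M]
      simp
    · rw [coeff_one_mul_X_sub_C, coeff_zero_mul_X_sub_C]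
      ring
    · rw [coeff_one_mul_X_sub_C]
      linear_combination -hy + y₁ * h20
    -- With J the shift and 2 = 0, p(Θ + J) = J(J + a). The cofactor is a unit because J is
    -- nilpotent and a ≠ 0.
    · refine isCyclicOf_of_aeval_eq_shiftEnd_mul
        (W := shiftEnd F (F × F) n + algebraMap F _ a) hr hrm ?_
        ((Commute.refl _).add_right (Algebra.commutes _ _).symm) ?_ hrd
      · rw [haev]
        have hΘ : Θ * Θ + algebraMap F _ a * Θ + algebraMap F _ b = 0 :=
          LinearMap.ext fun x => funext fun i => quadEnd_sq a b (x i)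
        have hcomm : Θ * shiftEnd F (F × F) n - shiftEnd F (F × F) n * Θ = 0 :=
          sub_eq_zero.2 (coordEnd_comm _)
        have h2E : 2 * (shiftEnd F (F × F) n * Θ) = 0 := by
          refine LinearMap.ext fun x => funext fun i => ?_
          rw [two_mul]
          exact (two_smul F _).symm.trans (h2M _)
        have hca : algebraMap F (Module.End F (Fin n → F × F)) a * shiftEnd F (F × F) n -
            shiftEnd F (F × F) n * algebraMap F _ a = 0 := sub_eq_zero.2 (Algebra.commutes _ _)
        have e1 : Θ - algebraMap F _ y₁ + shiftEnd F (F × F) n + algebraMap F _ y₁ =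
          Θ + shiftEnd F (F × F) n := by abel
        rw [e1]
        linear_combination (norm := noncomm_ring) hΘ + hcomm + h2E + hca
      · exact IsNilpotent.isUnit_add_right_of_commute ⟨n, shiftEnd_pow_eq_zero⟩
          ((isUnit_iff_ne_zero.2 ha0).map _) (Algebra.commutes _ _).symm

/-- The hypothesis says that a' - a = b' - b, so one scalar α passes from the first root to the
second for both polynomials. -/
theorem exists_isDifference_isCyclicOf_X_sub_C {a a' b b' : F} (h : a - b = a' - b') (n : ℕ) :
    ∃ f : Module.End F (Fin n → F),
      IsDifference ((X - C a) * (X - C a')) ((X - C b) * (X - C b')) f ∧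
      IsCyclicOf f ((X - C (a - b)) ^ n) := by
  have hc : coordEnd n (algebraMap F (Module.End F F) a) = algebraMap F _ a := rfl
  refine ⟨coordEnd n (algebraMap F _ a) - algebraMap F _ b + shiftEnd F F n,
    isDifference_coordEnd_add_shiftEnd (α := a' - a) (monic_mul_X_sub_C _ _)
      (natDegree_mul_X_sub_C _ _) (monic_mul_X_sub_C _ _) (natDegree_mul_X_sub_C _ _) ?_ ?_ ?_ ?_,
    isCyclicOf_of_aeval_eq_shiftEnd_mul (W := 1) (irreducible_X_sub_C _) (monic_X_sub_C _) ?_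
      (Commute.one_right _) isUnit_one (by rw [natDegree_X_sub_C, Module.finrank_self])⟩
  · intro x
    rw [coeff_one_mul_X_sub_C, coeff_zero_mul_X_sub_C]
    simp only [Module.algebraMap_end_apply, smul_eq_mul]
    ring
  · intro x
    rw [coeff_one_mul_X_sub_C]
    simp only [Module.algebraMap_end_apply, smul_eq_mul]
    ring
  · rw [coeff_one_mul_X_sub_C, coeff_zero_mul_X_sub_C]
    ring
  · rw [coeff_one_mul_X_sub_C]
    linear_combination -h
  · rw [hc]
    simp

theorem HasOrder.neg {V : Type*} [AddCommGroup V] [Module F V] {f : Module.End F V} {x : V}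
    {ρ : F[X]} (h : HasOrder f x ρ) : HasOrder (-f) x (ρ.comp (C 0 - X)) := by
  intro g
  have h1 : aeval (-f) g = aeval f (g.comp (C 0 - X)) := by
    rw [aeval_comp]
    simp
  rw [h1, h, dvd_comp_reflect_iff]

theorem IsCyclicOf.neg {V : Type*} [AddCommGroup V] [Module F V] {f : Module.End F V}
    {ρ : F[X]} (h : IsCyclicOf f ρ) : IsCyclicOf (-f) (ρ.comp (C 0 - X)) := by
  obtain ⟨⟨x, hx⟩, hd⟩ := h
  exact ⟨⟨x, hx.neg⟩, by rw [hd, natDegree_comp_reflect]⟩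

theorem irreducible_or_eq_mul {p : F[X]} (hp : p.Monic) (hp2 : p.natDegree = 2) :
    Irreducible p ∨ ∃ a b, p = (X - C a) * (X - C b) := by
  by_cases h : ∃ a, p.IsRoot a
  · obtain ⟨a, ha⟩ := h
    obtain ⟨b, hb⟩ := exists_eq_mul_of_isRoot hp hp2 ha
    exact Or.inr ⟨a, b, hb⟩
  · left
    refine (hp.irreducible_iff_roots_eq_zero_of_degree_le_three (by omega) (by omega)).2 ?_
    refine Multiset.eq_zero_of_forall_notMem fun a ha => h ⟨a, isRoot_of_mem_roots ha⟩

theorem not_isRoot_of_irreducible {p : F[X]} (hp2 : p.natDegree = 2) (h : Irreducible p) (a : F) :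
    ¬ p.IsRoot a := fun ha => by
  have : p.natDegree = 1 := natDegree_eq_of_degree_eq_some (degree_eq_one_of_irreducible_of_root h ha)
  omega

/-- The three cases of the classification. -/
theorem split_cases {p q : F[X]} (hp : p.Monic) (hp2 : p.natDegree = 2)
    (hq : q.Monic) (hq2 : q.natDegree = 2)
    (hroot : (∃ a : F, p.IsRoot a) ∨ (∃ b : F, q.IsRoot b)) :
    ((∃ a a', p = (X - C a) * (X - C a')) ∧ ∃ b b', q = (X - C b) * (X - C b')) ∨
    (Irreducible p ∧ ∃ b b', q = (X - C b) * (X - C b')) ∨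
    (Irreducible q ∧ ∃ a a', p = (X - C a) * (X - C a')) := by
  rcases irreducible_or_eq_mul hp hp2 with h1 | h1 <;>
  rcases irreducible_or_eq_mul hq hq2 with h2 | h2
  · rcases hroot with ⟨a, ha⟩ | ⟨a, ha⟩
    · exact absurd ha (not_isRoot_of_irreducible hp2 h1 a)
    · exact absurd ha (not_isRoot_of_irreducible hq2 h2 a)
  · exact Or.inr (Or.inl ⟨h1, h2⟩)
  · exact Or.inr (Or.inr ⟨h2, h1⟩)
  · exact Or.inl ⟨h1, h2⟩

theorem comp_C_sub_X_eq_reflection {q : F[X]} (hq2 : q.natDegree = 2) (x : F) :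
    q.comp (C x - X) = reflection x q := by
  rw [reflection, hq2]; simp

theorem reflection_comp_X_add_C {p : F[X]} (hp : p.Monic) (hp2 : p.natDegree = 2) (y₁ y₂ : F) :
    reflection (((X - C y₁) * (X - C y₂)).coeff 1 - p.coeff 1) (p.comp (X + C y₁)) =
      p.comp (X + C y₂) := by
  rw [reflection, natDegree_comp, natDegree_X_add_C, hp2, coeff_one_mul_X_sub_C]
  conv_lhs => rw [monic_quadratic_eq hp hp2]
  conv_rhs => rw [monic_quadratic_eq hp hp2]
  simp
  ring

theorem reflection_comp_C_sub_X {q : F[X]} (hq : q.Monic) (hq2 : q.natDegree = 2) (x₁ x₂ : F) :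
    reflection (q.coeff 1 - ((X - C x₁) * (X - C x₂)).coeff 1) (q.comp (C x₁ - X)) =
      q.comp (C x₂ - X) := by
  rw [reflection, natDegree_comp, natDegree_C_sub_X, hq2, coeff_one_mul_X_sub_C]
  conv_lhs => rw [monic_quadratic_eq hq hq2]
  conv_rhs => rw [monic_quadratic_eq hq hq2]
  simp
  ring

theorem reflection_X_sub_C (d x : F) : reflection d (X - C x) = X - C (d - x) := by
  simp [reflection]
  ring

theorem fundPoly_of_split (a a' b b' : F) :
    fundPoly ((X - C a) * (X - C a')) ((X - C b) * (X - C b')) =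
      (X - C (a - b)) * (X - C (a' - b')) * ((X - C (a - b')) * (X - C (a' - b))) := by
  rw [fundPoly_of_left a a' (monic_mul_X_sub_C b b') (natDegree_mul_X_sub_C b b')]
  simp
  ring

theorem eq_or_eq_of_dvd_mul {r s t : F[X]} (hr : Irreducible r) (hrm : r.Monic)
    (hs : Irreducible s) (hsm : s.Monic) (ht : Irreducible t) (htm : t.Monic) (h : r ∣ s * t) :
    r = s ∨ r = t :=
  (hr.prime.dvd_or_dvd h).imp
    (fun h => eq_of_monic_of_associated hrm hsm ((hr.dvd_irreducible_iff_associated hs).1 h))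
    (fun h => eq_of_monic_of_associated hrm htm ((hr.dvd_irreducible_iff_associated ht).1 h))

/-- The irreducible factors of the fundamental polynomial of split polynomials. -/
theorem eq_of_dvd_fundPoly_of_split {a a' b b' : F} {r : F[X]} (hr : Irreducible r) (hrm : r.Monic)
    (h : r ∣ fundPoly ((X - C a) * (X - C a')) ((X - C b) * (X - C b'))) :
    r = X - C (a - b) ∨ r = X - C (a' - b') ∨ r = X - C (a - b') ∨ r = X - C (a' - b) := by
  rw [fundPoly_of_split] at h
  have key : ∀ x y : F, r ∣ (X - C x) * (X - C y) → r = X - C x ∨ r = X - C y := fun x y =>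
    eq_or_eq_of_dvd_mul hr hrm (irreducible_X_sub_C x) (monic_X_sub_C x) (irreducible_X_sub_C y)
      (monic_X_sub_C y)
  rcases hr.prime.dvd_or_dvd h with h | h
  · exact (key _ _ h).imp_right Or.inl
  · exact Or.inr (Or.inr (key _ _ h))

theorem eq_of_dvd_fundPoly_left {p r : F[X]} {y₁ y₂ : F} (hp : p.Monic) (hp2 : p.natDegree = 2)
    (hirr : Irreducible p) (hr : Irreducible r) (hrm : r.Monic)
    (h : r ∣ fundPoly p ((X - C y₁) * (X - C y₂))) :
    r = p.comp (X + C y₁) ∨ r = p.comp (X + C y₂) :=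
  eq_or_eq_of_dvd_mul hr hrm (irreducible_comp_X_add_C hirr y₁) (hp.comp_X_add_C y₁)
    (irreducible_comp_X_add_C hirr y₂) (hp.comp_X_add_C y₂) (fundPoly_of_right hp hp2 y₁ y₂ ▸ h)

theorem irreducible_comp_C_sub_X {q : F[X]} (hq2 : q.natDegree = 2) (h : Irreducible q) (x : F) :
    Irreducible (q.comp (C x - X)) :=
  comp_C_sub_X_eq_reflection hq2 x ▸ reflection_irreducible x h

theorem monic_comp_C_sub_X {q : F[X]} (hq : q.Monic) (hq2 : q.natDegree = 2) (x : F) :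
    (q.comp (C x - X)).Monic :=
  comp_C_sub_X_eq_reflection hq2 x ▸ reflection_monic x hq

theorem eq_of_dvd_fundPoly_right {q r : F[X]} {x₁ x₂ : F} (hq : q.Monic) (hq2 : q.natDegree = 2)
    (hirr : Irreducible q) (hr : Irreducible r) (hrm : r.Monic)
    (h : r ∣ fundPoly ((X - C x₁) * (X - C x₂)) q) :
    r = q.comp (C x₁ - X) ∨ r = q.comp (C x₂ - X) :=
  eq_or_eq_of_dvd_mul hr hrm (irreducible_comp_C_sub_X hq2 hirr x₁) (monic_comp_C_sub_X hq hq2 x₁)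
    (irreducible_comp_C_sub_X hq2 hirr x₂) (monic_comp_C_sub_X hq hq2 x₂)
    (fundPoly_of_left x₁ x₂ hq hq2 ▸ h)

theorem IsCyclicOf.isDifference_companion {V : Type*} [AddCommGroup V] [Module F V]
    [FiniteDimensional F V] {p q : F[X]} {f : Module.End F V} {ρ : F[X]} (h : IsCyclicOf f ρ)
    (hρ : ρ.Monic) (hf : IsDifference p q f) : IsDifference p q (SquareMatrix.toEnd (companion ρ)) :=
  (h.isSimilar hρ).symm.isDifference hf

theorem isDifference_companion_of_split {a a' b b' : F} (h : a - b = a' - b') (n : ℕ) :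
    IsDifference ((X - C a) * (X - C a')) ((X - C b) * (X - C b'))
      (SquareMatrix.toEnd (companion ((X - C (a - b)) ^ n))) := by
  obtain ⟨f, hf, hc⟩ := exists_isDifference_isCyclicOf_X_sub_C h n
  exact hc.isDifference_companion ((monic_X_sub_C _).pow n) hf

theorem isDifference_companion_of_irreducible_left {p : F[X]} (hp : p.Monic)
    (hp2 : p.natDegree = 2) (hirr : Irreducible p) {y₁ y₂ : F}
    (h : p.comp (X + C y₁) = p.comp (X + C y₂)) (n : ℕ) :
    IsDifference p ((X - C y₁) * (X - C y₂))
      (SquareMatrix.toEnd (companion (p.comp (X + C y₁) ^ n))) := by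
  obtain ⟨f, hf, hc⟩ := exists_isDifference_isCyclicOf_of_irreducible hp hp2 hirr h n
  exact hc.isDifference_companion ((hp.comp_X_add_C y₁).pow n) hf

/-- Passing to -u exchanges p and q and reflects the cyclic polynomial under t ↦ -t, which reduces
to the case where the first polynomial is irreducible. -/
theorem isDifference_companion_of_irreducible_right {q : F[X]} (hq : q.Monic)
    (hq2 : q.natDegree = 2) (hirr : Irreducible q) {x₁ x₂ : F}
    (h : q.comp (C x₁ - X) = q.comp (C x₂ - X)) (n : ℕ) :
    IsDifference ((X - C x₁) * (X - C x₂)) q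
      (SquareMatrix.toEnd (companion (q.comp (C x₁ - X) ^ n))) := by
  have key : ∀ x : F, (q.comp (C x - X)).comp (C 0 - X) = q.comp (X + C x) := by
    intro x
    rw [comp_assoc]
    congr 1
    simp
    ring
  have h' := congrArg (fun r => r.comp (C 0 - X)) h
  simp only [key] at h'
  obtain ⟨f, hf, hc⟩ := exists_isDifference_isCyclicOf_of_irreducible hq hq2 hirr h' n
  have hc' := hc.neg
  rw [pow_comp, ← key, comp_reflect_reflect] at hc'
  exact hc'.isDifference_companion ((monic_comp_C_sub_X hq hq2 x₁).pow n) hf.neg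

/-- The elementary blocks attached to an irreducible polynomial that is its own reflection. -/
theorem isDifference_companion {p q : F[X]} (hp : p.Monic) (hp2 : p.natDegree = 2)
    (hq : q.Monic) (hq2 : q.natDegree = 2)
    (hroot : (∃ a : F, p.IsRoot a) ∨ (∃ b : F, q.IsRoot b)) {r : F[X]} (hr : Irreducible r)
    (hrm : r.Monic) (hd : r ∣ fundPoly p q) (h : reflection (q.coeff 1 - p.coeff 1) r = r) (n : ℕ) :
    IsDifference p q (SquareMatrix.toEnd (companion (r ^ n))) := by
  rcases split_cases hp hp2 hq hq2 hroot with ⟨⟨a, a', rfl⟩, b, b', rfl⟩ | ⟨hirr, b, b', rfl⟩ |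
    ⟨hirr, a, a', rfl⟩
  -- A self-reflected root x satisfies δ = 2x, so if x is the difference of two roots it is also the
  -- difference of the complementary roots.
  · have key : ∀ x, r = X - C x → (a + a') - (b + b') = 2 * x := by
      rintro x rfl
      rw [reflection_X_sub_C, coeff_one_mul_X_sub_C, coeff_one_mul_X_sub_C] at h
      have := C_injective (sub_right_injective h)
      linear_combination this
    rcases eq_of_dvd_fundPoly_of_split hr hrm hd with hx | hx | hx | hx <;>
      have hk := key _ hx <;> rw [hx]
    · exact isDifference_companion_of_split (by linear_combination -hk) n
    · rw [mul_comm (X - C a), mul_comm (X - C b)]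
      exact isDifference_companion_of_split (by linear_combination -hk) n
    · rw [mul_comm (X - C b)]
      exact isDifference_companion_of_split (by linear_combination -hk) n
    · rw [mul_comm (X - C a)]
      exact isDifference_companion_of_split (by linear_combination -hk) n
  · rcases eq_of_dvd_fundPoly_left hp hp2 hirr hr hrm hd with rfl | rfl
    · rw [reflection_comp_X_add_C hp hp2] at h
      exact isDifference_companion_of_irreducible_left hp hp2 hirr h.symm n
    · rw [mul_comm] at h ⊢
      rw [reflection_comp_X_add_C hp hp2] at h
      exact isDifference_companion_of_irreducible_left hp hp2 hirr h.symm n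
  · rcases eq_of_dvd_fundPoly_right hq hq2 hirr hr hrm hd with rfl | rfl
    · rw [reflection_comp_C_sub_X hq hq2] at h
      exact isDifference_companion_of_irreducible_right hq hq2 hirr h.symm n
    · rw [mul_comm] at h ⊢
      rw [reflection_comp_C_sub_X hq hq2] at h
      exact isDifference_companion_of_irreducible_right hq hq2 hirr h.symm n

end ExistenceSelf

/-! ### Exceptional symplectic differences as symplectic extensions. -/

section Structure

variable {F : Type u} [Field F] {p q : F[X]} {e : ℕ}

/-- The irreducible factors of the fundamental polynomial that are not their own reflections have
multiplicity `e`. -/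
def HasExponent (p q : F[X]) (e : ℕ) : Prop :=
  ∀ r : F[X], r.Monic → Irreducible r → r ∣ fundPoly p q →
    reflection (q.coeff 1 - p.coeff 1) r ≠ r → ∃ c, fundPoly p q = r ^ e * c ∧ IsCoprime r c

theorem interlaced_of_isDifference {V : Type*} [AddCommGroup V] [Module F V]
    [FiniteDimensional F V] (hp : p.Monic) (hp2 : p.natDegree = 2)
    (hq : q.Monic) (hq2 : q.natDegree = 2) (he : HasExponent p q e) {f : Module.End F V}
    (hf : IsDifference p q f) : Interlaced (q.coeff 1 - p.coeff 1) (fundPoly p q) e f := by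
  obtain ⟨u₁, u₂, h₁, h₂, rfl⟩ := hf
  obtain ⟨h, h'⟩ := commutator_relations hp hp2 hq hq2 h₁ h₂
  intro r hrm hr hd hne k
  obtain ⟨c, hc, hrc⟩ := he r hrm hr hd hne
  exact kerDim_interlacing h h' hc hrc k

theorem isSimilar_toEnd_blockSum_of_subsingleton (M N : SquareMatrix F)
    [Subsingleton (Fin N.1 → F)] :
    IsSimilar (SquareMatrix.toEnd (blockSum M N)) (SquareMatrix.toEnd M) :=
  ((isSimilar_toEnd_blockSum M N).trans (isSimilar_prodMap_comm _ _)).trans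
    (isSimilar_prodMap_of_subsingleton _ _).symm

/-- This is the case m' = 0 of the paired construction: the partner is the empty matrix. -/
theorem isDifference_companion_of_reflection_ne (hp : p.Monic) (hp2 : p.natDegree = 2)
    (hq : q.Monic) (hq2 : q.natDegree = 2) (he : HasExponent p q e) {r : F[X]} (hr : Irreducible r)
    (hrm : r.Monic) (hd : r ∣ fundPoly p q) (h : reflection (q.coeff 1 - p.coeff 1) r ≠ r)
    {m : ℕ} (hm : m ≤ e) : IsDifference p q (SquareMatrix.toEnd (companion (r ^ m))) := by
  obtain ⟨c, hc, -⟩ := he r hrm hr hd h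
  have h1 := isDifference_blockSum hp hp2 hq hq2 hr hrm h hc (Nat.zero_le m)
    (by omega : m ≤ 0 + e)
  rw [pow_zero] at h1
  have := subsingleton_companion_one (F := F)
  exact (isSimilar_toEnd_blockSum_of_subsingleton _ _).isDifference h1

theorem IsBlock.isDifference (hp : p.Monic) (hp2 : p.natDegree = 2)
    (hq : q.Monic) (hq2 : q.natDegree = 2)
    (hroot : (∃ a : F, p.IsRoot a) ∨ (∃ b : F, q.IsRoot b)) (he : HasExponent p q e)
    {M : SquareMatrix F} (hM : IsBlock (q.coeff 1 - p.coeff 1) (fundPoly p q) e M) :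
    IsDifference p q (SquareMatrix.toEnd M) := by
  obtain ⟨r, hrm, hr, hd, ⟨hself, m, -, rfl⟩ | ⟨hne, m, m', -, h1, h2, rfl⟩⟩ := hM
  · exact isDifference_companion hp hp2 hq hq2 hroot hr hrm hd hself m
  · obtain ⟨c, hc, -⟩ := he r hrm hr hd hne
    exact isDifference_blockSum hp hp2 hq hq2 hr hrm hne hc h1 h2

theorem isDifference_blockSumList (L : List (SquareMatrix F))
    (hL : ∀ M ∈ L, IsDifference p q (SquareMatrix.toEnd M)) :
    IsDifference p q (SquareMatrix.toEnd (blockSumList L)) := by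
  induction L with
  | nil =>
    have : Subsingleton (Fin (blockSumList ([] : List (SquareMatrix F))).1 → F) :=
      inferInstanceAs (Subsingleton (Fin 0 → F))
    exact ⟨0, 0, LinearMap.ext fun x => Subsingleton.elim _ _,
      LinearMap.ext fun x => Subsingleton.elim _ _, LinearMap.ext fun x => Subsingleton.elim _ _⟩
  | cons M L ih =>
    exact (isSimilar_toEnd_blockSum M (blockSumList L)).symm.isDifference
      ((hL M (by simp)).prodMap (ih fun N hN => hL N (by simp [hN])))

theorem SymplecticPair.IsDifference.exists_isIsometric (hp : p.Monic) (hp2 : p.natDegree = 2)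
    (hq : q.Monic) (hq2 : q.natDegree = 2) (he : HasExponent p q e) {V : Type v} [AddCommGroup V]
    [Module F V] [FiniteDimensional F V] {P : SymplecticPair F V} (hP : P.IsDifference p q) {N : ℕ}
    (hN : aeval P.endo (fundPoly p q ^ N) = 0) :
    ∃ L : List (SquareMatrix F),
      (∀ M ∈ L, IsBlock (q.coeff 1 - p.coeff 1) (fundPoly p q) e M) ∧
      P.IsIsometric (symplecticExtension (SquareMatrix.toEnd (blockSumList L))) :=
  P.exists_isIsometric_blockSumList (fundPoly_comp_conjPoly p q) hN
    (interlaced_of_isDifference hp hp2 hq hq2 he hP.endo)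

/-- Exceptional symplectic differences are symplectic extensions of differences. -/
theorem SymplecticPair.IsDifference.exists_isIsometric_symplecticExtension
    (hp : p.Monic) (hp2 : p.natDegree = 2)
    (hq : q.Monic) (hq2 : q.natDegree = 2)
    (hroot : (∃ a : F, p.IsRoot a) ∨ (∃ b : F, q.IsRoot b)) (he : HasExponent p q e)
    {V : Type v} [AddCommGroup V]
    [Module F V] [FiniteDimensional F V] {P : SymplecticPair F V} (hP : P.IsDifference p q) {N : ℕ}
    (hN : aeval P.endo (fundPoly p q ^ N) = 0) :
    ∃ M : SquareMatrix F, _root_.IsDifference p q (SquareMatrix.toEnd M) ∧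
      P.IsIsometric (symplecticExtension (SquareMatrix.toEnd M)) := by
  obtain ⟨L, hL, h⟩ := hP.exists_isIsometric hp hp2 hq hq2 he hN
  exact ⟨_, isDifference_blockSumList L fun M hM => (hL M hM).isDifference hp hp2 hq hq2 hroot he, h⟩

theorem isExceptional_iff (hp : p.Monic) (hp2 : p.natDegree = 2)
    (hq : q.Monic) (hq2 : q.natDegree = 2)
    (hroot : (∃ a : F, p.IsRoot a) ∨ (∃ b : F, q.IsRoot b))
    {V : Type v} [AddCommGroup V] [Module F V] [FiniteDimensional F V] (f : Module.End F V) :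
    IsExceptional p q f ↔ ∃ N, aeval f (fundPoly p q ^ N) = 0 := by
  rw [IsExceptional, fundamentalPolynomial_eq hp hp2 hq hq2 hroot]
  constructor
  · intro h
    -- Kernels of powers of an endomorphism stabilise at the latest at the dimension.
    refine ⟨Module.finrank F V, LinearMap.ext fun x => ?_⟩
    obtain ⟨n, hn⟩ := Set.mem_iUnion.1 (h ▸ Set.mem_univ x)
    rw [map_pow]
    exact Module.End.ker_pow_le_ker_pow_finrank _ n hn
  · rintro ⟨N, hN⟩
    refine Set.eq_univ_of_forall fun x => Set.mem_iUnion.2 ⟨N, ?_⟩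
    rw [map_pow] at hN
    rw [hN]
    simp

theorem symplecticExtension_nontrivial_iff {V : Type*} [AddCommGroup V] [Module F V] :
    Nontrivial (V × Module.Dual F V) ↔ Nontrivial V := by
  constructor
  · intro h
    by_contra hV
    have := not_nontrivial_iff_subsingleton.1 hV
    exact not_subsingleton (V × Module.Dual F V) inferInstance
  · intro h
    infer_instance

theorem SymplecticPair.IsIsometric.nontrivial {V W : Type*} [AddCommGroup V] [Module F V]
    [AddCommGroup W] [Module F W] [Nontrivial V] {P : SymplecticPair F V} {f : Module.End F W}
    (h : P.IsIsometric (symplecticExtension f)) : Nontrivial W := by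
  obtain ⟨φ, -⟩ := h
  exact symplecticExtension_nontrivial_iff.1 φ.symm.toEquiv.nontrivial

/-- If S(f) is a symplectic difference it is isometric to some S(M) with M a difference, and f is
then similar to M. -/
theorem isDifference_iff (hp : p.Monic) (hp2 : p.natDegree = 2)
    (hq : q.Monic) (hq2 : q.natDegree = 2)
    (hroot : (∃ a : F, p.IsRoot a) ∨ (∃ b : F, q.IsRoot b)) (he : HasExponent p q e)
    {V : Type v} [AddCommGroup V] [Module F V] [FiniteDimensional F V] {f : Module.End F V} {N : ℕ}
    (hN : aeval f (fundPoly p q ^ N) = 0) :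
    IsDifference p q f ↔ (symplecticExtension f).IsDifference p q := by
  refine ⟨IsDifference.symplecticExtension, fun h => ?_⟩
  obtain ⟨M, hM, h'⟩ := h.exists_isIsometric_symplecticExtension hp hp2 hq hq2 hroot he
    (aeval_symplecticExtension_eq_zero hN)
  exact (isSimilar_of_isIsometric_symplecticExtension h').symm.isDifference hM

/-- Each orthogonal summand is itself exceptional, hence of the form S(Mᵢ) with Mᵢ a difference. So
S(f) is isometric to S(M₁ ⊕ M₂), and the similarity class can be recovered. -/
theorem exists_isSimilar_of_isIsometric_orthogonalSum (hp : p.Monic) (hp2 : p.natDegree = 2)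
    (hq : q.Monic) (hq2 : q.natDegree = 2)
    (hroot : (∃ a : F, p.IsRoot a) ∨ (∃ b : F, q.IsRoot b)) (he : HasExponent p q e)
    {V V₁ V₂ : Type*} [AddCommGroup V] [Module F V] [FiniteDimensional F V] [AddCommGroup V₁]
    [Module F V₁] [AddCommGroup V₂] [Module F V₂] [Nontrivial V₁] [Nontrivial V₂]
    {f : Module.End F V} {N : ℕ}
    (hN : aeval f (fundPoly p q ^ N) = 0) {P₁ : SymplecticPair F V₁} {P₂ : SymplecticPair F V₂}
    (h₁ : P₁.IsDifference p q) (h₂ : P₂.IsDifference p q)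
    (h : (symplecticExtension f).IsIsometric (P₁.orthogonalSum P₂)) :
    ∃ M₁ M₂ : SquareMatrix F, Nontrivial (Fin M₁.1 → F) ∧ Nontrivial (Fin M₂.1 → F) ∧
      IsDifference p q (SquareMatrix.toEnd M₁) ∧ IsDifference p q (SquareMatrix.toEnd M₂) ∧
      IsSimilar f (LinearMap.prodMap (SquareMatrix.toEnd M₁) (SquareMatrix.toEnd M₂)) := by
  have hS := aeval_symplecticExtension_eq_zero hN
  have hfin : FiniteDimensional F (V₁ × V₂) := by
    obtain ⟨φ, -⟩ := id h
    exact Module.Finite.equiv φ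
  have : FiniteDimensional F V₁ :=
    Module.Finite.of_surjective (LinearMap.fst F V₁ V₂) LinearMap.fst_surjective
  have : FiniteDimensional F V₂ :=
    Module.Finite.of_surjective (LinearMap.snd F V₁ V₂) LinearMap.snd_surjective
  obtain ⟨M₁, hM₁, k₁⟩ := h₁.exists_isIsometric_symplecticExtension hp hp2 hq hq2 hroot he
    ((h.trans (SymplecticPair.isIsometric_orthogonalSum_comm _ _)).aeval_right_eq_zero hS)
  obtain ⟨M₂, hM₂, k₂⟩ := h₂.exists_isIsometric_symplecticExtension hp hp2 hq hq2 hroot he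
    (h.aeval_right_eq_zero hS)
  exact ⟨M₁, M₂, k₁.nontrivial, k₂.nontrivial, hM₁, hM₂,
    isSimilar_of_isIsometric_symplecticExtension
      ((h.trans (k₁.orthogonalSum k₂)).trans (symplecticExtension_prodMap _ _).symm)⟩

theorem isIndecomposableDifference_iff (hp : p.Monic) (hp2 : p.natDegree = 2)
    (hq : q.Monic) (hq2 : q.natDegree = 2)
    (hroot : (∃ a : F, p.IsRoot a) ∨ (∃ b : F, q.IsRoot b)) (he : HasExponent p q e)
    {V : Type v} [AddCommGroup V] [Module F V] [FiniteDimensional F V] {f : Module.End F V} {N : ℕ}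
    (hN : aeval f (fundPoly p q ^ N) = 0) :
    IsIndecomposableDifference p q f ↔
      (symplecticExtension f).IsIndecomposableDifference p q := by
  constructor
  · intro h
    refine ⟨h.1.symplecticExtension, symplecticExtension_nontrivial_iff.2 h.2.1, ?_⟩
    rintro ⟨V₁, V₂, _, _, _, _, P₁, P₂, _, _, h₁, h₂, h'⟩
    obtain ⟨M₁, M₂, _, _, k₁, k₂, k⟩ :=
      exists_isSimilar_of_isIsometric_orthogonalSum hp hp2 hq hq2 hroot he hN h₁ h₂ h'
    exact h.false_of_isSimilar k₁ k₂ k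
  · intro h
    refine ⟨(isDifference_iff hp hp2 hq hq2 hroot he hN).2 h.1,
      symplecticExtension_nontrivial_iff.1 h.2.1, ?_⟩
    rintro ⟨V₁, V₂, _, _, _, _, f₁, f₂, _, _, h₁, h₂, h'⟩
    exact h.false_of_isIsometric h₁.symplecticExtension h₂.symplecticExtension
      (h'.symplecticExtension.trans (symplecticExtension_prodMap _ _))

end Structure

/-! ### Which blocks are indecomposable. -/

section Indecomposable

variable {F : Type u} [Field F] {p q : F[X]} {e : ℕ}

/-- The indecomposable elementary blocks. -/
def IsIndecomposableBlock (d : F) (Φ : F[X]) (e : ℕ) (M : SquareMatrix F) : Prop :=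
  ∃ r : F[X], r.Monic ∧ Irreducible r ∧ r ∣ Φ ∧
    ((reflection d r = r ∧ ∃ m, 1 ≤ m ∧ M = companion (r ^ m)) ∨
     (reflection d r ≠ r ∧ ∃ m m', 1 ≤ m ∧ m' ≤ m ∧ m ≤ m' + e ∧ (m' = 0 ∨ e < m) ∧
        M = blockSum (companion (r ^ m)) (companion (reflection d r ^ m'))))

theorem IsIndecomposableBlock.isBlock {d : F} {Φ : F[X]} {M : SquareMatrix F}
    (h : IsIndecomposableBlock d Φ e M) : IsBlock d Φ e M := by
  obtain ⟨r, h1, h2, h3, h | ⟨h, m, m', h4, h5, h6, -, h7⟩⟩ := h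
  · exact ⟨r, h1, h2, h3, Or.inl h⟩
  · exact ⟨r, h1, h2, h3, Or.inr ⟨h, m, m', h4, h5, h6, h7⟩⟩

theorem nontrivial_companion_pow {r : F[X]} (hr : Irreducible r) (hrm : r.Monic) {m : ℕ}
    (hm : 1 ≤ m) : Nontrivial (Fin (companion (r ^ m)).1 → F) := by
  have h1 : (companion (r ^ m)).1 = m * r.natDegree := hrm.natDegree_pow m
  have := Nat.mul_pos hm hr.natDegree_pos
  have : NeZero (companion (r ^ m)).1 := ⟨by omega⟩
  infer_instance

theorem IsBlock.nontrivial {d : F} {Φ : F[X]} {M : SquareMatrix F}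
    (h : IsBlock d Φ e M) : Nontrivial (Fin M.1 → F) := by
  obtain ⟨r, hrm, hr, -, ⟨-, m, hm, rfl⟩ | ⟨-, m, m', hm, -, -, rfl⟩⟩ := h
  · exact nontrivial_companion_pow hr hrm hm
  · have := nontrivial_companion_pow hr hrm hm
    obtain ⟨φ, -⟩ := isSimilar_toEnd_blockSum (companion (r ^ m)) (companion (reflection d r ^ m'))
    exact φ.toEquiv.nontrivial

theorem IsBlock.exists_aeval_eq_zero {d : F} {Φ : F[X]} {M : SquareMatrix F}
    (hΦ : Φ.comp (C d - X) = Φ)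
    (h : IsBlock d Φ e M) : ∃ N, aeval (SquareMatrix.toEnd M) (Φ ^ N) = 0 := by
  have key : ∀ {r : F[X]} {m n : ℕ}, r.Monic → r ∣ Φ → m ≤ n →
      aeval (SquareMatrix.toEnd (companion (r ^ m))) (Φ ^ n) = 0 := by
    intro r m n hrm hd hmn
    obtain ⟨c, hc⟩ := (pow_dvd_pow_of_dvd hd m).trans (pow_dvd_pow Φ hmn)
    rw [hc, map_mul, aeval_companion (hrm.pow m), zero_mul]
  obtain ⟨r, hrm, hr, hd, ⟨-, m, hm, rfl⟩ | ⟨-, m, m', hm, hm', -, rfl⟩⟩ := h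
  · exact ⟨m, key hrm hd le_rfl⟩
  · refine ⟨m, (isSimilar_toEnd_blockSum _ _).symm.aeval_eq_zero ?_⟩
    rw [aeval_prodMap, key hrm hd le_rfl,
      key (reflection_monic d hrm) (reflection_dvd hΦ hd) hm', LinearMap.prodMap_zero]

/-- Every indecomposable exceptional symplectic difference comes from an indecomposable block. -/
theorem SymplecticPair.IsIndecomposableDifference.exists_isIsometric
    (hp : p.Monic) (hp2 : p.natDegree = 2)
    (hq : q.Monic) (hq2 : q.natDegree = 2)
    (hroot : (∃ a : F, p.IsRoot a) ∨ (∃ b : F, q.IsRoot b)) (he : HasExponent p q e)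
    {V : Type v} [AddCommGroup V] [Module F V] [FiniteDimensional F V] {P : SymplecticPair F V}
    (hP : P.IsIndecomposableDifference p q) {N : ℕ}
    (hN : aeval P.endo (fundPoly p q ^ N) = 0) :
    ∃ M, IsIndecomposableBlock (q.coeff 1 - p.coeff 1) (fundPoly p q) e M ∧
      P.IsIsometric (symplecticExtension (SquareMatrix.toEnd M)) := by
  have := hP.2.1
  obtain ⟨L, hL, h⟩ := hP.1.exists_isIsometric hp hp2 hq hq2 he hN
  rcases L with _ | ⟨M, L⟩
  · exact absurd h.nontrivial (not_nontrivial_iff_subsingleton.2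
      (inferInstanceAs (Subsingleton (Fin 0 → F))))
  have hM : IsBlock (q.coeff 1 - p.coeff 1) (fundPoly p q) e M := hL M (by simp)
  have hM0 := hM.nontrivial
  rcases subsingleton_or_nontrivial (Fin (blockSumList L).1 → F) with h0 | h0
  · have h' := h.trans
      (isSimilar_toEnd_blockSum_of_subsingleton M (blockSumList L)).symplecticExtension
    refine ⟨M, ?_, h'⟩
    obtain ⟨r, hrm, hr, hd, hs | ⟨hne, m, m', h4, h5, h6, rfl⟩⟩ := hM
    · exact ⟨r, hrm, hr, hd, Or.inl hs⟩
    · refine ⟨r, hrm, hr, hd, Or.inr ⟨hne, m, m', h4, h5, h6, ?_, rfl⟩⟩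
      -- If m' ≥ 1 and m ≤ e, each of the two companion blocks is a difference alone, so the pair
      -- decomposes.
      by_contra! hcon
      have hr' := reflection_irreducible (q.coeff 1 - p.coeff 1) hr
      have hrm' := reflection_monic (q.coeff 1 - p.coeff 1) hrm
      have n1 := nontrivial_companion_pow hr hrm h4
      have n2 := nontrivial_companion_pow hr' hrm' (Nat.one_le_iff_ne_zero.2 hcon.1)
      refine hP.false_of_isIsometric
        (isDifference_companion_of_reflection_ne hp hp2 hq hq2 he hr hrm hd hne
          hcon.2).symplecticExtension
        (isDifference_companion_of_reflection_ne (m := m') hp hp2 hq hq2 he hr' hrm'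
          (reflection_dvd (fundPoly_comp_conjPoly p q) hd) ?_ (by omega)).symplecticExtension
        (h'.trans (symplecticExtension_blockSum _ _))
      rw [reflection_reflection]
      exact hne.symm
  · refine (hP.false_of_isIsometric
      (hM.isDifference hp hp2 hq hq2 hroot he).symplecticExtension
      (isDifference_blockSumList L fun N hN =>
        (hL N (by simp [hN])).isDifference hp hp2 hq hq2 hroot he).symplecticExtension
      (h.trans (symplecticExtension_blockSum _ _))).elim

/-- A nonzero vector killed by r(f) has order r, so it spans a cyclic subspace of dimension deg r
inside the kernel. -/
theorem natDegree_le_kerDim {V : Type*} [AddCommGroup V] [Module F V] [FiniteDimensional F V]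
    {f : Module.End F V} {r : F[X]} (hr : Irreducible r) (hrm : r.Monic) (h : kerDim f r ≠ 0) :
    r.natDegree ≤ kerDim f r := by
  have h0 : LinearMap.ker (aeval f r) ≠ ⊥ := fun h0 => h (by rw [kerDim, h0, finrank_bot])
  obtain ⟨x, hx, hx0⟩ := Submodule.exists_mem_ne_zero_of_ne_bot h0
  have ho : HasOrder f x r := by
    have := hasOrder_pow (f := f) (x := x) hr (m := 1) (by rwa [pow_one])
      (fun k hk => by
        obtain rfl : k = 0 := by omega
        simpa using hx0)
    rwa [pow_one] at this
  have hmem : ∀ c, cyclicMap f x r c ∈ LinearMap.ker (aeval f r) := by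
    intro c
    rw [cyclicMap_eq_aeval, LinearMap.mem_ker, ← Module.End.mul_apply, ← map_mul, mul_comm, map_mul,
      Module.End.mul_apply, LinearMap.mem_ker.1 hx, map_zero]
  have := LinearMap.finrank_le_finrank_of_injective
    (f := (cyclicMap f x r).codRestrict (LinearMap.ker (aeval f r)) hmem)
    (fun a b hab => cyclicMap_injective hrm ho (congrArg Subtype.val hab))
  rw [Module.finrank_fin_fun] at this
  exact this

theorem kerDim_pow_eq_zero {V : Type*} [AddCommGroup V] [Module F V] [FiniteDimensional F V]
    {f : Module.End F V} {r : F[X]} (h : kerDim f r = 0) (k : ℕ) : kerDim f (r ^ k) = 0 := by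
  have h1 : LinearMap.ker (aeval f r) = ⊥ := Submodule.finrank_eq_zero.1 h
  have h2 : LinearMap.ker (aeval f (r ^ k)) = ⊥ := by
    rw [LinearMap.ker_eq_bot] at *
    rw [map_pow, Module.End.coe_pow]
    exact h1.iterate k
  rw [kerDim, h2, finrank_bot]

theorem subsingleton_of_kerDim_eq_zero {V : Type*} [AddCommGroup V] [Module F V]
    [FiniteDimensional F V] {f : Module.End F V} {a : F[X]} (ha : aeval f a = 0)
    (h : kerDim f a = 0) : Subsingleton V := by
  rw [(kerDim_eq_finrank_iff f a).2 ha] at h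
  exact Module.finrank_zero_iff.1 h

theorem kerDim_blockSum (M N : SquareMatrix F) (a : F[X]) :
    kerDim (SquareMatrix.toEnd (blockSum M N)) a =
      kerDim (SquareMatrix.toEnd M) a + kerDim (SquareMatrix.toEnd N) a := by
  rw [(isSimilar_toEnd_blockSum M N).kerDim_eq, kerDim_prodMap]

theorem IsSimilar.kerDim_eq_add {U V W : Type*} [AddCommGroup U] [Module F U] [AddCommGroup V]
    [Module F V] [AddCommGroup W] [Module F W] [FiniteDimensional F V] [FiniteDimensional F W]
    {f : Module.End F U} {f₁ : Module.End F V} {f₂ : Module.End F W}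
    (h : IsSimilar f (LinearMap.prodMap f₁ f₂)) (a : F[X]) :
    kerDim f a = kerDim f₁ a + kerDim f₂ a := by
  rw [h.kerDim_eq, kerDim_prodMap]

theorem aeval_left_eq_zero_of_isSimilar {U V W : Type*} [AddCommGroup U] [Module F U]
    [AddCommGroup V] [Module F V] [AddCommGroup W] [Module F W]
    {f : Module.End F U} {f₁ : Module.End F V} {f₂ : Module.End F W}
    (h : IsSimilar f (LinearMap.prodMap f₁ f₂)) {a : F[X]} (ha : aeval f a = 0) :
    aeval f₁ a = 0 := by
  have h1 := h.aeval_eq_zero ha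
  rw [aeval_prodMap] at h1
  ext x
  simpa using congrArg Prod.fst (LinearMap.congr_fun h1 (x, (0 : W)))

/-- Each nonzero summand would contribute at least deg r to the kernel of r, but a cyclic block has
a kernel of dimension at most deg r. -/
theorem not_isSimilar_companion {V₁ V₂ : Type*} [AddCommGroup V₁] [Module F V₁] [AddCommGroup V₂]
    [Module F V₂] [FiniteDimensional F V₁] [FiniteDimensional F V₂] [Nontrivial V₁] [Nontrivial V₂]
    {f₁ : Module.End F V₁} {f₂ : Module.End F V₂} {r : F[X]} (hr : Irreducible r) (hrm : r.Monic)
    {m : ℕ} (h : IsSimilar (SquareMatrix.toEnd (companion (r ^ m))) (LinearMap.prodMap f₁ f₂)) :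
    False := by
  have hz := aeval_companion (hrm.pow m)
  have z₁ := aeval_left_eq_zero_of_isSimilar h hz
  have z₂ := aeval_left_eq_zero_of_isSimilar (h.trans (isSimilar_prodMap_comm _ _)) hz
  have n₁ : kerDim f₁ r ≠ 0 := fun h0 =>
    not_subsingleton V₁ (subsingleton_of_kerDim_eq_zero z₁ (kerDim_pow_eq_zero h0 m))
  have n₂ : kerDim f₂ r ≠ 0 := fun h0 =>
    not_subsingleton V₂ (subsingleton_of_kerDim_eq_zero z₂ (kerDim_pow_eq_zero h0 m))
  have h1 := h.kerDim_eq_add r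
  have h2 := kerDim_companion_pow hrm m 1
  rw [pow_one] at h2
  have := natDegree_le_kerDim hr hrm n₁
  have := natDegree_le_kerDim hr hrm n₂
  have : r.natDegree * min 1 m ≤ r.natDegree * 1 := Nat.mul_le_mul_left _ (min_le_left _ _)
  have := hr.natDegree_pos
  omega

/-- The nonzero summand `f₂` has no part at r, so it has one at the reflection, whose kernel has
dimension deg r; then `f₁` has none there. Interlacing for `f₁` at k = 0 stops the growth of its
kernels at r beyond exponent e, and these carry the whole block of size m. -/
theorem le_of_isSimilar_blockSum {V₁ V₂ : Type*} [AddCommGroup V₁] [Module F V₁] [AddCommGroup V₂]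
    [Module F V₂] [FiniteDimensional F V₁] [FiniteDimensional F V₂] [Nontrivial V₂]
    {f₁ : Module.End F V₁} {f₂ : Module.End F V₂} {d : F} {Φ r : F[X]}
    (hr : Irreducible r) (hrm : r.Monic)
    (hd : r ∣ Φ) (hne : reflection d r ≠ r) {m m' : ℕ}
    (h : IsSimilar (SquareMatrix.toEnd (blockSum (companion (r ^ m))
      (companion (reflection d r ^ m')))) (LinearMap.prodMap f₁ f₂))
    (hf₁ : Interlaced d Φ e f₁) (h₂ : kerDim f₂ r = 0) : m ≤ e ∧ 1 ≤ m' := by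
  have hI := hf₁ r hrm hr hd hne 0
  have hr' := reflection_irreducible d hr
  have hrm' := reflection_monic d hrm
  have hdeg := natDegree_reflection d r
  obtain ⟨s, hs⟩ : ∃ s, s = reflection d r := ⟨_, rfl⟩
  rw [← hs] at hne h hI hr' hrm' hdeg
  have hz : aeval (SquareMatrix.toEnd (blockSum (companion (r ^ m)) (companion (s ^ m'))))
      (r ^ m * s ^ m') = 0 := by
    refine (isSimilar_toEnd_blockSum _ _).symm.aeval_eq_zero ?_
    rw [aeval_prodMap, map_mul, map_mul, aeval_companion (hrm.pow m),
      aeval_companion (hrm'.pow m'), zero_mul, mul_zero, LinearMap.prodMap_zero]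
  have z₂ := aeval_left_eq_zero_of_isSimilar (h.trans (isSimilar_prodMap_comm _ _)) hz
  have hK : ∀ a, kerDim f₁ a + kerDim f₂ a = kerDim (SquareMatrix.toEnd (companion (r ^ m))) a +
      kerDim (SquareMatrix.toEnd (companion (s ^ m'))) a := fun a => by
    rw [← h.kerDim_eq_add, kerDim_blockSum]
  have hcop := isCoprime_of_irreducible hr hr' hrm hrm' hne.symm
  have n₂ : kerDim f₂ s ≠ 0 := fun h0 =>
    not_subsingleton V₂ (subsingleton_of_kerDim_eq_zero z₂ (by
      rw [kerDim_mul_of_isCoprime f₂ hcop.pow, kerDim_pow_eq_zero h0, kerDim_pow_eq_zero h₂]))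
  have hKr : ∀ k, kerDim f₁ (r ^ k) = r.natDegree * min k m := fun k => by
    rw [← kerDim_companion_pow hrm, ← add_zero (kerDim f₁ _), ← kerDim_pow_eq_zero h₂ k, hK,
      kerDim_blocks_of_ne hr' hr hrm' hrm hne.symm, add_zero]
  have hs1 := hK (s ^ 1)
  rw [kerDim_blocks_of_ne hr hr' hrm hrm' hne, kerDim_companion_pow hrm', pow_one, hdeg] at hs1
  have g₂ := natDegree_le_kerDim hr' hrm' n₂
  rw [hdeg] at g₂
  have hpos := hr.natDegree_pos
  have hm' : 1 ≤ m' := by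
    by_contra! h0
    obtain rfl : m' = 0 := by omega
    rw [Nat.min_zero, mul_zero] at hs1
    omega
  rw [min_eq_left hm', mul_one] at hs1
  have n₁ : kerDim f₁ s = 0 := by
    by_contra n₁
    have := natDegree_le_kerDim hr' hrm' n₁
    omega
  refine ⟨?_, hm'⟩
  rw [hKr, hKr, kerDim_pow_eq_zero n₁, kerDim_pow_eq_zero n₁] at hI
  have := Nat.le_of_mul_le_mul_left hI hpos
  omega

/-- The symplectic extensions of the indecomposable blocks are indecomposable. -/
theorem IsIndecomposableBlock.isIndecomposableDifference
    (hp : p.Monic) (hp2 : p.natDegree = 2)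
    (hq : q.Monic) (hq2 : q.natDegree = 2)
    (hroot : (∃ a : F, p.IsRoot a) ∨ (∃ b : F, q.IsRoot b)) (he : HasExponent p q e)
    {M : SquareMatrix F}
    (hM : IsIndecomposableBlock (q.coeff 1 - p.coeff 1) (fundPoly p q) e M) :
    (symplecticExtension (SquareMatrix.toEnd M)).IsIndecomposableDifference p q := by
  obtain ⟨N, hN⟩ := hM.isBlock.exists_aeval_eq_zero (fundPoly_comp_conjPoly p q)
  refine ⟨(hM.isBlock.isDifference hp hp2 hq hq2 hroot he).symplecticExtension,
    symplecticExtension_nontrivial_iff.2 hM.isBlock.nontrivial, ?_⟩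
  rintro ⟨V₁, V₂, _, _, _, _, P₁, P₂, _, _, h₁, h₂, h'⟩
  obtain ⟨M₁, M₂, _, _, k₁, k₂, k⟩ :=
    exists_isSimilar_of_isIsometric_orthogonalSum hp hp2 hq hq2 hroot he hN h₁ h₂ h'
  have i₁ := interlaced_of_isDifference hp hp2 hq hq2 he k₁
  have i₂ := interlaced_of_isDifference hp hp2 hq hq2 he k₂
  obtain ⟨r, hrm, hr, hd, ⟨-, m, -, rfl⟩ | ⟨hne, m, m', -, -, -, hm, rfl⟩⟩ := hM
  · exact not_isSimilar_companion hr hrm k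
  · have hlt : ¬ (m ≤ e ∧ 1 ≤ m') := by omega
    -- The r-part is a single cyclic block, so it cannot meet both summands; the summand that
    -- contains it lacks the reflected part, contrary to the size condition.
    by_cases n₂ : kerDim (SquareMatrix.toEnd M₂) r = 0
    · exact hlt (le_of_isSimilar_blockSum hr hrm hd hne k i₁ n₂)
    by_cases n₁ : kerDim (SquareMatrix.toEnd M₁) r = 0
    · exact hlt (le_of_isSimilar_blockSum hr hrm hd hne
        (k.trans (isSimilar_prodMap_comm _ _)) i₂ n₁)
    have h1 := k.kerDim_eq_add (r ^ 1)
    rw [kerDim_blockSum, kerDim_companion_pow hrm,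
      kerDim_blocks_of_ne (reflection_irreducible _ hr) hr (reflection_monic _ hrm) hrm hne.symm,
      pow_one] at h1
    have := natDegree_le_kerDim hr hrm n₁
    have := natDegree_le_kerDim hr hrm n₂
    have : r.natDegree * min 1 m ≤ r.natDegree * 1 := Nat.mul_le_mul_left _ (min_le_left _ _)
    have := hr.natDegree_pos
    omega

theorem classifiesExceptional_of_isSimilar (hp : p.Monic) (hp2 : p.natDegree = 2)
    (hq : q.Monic) (hq2 : q.natDegree = 2)
    (hroot : (∃ a : F, p.IsRoot a) ∨ (∃ b : F, q.IsRoot b)) (he : HasExponent p q e)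
    {T : Set (SquareMatrix F)}
    (h₁ : ∀ M ∈ T, IsIndecomposableBlock (q.coeff 1 - p.coeff 1) (fundPoly p q) e M)
    (h₂ : ∀ M, IsIndecomposableBlock (q.coeff 1 - p.coeff 1) (fundPoly p q) e M →
      ∃ M' ∈ T, IsSimilar (SquareMatrix.toEnd M) (SquareMatrix.toEnd M')) :
    ClassifiesExceptional.{u, w} p q T := by
  refine ⟨fun M hM => ⟨(h₁ M hM).isIndecomposableDifference hp hp2 hq hq2 hroot he, ?_⟩,
    fun W _ _ _ P hP hE => ?_⟩
  · obtain ⟨N, hN⟩ := (h₁ M hM).isBlock.exists_aeval_eq_zero (fundPoly_comp_conjPoly p q)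
    exact (isExceptional_iff hp hp2 hq hq2 hroot _).2 ⟨N, aeval_symplecticExtension_eq_zero hN⟩
  · obtain ⟨N, hN⟩ := (isExceptional_iff hp hp2 hq hq2 hroot _).1 hE
    obtain ⟨M, hM, h⟩ := hP.exists_isIsometric hp hp2 hq hq2 hroot he hN
    obtain ⟨M', hM', h'⟩ := h₂ M hM
    exact ⟨M', hM', h.trans h'.symplecticExtension⟩

end Indecomposable

/-! ### From indecomposable blocks to the listed matrices. -/

section Tables

variable {F : Type u} [Field F] {p q : F[X]}

theorem hasExponent_of_forall_reflection_eq {e : ℕ}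
    (h : ∀ r : F[X], r.Monic → Irreducible r → r ∣ fundPoly p q →
      reflection (q.coeff 1 - p.coeff 1) r = r) : HasExponent p q e :=
  fun r hrm hr hd hne => absurd (h r hrm hr hd) hne

theorem hasExponent_one_of_eq_mul {r₁ r₂ : F[X]} (hm₁ : r₁.Monic) (hm₂ : r₂.Monic)
    (hi₁ : Irreducible r₁) (hi₂ : Irreducible r₂) (hΦ : fundPoly p q = r₁ * r₂)
    (h : reflection (q.coeff 1 - p.coeff 1) r₁ = r₂) : HasExponent p q 1 := by
  intro r hrm hr hd hne
  rw [hΦ] at hd ⊢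
  rcases eq_or_eq_of_dvd_mul hr hrm hi₁ hm₁ hi₂ hm₂ hd with rfl | rfl
  · exact ⟨r₂, by rw [pow_one], isCoprime_of_irreducible hi₁ hi₂ hm₁ hm₂ (h ▸ hne.symm)⟩
  · have hne' : r₁ ≠ r := by
      rintro rfl
      exact hne h
    exact ⟨r₁, by rw [pow_one, mul_comm], isCoprime_of_irreducible hi₂ hi₁ hm₂ hm₁ hne'.symm⟩

theorem isCoprime_X_sub_C {x y : F} (h : x ≠ y) : IsCoprime (X - C x) (X - C y) :=
  isCoprime_X_sub_C_of_isUnit_sub (sub_ne_zero.2 h).isUnit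

/-- Among the four roots of F_{p,q}, a - b equals a - b' or a' - b only if p or q has a double root,
and it equals a' - b' only if it is its own reflection. Thus every other root is simple. -/
theorem hasExponent_one_of_simple {a a' b b' : F} (ha : a ≠ a') (hb : b ≠ b') :
    HasExponent ((X - C a) * (X - C a')) ((X - C b) * (X - C b')) 1 := by
  intro r hrm hr hd hne
  have hd' := eq_of_dvd_fundPoly_of_split hr hrm hd
  rw [fundPoly_of_split]
  rw [coeff_one_mul_X_sub_C, coeff_one_mul_X_sub_C] at hne
  have key : ∀ x, r = X - C x → a + a' - (b + b') ≠ 2 * x := by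
    rintro x rfl h
    refine hne ?_
    rw [reflection_X_sub_C]
    congr 2
    linear_combination h
  have cop : ∀ x y z t : F, x ≠ y → x ≠ z → x ≠ t →
      IsCoprime (X - C x) ((X - C y) * (X - C z) * (X - C t)) := fun x y z t h1 h2 h3 =>
    ((isCoprime_X_sub_C h1).mul_right (isCoprime_X_sub_C h2)).mul_right (isCoprime_X_sub_C h3)
  rcases hd' with h | h | h | h <;> have hk := key _ h <;> subst h
  · refine ⟨_, ?_, cop _ (a' - b') (a - b') (a' - b) (fun h => ?_) (fun h => ?_) (fun h => ?_)⟩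
    · ring
    · exact hk (by linear_combination -h)
    · exact hb (by linear_combination -h)
    · exact ha (by linear_combination h)
  · refine ⟨_, ?_, cop _ (a - b) (a - b') (a' - b) (fun h => ?_) (fun h => ?_) (fun h => ?_)⟩
    · ring
    · exact hk (by linear_combination -h)
    · exact ha (by linear_combination -h)
    · exact hb (by linear_combination h)
  · refine ⟨_, ?_, cop _ (a - b) (a' - b') (a' - b) (fun h => ?_) (fun h => ?_) (fun h => ?_)⟩
    · ring
    · exact hb (by linear_combination h)
    · exact ha (by linear_combination h)
    · exact hk (by linear_combination -h)
  · refine ⟨_, ?_, cop _ (a - b) (a' - b') (a - b') (fun h => ?_) (fun h => ?_) (fun h => ?_)⟩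
    · ring
    · exact ha (by linear_combination -h)
    · exact hb (by linear_combination -h)
    · exact hk (by linear_combination -h)

theorem hasExponent_two_of_eq_mul {x y : F} (hxy : x ≠ y)
    (h : fundPoly p q = (X - C x) ^ 2 * (X - C y) ^ 2) : HasExponent p q 2 := by
  intro r hrm hr hd _
  rw [h] at hd ⊢
  have hc := (isCoprime_X_sub_C hxy).pow (m := 2) (n := 2)
  rcases hr.prime.dvd_or_dvd hd with hd | hd <;> have hd := hr.prime.dvd_of_dvd_pow hd <;>
    rw [hr.dvd_irreducible_iff_associated (irreducible_X_sub_C _)] at hd <;>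
    have hd := eq_of_monic_of_associated hrm (monic_X_sub_C _) hd <;> subst hd
  · exact ⟨_, rfl, (isCoprime_X_sub_C hxy).pow_right⟩
  · exact ⟨_, mul_comm _ _, (isCoprime_X_sub_C hxy.symm).pow_right⟩

theorem fundPoly_of_right_eq {a a' b : F} :
    fundPoly ((X - C a) * (X - C a')) ((X - C b) * (X - C b)) =
      (X - C (a - b)) ^ 2 * (X - C (a' - b)) ^ 2 := by
  rw [fundPoly_of_split]
  ring

theorem fundPoly_of_left_eq {a b b' : F} :
    fundPoly ((X - C a) * (X - C a)) ((X - C b) * (X - C b')) =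
      (X - C (a - b)) ^ 2 * (X - C (a - b')) ^ 2 := by
  rw [fundPoly_of_split]
  ring

theorem hasExponent_two_of_right_eq {a a' b : F} (ha : a ≠ a') :
    HasExponent ((X - C a) * (X - C a')) ((X - C b) * (X - C b)) 2 :=
  hasExponent_two_of_eq_mul (fun h => ha (by linear_combination h)) fundPoly_of_right_eq

theorem hasExponent_two_of_left_eq {a b b' : F} (hb : b ≠ b') :
    HasExponent ((X - C a) * (X - C a)) ((X - C b) * (X - C b')) 2 :=
  hasExponent_two_of_eq_mul (fun h => hb (by linear_combination -h)) fundPoly_of_left_eq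

theorem mem_rootDifferences_mul {a a' b b' x : F} :
    x ∈ rootDifferences ((X - C a) * (X - C a')) ((X - C b) * (X - C b')) ↔
      x = a - b ∨ x = a' - b' ∨ x = a - b' ∨ x = a' - b := by
  have key : ∀ c c' y : F, ((X - C c) * (X - C c')).IsRoot y ↔ y = c ∨ y = c' := fun c c' y => by
    simp [sub_eq_zero]
  simp only [rootDifferences, key, Set.mem_ofPred_eq]
  constructor
  · rintro ⟨s, t, rfl | rfl, rfl | rfl, rfl⟩ <;> simp
  · rintro (rfl | rfl | rfl | rfl)
    · exact ⟨_, _, Or.inl rfl, Or.inl rfl, rfl⟩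
    · exact ⟨_, _, Or.inr rfl, Or.inr rfl, rfl⟩
    · exact ⟨_, _, Or.inl rfl, Or.inr rfl, rfl⟩
    · exact ⟨_, _, Or.inr rfl, Or.inl rfl, rfl⟩

theorem exists_mem_rootDifferences {a a' b b' : F} {r : F[X]} (hr : Irreducible r) (hrm : r.Monic)
    (h : r ∣ fundPoly ((X - C a) * (X - C a')) ((X - C b) * (X - C b'))) :
    ∃ x ∈ rootDifferences ((X - C a) * (X - C a')) ((X - C b) * (X - C b')), r = X - C x := by
  simp only [mem_rootDifferences_mul]
  rcases eq_of_dvd_fundPoly_of_split hr hrm h with h | h | h | h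
  · exact ⟨_, Or.inl rfl, h⟩
  · exact ⟨_, Or.inr (Or.inl rfl), h⟩
  · exact ⟨_, Or.inr (Or.inr (Or.inl rfl)), h⟩
  · exact ⟨_, Or.inr (Or.inr (Or.inr rfl)), h⟩

theorem X_sub_C_dvd_fundPoly {a a' b b' x : F}
    (h : x ∈ rootDifferences ((X - C a) * (X - C a')) ((X - C b) * (X - C b'))) :
    X - C x ∣ fundPoly ((X - C a) * (X - C a')) ((X - C b) * (X - C b')) := by
  rw [fundPoly_of_split]
  rcases mem_rootDifferences_mul.1 h with rfl | rfl | rfl | rfl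
  · exact (dvd_mul_right _ _).mul_right _
  · exact (dvd_mul_left _ _).mul_right _
  · exact (dvd_mul_right _ _).mul_left _
  · exact (dvd_mul_left _ _).mul_left _

theorem polyTrace_sub_polyTrace (hp2 : p.natDegree = 2) (hq2 : q.natDegree = 2) :
    polyTrace p - polyTrace q = q.coeff 1 - p.coeff 1 := by
  rw [polyTrace, polyTrace, hp2, hq2]
  ring

theorem exists_hasExponent (hp : p.Monic) (hp2 : p.natDegree = 2)
    (hq : q.Monic) (hq2 : q.natDegree = 2)
    (hroot : (∃ a : F, p.IsRoot a) ∨ (∃ b : F, q.IsRoot b)) : ∃ e, HasExponent p q e := by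
  rcases split_cases hp hp2 hq hq2 hroot with ⟨⟨a, a', rfl⟩, b, b', rfl⟩ | ⟨hirr, b, b', rfl⟩ |
    ⟨hirr, a, a', rfl⟩
  · by_cases ha : a = a' <;> by_cases hb : b = b'
    · subst ha hb
      -- With two double roots the only root of F_{p,q} is its own reflection, so the exponent
      -- condition is vacuous and 0 is a free choice.
      refine ⟨0, hasExponent_of_forall_reflection_eq fun r hrm hr hd => ?_⟩
      rcases eq_of_dvd_fundPoly_of_split hr hrm hd with rfl | rfl | rfl | rfl <;>
        rw [reflection_X_sub_C, coeff_one_mul_X_sub_C, coeff_one_mul_X_sub_C] <;> congr 2 <;> ring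
    · subst ha
      exact ⟨2, hasExponent_two_of_left_eq hb⟩
    · subst hb
      exact ⟨2, hasExponent_two_of_right_eq ha⟩
    · exact ⟨1, hasExponent_one_of_simple ha hb⟩
  · exact ⟨1, hasExponent_one_of_eq_mul (hp.comp_X_add_C b) (hp.comp_X_add_C b')
      (irreducible_comp_X_add_C hirr b) (irreducible_comp_X_add_C hirr b')
      (fundPoly_of_right hp hp2 b b') (reflection_comp_X_add_C hp hp2 b b')⟩
  · exact ⟨1, hasExponent_one_of_eq_mul (monic_comp_C_sub_X hq hq2 a)
      (monic_comp_C_sub_X hq hq2 a') (irreducible_comp_C_sub_X hq2 hirr a)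
      (irreducible_comp_C_sub_X hq2 hirr a')
      (fundPoly_of_left a a' hq hq2) (reflection_comp_C_sub_X hq hq2 a a')⟩

theorem classifiesExceptional_tableIrredSame (hp : p.Monic) (hp2 : p.natDegree = 2)
    (hq : q.Monic) (hq2 : q.natDegree = 2)
    (hroot : (∃ a : F, p.IsRoot a) ∨ (∃ b : F, q.IsRoot b)) {r : F[X]} (hrm : r.Monic)
    (hr : Irreducible r) (hrΦ : r ∣ fundPoly p q)
    (hu : ∀ s : F[X], s.Monic → Irreducible s → s ∣ fundPoly p q → s = r)
    (h : reflection (q.coeff 1 - p.coeff 1) r = r) :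
    ClassifiesExceptional.{u, w} p q (tableIrredSame r) := by
  refine classifiesExceptional_of_isSimilar (e := 0) hp hp2 hq hq2 hroot
    (hasExponent_of_forall_reflection_eq fun s hsm hs hd => by rw [hu s hsm hs hd, h]) ?_ ?_
  · rintro _ ⟨n, hn, rfl⟩
    exact ⟨r, hrm, hr, hrΦ, Or.inl ⟨h, n, hn, rfl⟩⟩
  · rintro M ⟨s, hsm, hs, hd, hM⟩
    obtain rfl := hu s hsm hs hd
    rcases hM with ⟨-, m, hm, rfl⟩ | ⟨hne, -⟩
    · exact ⟨_, ⟨m, hm, rfl⟩, IsSimilar.refl _⟩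
    · exact absurd h hne

theorem isSimilar_toEnd_blockSum_comm (M N : SquareMatrix F) :
    IsSimilar (SquareMatrix.toEnd (blockSum M N)) (SquareMatrix.toEnd (blockSum N M)) :=
  ((isSimilar_toEnd_blockSum M N).trans (isSimilar_prodMap_comm _ _)).trans
    (isSimilar_toEnd_blockSum N M).symm

/-- With e = 1, indecomposability reads m' = 0 or m ≥ 2. Equal sizes thus start at 2, while sizes (n
+ 1, n) are all admitted. Equal sizes are listed with r₁ first only, so the other order is handled
up to similarity. -/
theorem classifiesExceptional_tableIrredDistinct (hp : p.Monic) (hp2 : p.natDegree = 2)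
    (hq : q.Monic) (hq2 : q.natDegree = 2)
    (hroot : (∃ a : F, p.IsRoot a) ∨ (∃ b : F, q.IsRoot b)) {r₁ r₂ : F[X]} (hm₁ : r₁.Monic)
    (hm₂ : r₂.Monic) (hi₁ : Irreducible r₁) (hi₂ : Irreducible r₂) (hΦ : fundPoly p q = r₁ * r₂)
    (h : reflection (q.coeff 1 - p.coeff 1) r₁ = r₂) (hne : r₁ ≠ r₂) :
    ClassifiesExceptional.{u, w} p q (tableIrredDistinct r₁ r₂) := by
  have h' : reflection (q.coeff 1 - p.coeff 1) r₂ = r₁ := by rw [← h, reflection_reflection]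
  have hd₁ : r₁ ∣ fundPoly p q := hΦ ▸ dvd_mul_right r₁ r₂
  have hd₂ : r₂ ∣ fundPoly p q := hΦ ▸ dvd_mul_left r₂ r₁
  refine classifiesExceptional_of_isSimilar (e := 1) hp hp2 hq hq2 hroot
    (hasExponent_one_of_eq_mul hm₁ hm₂ hi₁ hi₂ hΦ h) ?_ ?_
  · rintro _ ⟨n, ⟨hn, rfl⟩ | rfl | rfl⟩
    · exact ⟨r₁, hm₁, hi₁, hd₁, Or.inr ⟨h.symm ▸ hne.symm, n, n, by omega, by omega, by omega,
        by omega, by rw [h]⟩⟩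
    · exact ⟨r₁, hm₁, hi₁, hd₁, Or.inr ⟨h.symm ▸ hne.symm, n + 1, n, by omega, by omega, by omega,
        by omega, by rw [h]⟩⟩
    · exact ⟨r₂, hm₂, hi₂, hd₂, Or.inr ⟨h'.symm ▸ hne, n + 1, n, by omega, by omega, by omega,
        by omega, by rw [h']⟩⟩
  · rintro M ⟨s, hsm, hs, hd, hM⟩
    rcases eq_or_eq_of_dvd_mul hs hsm hi₁ hm₁ hi₂ hm₂ (hΦ ▸ hd) with rfl | rfl <;>
      rcases hM with ⟨hself, -⟩ | ⟨-, m, m', h1, h2, h3, h4, rfl⟩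
    · exact absurd (hself.symm.trans h) hne
    · rw [h]
      rcases (by omega : m = m' ∨ m = m' + 1) with rfl | rfl
      · exact ⟨_, ⟨m, Or.inl ⟨by omega, rfl⟩⟩, IsSimilar.refl _⟩
      · exact ⟨_, ⟨m', Or.inr (Or.inl rfl)⟩, IsSimilar.refl _⟩
    · exact absurd (h'.symm.trans hself) hne
    · rw [h']
      rcases (by omega : m = m' ∨ m = m' + 1) with rfl | rfl
      · exact ⟨_, ⟨m, Or.inl ⟨by omega, rfl⟩⟩, isSimilar_toEnd_blockSum_comm _ _⟩
      · exact ⟨_, ⟨m', Or.inr (Or.inr rfl)⟩, IsSimilar.refl _⟩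

theorem tableDoubleDouble_eq (a b : F) :
    tableDoubleDouble ((X - C a) * (X - C a)) ((X - C b) * (X - C b)) =
      tableIrredSame (X - C (a - b)) := by
  ext M
  simp only [tableDoubleDouble, tableIrredSame, mem_rootDifferences_mul, or_self,
    exists_eq_left, Set.mem_ofPred_eq]

theorem isIndecomposableBlock_X_sub_C {a a' b b' d x : F} {e : ℕ}
    (hx : x ∈ rootDifferences ((X - C a) * (X - C a')) ((X - C b) * (X - C b'))) (h : x ≠ d - x)
    {m m' : ℕ} (h1 : 1 ≤ m) (h2 : m' ≤ m) (h3 : m ≤ m' + e) (h4 : m' = 0 ∨ e < m) :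
    IsIndecomposableBlock d (fundPoly ((X - C a) * (X - C a')) ((X - C b) * (X - C b'))) e
      (blockSum (companion ((X - C x) ^ m)) (companion ((X - C (d - x)) ^ m'))) := by
  refine ⟨X - C x, monic_X_sub_C x, irreducible_X_sub_C x, X_sub_C_dvd_fundPoly hx, Or.inr
    ⟨fun h' => h ?_, m, m', h1, h2, h3, h4, by rw [reflection_X_sub_C]⟩⟩
  rw [reflection_X_sub_C] at h'
  exact (C_injective (sub_right_injective h')).symm

theorem classifiesExceptional_tableSimpleSimple {a a' b b' : F} (ha : a ≠ a') (hb : b ≠ b') :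
    ClassifiesExceptional.{u, w} ((X - C a) * (X - C a')) ((X - C b) * (X - C b'))
      (tableSimpleSimple ((X - C a) * (X - C a')) ((X - C b) * (X - C b'))
        (((X - C b) * (X - C b')).coeff 1 - ((X - C a) * (X - C a')).coeff 1)) := by
  refine classifiesExceptional_of_isSimilar (e := 1) (monic_mul_X_sub_C _ _)
    (natDegree_mul_X_sub_C _ _) (monic_mul_X_sub_C _ _) (natDegree_mul_X_sub_C _ _)
    (Or.inl ⟨a, by simp⟩) (hasExponent_one_of_simple ha hb) ?_ ?_
  · rintro _ ⟨n, x, hx, ⟨hn, hne, rfl⟩ | ⟨hne, rfl⟩ | ⟨hn, heq, rfl⟩⟩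
    · exact isIndecomposableBlock_X_sub_C hx hne (by omega) le_rfl (by omega) (by omega)
    · exact isIndecomposableBlock_X_sub_C hx hne (by omega) (by omega) le_rfl (by omega)
    · exact ⟨_, monic_X_sub_C x, irreducible_X_sub_C x, X_sub_C_dvd_fundPoly hx,
        Or.inl ⟨by rw [reflection_X_sub_C, ← heq], n, hn, rfl⟩⟩
  · rintro M ⟨r, hrm, hr, hd, hM⟩
    refine ⟨M, ?_, IsSimilar.refl _⟩
    obtain ⟨x, hx, rfl⟩ := exists_mem_rootDifferences hr hrm hd
    rw [reflection_X_sub_C] at hM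
    rcases hM with ⟨hself, m, hm, rfl⟩ | ⟨hne, m, m', h1, h2, h3, h4, rfl⟩
    · exact ⟨m, x, hx, Or.inr (Or.inr
        ⟨hm, (C_injective (sub_right_injective hself)).symm, rfl⟩)⟩
    · have hne' : x ≠ (((X - C b) * (X - C b')).coeff 1 - ((X - C a) * (X - C a')).coeff 1) - x :=
        fun h => hne (by rw [← h])
      rcases (by omega : m = m' ∨ m = m' + 1) with rfl | rfl
      · exact ⟨m, x, hx, Or.inl ⟨by omega, hne', rfl⟩⟩
      · exact ⟨m', x, hx, Or.inr (Or.inl ⟨hne', rfl⟩)⟩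

/-- With e = 2, indecomposability reads m' = 0 or m ≥ 3. Hence (n, n) requires n ≥ 3, (n + 1, n)
excludes exactly n = 1, and (n + 2, n) is unrestricted. -/
theorem classifiesExceptional_tableSimpleDouble {a a' b b' : F}
    (he : HasExponent ((X - C a) * (X - C a')) ((X - C b) * (X - C b')) 2)
    (hne : ∀ x ∈ rootDifferences ((X - C a) * (X - C a')) ((X - C b) * (X - C b')),
      x ≠ (((X - C b) * (X - C b')).coeff 1 - ((X - C a) * (X - C a')).coeff 1) - x) :
    ClassifiesExceptional.{u, w} ((X - C a) * (X - C a')) ((X - C b) * (X - C b'))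
      (tableSimpleDouble ((X - C a) * (X - C a')) ((X - C b) * (X - C b'))
        (((X - C b) * (X - C b')).coeff 1 - ((X - C a) * (X - C a')).coeff 1)) := by
  refine classifiesExceptional_of_isSimilar (e := 2) (monic_mul_X_sub_C _ _)
    (natDegree_mul_X_sub_C _ _) (monic_mul_X_sub_C _ _) (natDegree_mul_X_sub_C _ _)
    (Or.inl ⟨a, by simp⟩) he ?_ ?_
  · rintro _ ⟨n, x, hx, ⟨hn, rfl⟩ | ⟨hn, rfl⟩ | rfl⟩
    · exact isIndecomposableBlock_X_sub_C hx (hne x hx) (by omega) le_rfl (by omega) (by omega)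
    · exact isIndecomposableBlock_X_sub_C hx (hne x hx) (by omega) (by omega) (by omega) (by omega)
    · exact isIndecomposableBlock_X_sub_C hx (hne x hx) (by omega) (by omega) le_rfl (by omega)
  · rintro M ⟨r, hrm, hr, hd, hM⟩
    refine ⟨M, ?_, IsSimilar.refl _⟩
    obtain ⟨x, hx, rfl⟩ := exists_mem_rootDifferences hr hrm hd
    rw [reflection_X_sub_C] at hM
    rcases hM with ⟨hself, m, hm, rfl⟩ | ⟨-, m, m', h1, h2, h3, h4, rfl⟩
    · exact absurd (C_injective (sub_right_injective hself)).symm (hne x hx)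
    · rcases (by omega : m = m' ∨ m = m' + 1 ∨ m = m' + 2) with rfl | rfl | rfl
      · exact ⟨m, x, hx, Or.inl ⟨by omega, rfl⟩⟩
      · exact ⟨m', x, hx, Or.inr (Or.inl ⟨by omega, rfl⟩)⟩
      · exact ⟨m', x, hx, Or.inr (Or.inr rfl)⟩

end Tables

/-! ### Assembly of the theorem. -/

theorem mainTheorem11 {F : Type u} [Field F] (p q : F[X])
    (hp : p.Monic) (hp2 : p.natDegree = 2) (hq : q.Monic) (hq2 : q.natDegree = 2)
    (hroot : (∃ a : F, p.IsRoot a) ∨ (∃ b : F, q.IsRoot b)) :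
    (∀ (V : Type v) [AddCommGroup V] [Module F V] [FiniteDimensional F V]
        (f : Module.End F V), IsExceptional p q f →
        (IsDifference p q f ↔ (symplecticExtension f).IsDifference p q) ∧
        (IsIndecomposableDifference p q f ↔
          (symplecticExtension f).IsIndecomposableDifference p q)) ∧
    ((∃ a b : F, p = (X - C a) ^ 2 ∧ q = (X - C b) ^ 2) →
      ClassifiesExceptional.{u, w} p q (tableDoubleDouble p q)) ∧
    ((∃ a a' b b' : F, a ≠ a' ∧ b ≠ b' ∧
        p = (X - C a) * (X - C a') ∧ q = (X - C b) * (X - C b')) →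
      ClassifiesExceptional.{u, w} p q
        (tableSimpleSimple p q (polyTrace p - polyTrace q))) ∧
    (((∃ a a' b : F, a ≠ a' ∧ p = (X - C a) * (X - C a') ∧ q = (X - C b) ^ 2) ∨
        (∃ a b b' : F, b ≠ b' ∧ p = (X - C a) ^ 2 ∧ q = (X - C b) * (X - C b'))) →
      ClassifiesExceptional.{u, w} p q
        (tableSimpleDouble p q (polyTrace p - polyTrace q))) ∧
    (∀ y₁ y₂ : F, Irreducible p → q = (X - C y₁) * (X - C y₂) →
      (p.comp (X + C y₁) = p.comp (X + C y₂) →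
        ClassifiesExceptional.{u, w} p q (tableIrredSame (p.comp (X + C y₁)))) ∧
      (p.comp (X + C y₁) ≠ p.comp (X + C y₂) →
        ClassifiesExceptional.{u, w} p q
          (tableIrredDistinct (p.comp (X + C y₁)) (p.comp (X + C y₂))))) ∧
    (∀ x₁ x₂ : F, Irreducible q → p = (X - C x₁) * (X - C x₂) →
      (q.comp (C x₁ - X) = q.comp (C x₂ - X) →
        ClassifiesExceptional.{u, w} p q (tableIrredSame (q.comp (C x₁ - X)))) ∧
      (q.comp (C x₁ - X) ≠ q.comp (C x₂ - X) →
        ClassifiesExceptional.{u, w} p q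
          (tableIrredDistinct (q.comp (C x₁ - X)) (q.comp (C x₂ - X))))) := by
  refine ⟨fun V _ _ _ f hf => ?_, ?_, ?_, ?_, fun y₁ y₂ hirr hsplit => ?_,
    fun x₁ x₂ hirr hsplit => ?_⟩
  · obtain ⟨e, he⟩ := exists_hasExponent hp hp2 hq hq2 hroot
    obtain ⟨N, hN⟩ := (isExceptional_iff hp hp2 hq hq2 hroot f).1 hf
    exact ⟨isDifference_iff hp hp2 hq hq2 hroot he hN,
      isIndecomposableDifference_iff hp hp2 hq hq2 hroot he hN⟩
  · rintro ⟨a, b, rfl, rfl⟩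
    rw [pow_two, pow_two] at *
    rw [tableDoubleDouble_eq]
    refine classifiesExceptional_tableIrredSame hp hp2 hq hq2 hroot (monic_X_sub_C _)
      (irreducible_X_sub_C _) (X_sub_C_dvd_fundPoly (mem_rootDifferences_mul.2 (Or.inl rfl)))
      (fun s hsm hs hd => ?_) ?_
    · rcases eq_of_dvd_fundPoly_of_split hs hsm hd with h | h | h | h <;> exact h
    · rw [reflection_X_sub_C, coeff_one_mul_X_sub_C, coeff_one_mul_X_sub_C]
      congr 2
      ring
  · rintro ⟨a, a', b, b', ha, hb, rfl, rfl⟩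
    rw [polyTrace_sub_polyTrace hp2 hq2]
    exact classifiesExceptional_tableSimpleSimple ha hb
  · rw [polyTrace_sub_polyTrace hp2 hq2]
    rintro (⟨a, a', b, ha, rfl, rfl⟩ | ⟨a, b, b', hb, rfl, rfl⟩)
    · rw [pow_two (X - C b)]
      refine classifiesExceptional_tableSimpleDouble (hasExponent_two_of_right_eq ha) ?_
      intro x hx h
      rw [coeff_one_mul_X_sub_C, coeff_one_mul_X_sub_C] at h
      rcases mem_rootDifferences_mul.1 hx with rfl | rfl | rfl | rfl
      · exact ha (by linear_combination h)
      · exact ha (by linear_combination -h)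
      · exact ha (by linear_combination h)
      · exact ha (by linear_combination -h)
    · rw [pow_two (X - C a)]
      refine classifiesExceptional_tableSimpleDouble (hasExponent_two_of_left_eq hb) ?_
      intro x hx h
      rw [coeff_one_mul_X_sub_C, coeff_one_mul_X_sub_C] at h
      rcases mem_rootDifferences_mul.1 hx with rfl | rfl | rfl | rfl
      · exact hb (by linear_combination -h)
      · exact hb (by linear_combination h)
      · exact hb (by linear_combination h)
      · exact hb (by linear_combination -h)
  · subst hsplit
    refine ⟨fun h => ?_, fun h => ?_⟩
    · refine classifiesExceptional_tableIrredSame hp hp2 hq hq2 hroot (hp.comp_X_add_C y₁)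
        (irreducible_comp_X_add_C hirr y₁) ?_ (fun s hsm hs hd => ?_) ?_
      · exact fundPoly_of_right hp hp2 y₁ y₂ ▸ dvd_mul_right _ _
      · exact (eq_of_dvd_fundPoly_left hp hp2 hirr hs hsm hd).elim id fun h' => h'.trans h.symm
      · rw [reflection_comp_X_add_C hp hp2, ← h]
    · exact classifiesExceptional_tableIrredDistinct hp hp2 hq hq2 hroot (hp.comp_X_add_C y₁)
        (hp.comp_X_add_C y₂) (irreducible_comp_X_add_C hirr y₁) (irreducible_comp_X_add_C hirr y₂)
        (fundPoly_of_right hp hp2 y₁ y₂) (reflection_comp_X_add_C hp hp2 y₁ y₂) h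
  · subst hsplit
    refine ⟨fun h => ?_, fun h => ?_⟩
    · refine classifiesExceptional_tableIrredSame hp hp2 hq hq2 hroot (monic_comp_C_sub_X hq hq2 x₁)
        (irreducible_comp_C_sub_X hq2 hirr x₁) ?_ (fun s hsm hs hd => ?_) ?_
      · exact fundPoly_of_left x₁ x₂ hq hq2 ▸ dvd_mul_right _ _
      · exact (eq_of_dvd_fundPoly_right hq hq2 hirr hs hsm hd).elim id fun h' => h'.trans h.symm
      · rw [reflection_comp_C_sub_X hq hq2, ← h]
    · exact classifiesExceptional_tableIrredDistinct hp hp2 hq hq2 hroot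
        (monic_comp_C_sub_X hq hq2 x₁) (monic_comp_C_sub_X hq hq2 x₂)
        (irreducible_comp_C_sub_X hq2 hirr x₁) (irreducible_comp_C_sub_X hq2 hirr x₂)
        (fundPoly_of_left x₁ x₂ hq hq2) (reflection_comp_C_sub_X hq hq2 x₁ x₂) h
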